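/- **Setting.** Fix $p\ge 0$, $q\ge1$, $\alpha\in(0,1)$, $\beta\in\mathbb R^q$ and a $p\times p$ positive semidefinite matrix $T$. Study $i=1,2,\dots$ reports a subset of $p_i\le p$ effects; let $X_i\in\mathbb R^{p_i\times q}$ be its (non-random) design matrix, $T_i$ the corresponding $p_i\times p_i$ submatrix of $T$, $V_i$ a known positive semidefinite $p_i\times p_i$ matrix, and $$Y_i=X_i\beta+u_i+\varepsilon_i,\qquad u_i\sim\mathcal N(0,T_i),\quad \varepsilon_i\sim\mathcal N(0,V_i),$$ where $u_i$ and $\varepsilon_i$ are independent and the studies are independent of each other. For each number $k$ of studies let $\widehat T=\widehat T^{(k)}$ be a random symmetric $p\times p$ matrix, $\widehat T_i$ its $p_i\times p_i$ submatrix for study $i$, $\widehat S_i=\widehat T_i+V_i$, $\widehat W_i=\widehat S_i^{-1}$, and put, with block-diagonal $\widehat W$ and stacked $X,Y$ over $i\le k$, $$M=(X'\widehat WX)^{-1},\quad \hat\beta=MX'\widehat WY,\quad E_i=Y_i-X_i\hat\beta,\quad H_i=X_iMX_i'\widehat W_i,\quad \Delta_i=\operatorname{diag}(E_iE_i'),$$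 so that $H_i$ is the diagonal block of the hat matrix $H=XMX'\widehat W$ for study $i$. For matrices $\Omega_i$ let $\mathcal S(\Omega)=M\bigl(\sum_{i=1}^kX_i'\widehat W_i\Omega_i\widehat W_iX_i\bigr)M$. The cluster-robust estimators of $\operatorname{Cov}(\hat\beta)$ are - $CR_0$: $\mathcal S(\Omega)$ with $\Omega_i=E_iE_i'$; $CR_1$: $\frac{k}{k-1}CR_0$; $CR_1^*$: $\frac{k}{k-q}CR_0$; - $CR_2$: $\Omega_i=A_iE_iE_i'A_i'$ with $A_i=\widehat S_i^{1/2}\bigl[\widehat S_i^{1/2}(\widehat S_i-X_iMX_i')\widehat S_i^{1/2}\bigr]^{-1/2}\widehat S_i^{1/2}$ (symmetric roots); - $CR_3$: $\Omega_i=(I-H_i)^{-1}E_iE_i'\bigl((I-H_i)^{-1}\bigr)'$; - $CR_3^*$: $\Omega_i=E_iE_i'-\Delta_i+\Delta_i(I-\operatorname{diag}H_i)^{-2}$; - $CR_4^*$: $\Omega_i=E_iE_i'-\Delta_i+\Delta_iG_i$, where $G_i$ is diagonal with $r$-th entry $(1-h_r)^{-\delta_r}$, $h_r=(H_i)_{rr}$,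 $\delta_r=\min\{4,h_r/\bar h\}$, and $\bar h$ is the average of all diagonal entries of $H$. For an estimator $\widehat\Sigma$ among these let $$\Lambda=\bigl\{b\in\mathbb R^q:(\hat\beta-b)'\widehat\Sigma^{-1}(\hat\beta-b)\le q\,F_{q,\max(2,k-q),1-\alpha}\bigr\},$$ where $F_{m,n,1-\alpha}$ is the $(1-\alpha)$-quantile of the $F$-distribution with $m$ and $n$ degrees of freedom. **Theorem.** Assume: 1. the entries of all $X_i$ and $V_i$ are bounded by a constant, and there is $c>0$ such that $T_i+V_i\succeq cI$ for all $i$ (the latter holds if $T$ is positive definite); 2. $\widehat T\to T$ in probability, entrywise, as $k\to\infty$; 3. $k(X'\widehat WX)^{-1}$ exists and is uniformly bounded entrywise in probability: for every $\eta>0$ there are $k_0$ and $C$ such that for all $k\ge k_0$, with probability at least $1-\eta$, $X'\widehat WX$ is invertible and all entries of $k(X'\widehat WX)^{-1}$ are at most $C$ in absolute value. (This holds in particular if, almost surely, the inverse exists and the entries are bounded by one constant for all $k\ge k_0$.) Then the estimators $CR_0,CR_1,CR_1^*,CR_2,CR_3,CR_3^*,CR_4^*$ are asymptotically equivalent: for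 any two of them, $\widehat\Sigma_a-\widehat\Sigma_b\to0$ and even $k(\widehat\Sigma_a-\widehat\Sigma_b)\to0$ entrywise in probability as $k\to\infty$. Moreover, for each of them, $P(\beta\in\Lambda)\to1-\alpha$ as $k\to\infty$. -/

import Mathlib

open MeasureTheory ProbabilityTheory Filter Topology
open scoped Matrix

noncomputable section

namespace MetaRegression

/-- The block of a `p × p` matrix that belongs to the set `s` of observed effects. -/
def block {p : ℕ} (T : Matrix (Fin p) (Fin p) ℝ) (s : Finset (Fin p)) : Matrix s s ℝ :=
  T.submatrix Subtype.val Subtype.val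

/-- What the analyst works with, for a sequence of studies `0, 1, 2, …`: the set of the effects
(out of `p`) that each study reports, its design matrix, its working covariance matrix
`S i` (an estimate of the total covariance of the effects of study `i`) and its vector of
observed effects. -/
structure Data (p q : ℕ) where
  obs : ℕ → Finset (Fin p)
  X : ∀ i, Matrix (obs i) (Fin q) ℝ
  S : ∀ i, Matrix (obs i) (obs i) ℝ
  Y : ∀ i, obs i → ℝ

namespace Data

variable {p q : ℕ} (D : Data p q) (k : ℕ)

/-- The inverse variance weights of study `i`. -/
def W (i : ℕ) : Matrix (D.obs i) (D.obs i) ℝ := (D.S i)⁻¹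

/-- `X' W X` for the first `k` studies (`W` is block diagonal). -/
def gram : Matrix (Fin q) (Fin q) ℝ :=
  ∑ i ∈ Finset.range k, (D.X i)ᵀ * D.W i * D.X i

/-- `(X' W X)⁻¹` for the first `k` studies. -/
def bread : Matrix (Fin q) (Fin q) ℝ := (D.gram k)⁻¹

/-- The weighted least squares estimator `(X' W X)⁻¹ X' W Y` from the first `k` studies. -/
def betaHat : Fin q → ℝ :=
  D.bread k *ᵥ ∑ i ∈ Finset.range k, ((D.X i)ᵀ * D.W i) *ᵥ D.Y i

/-- The residual vector `E_i = Y_i - X_i β̂`. -/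
def resid (i : ℕ) : D.obs i → ℝ := D.Y i - D.X i *ᵥ D.betaHat k

/-- The diagonal block of the hat matrix `X (X' W X)⁻¹ X' W` that belongs to study `i`. -/
def hat (i : ℕ) : Matrix (D.obs i) (D.obs i) ℝ :=
  D.X i * D.bread k * (D.X i)ᵀ * D.W i

/-- The number `p(k)` of effects observed in the first `k` studies. -/
def numEffects : ℕ := ∑ i ∈ Finset.range k, (D.obs i).card

/-- The average of the diagonal entries of the hat matrix. -/
def meanLeverage : ℝ :=
  (∑ i ∈ Finset.range k, (D.hat k i).trace) / (D.numEffects k : ℝ)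

/-- `E_i E_i'`. -/
def omega (i : ℕ) : Matrix (D.obs i) (D.obs i) ℝ :=
  Matrix.vecMulVec (D.resid k i) (D.resid k i)

/-- `Δ_i = diag (E_i E_i')`. -/
def delta (i : ℕ) : Matrix (D.obs i) (D.obs i) ℝ :=
  Matrix.diagonal (D.omega k i).diag

/-- The adjustment matrix of the bias reduced linearization estimator for inverse variance
weights: `S^{1/2} [S^{1/2} (S - X (X' W X)⁻¹ X') S^{1/2}]^{-1/2} S^{1/2}`, with symmetric roots
(the inverse square root is taken on the range, since `0 ^ (-1/2) = 0`). -/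
def adjust2 (i : ℕ) : Matrix (D.obs i) (D.obs i) ℝ :=
  cfc Real.sqrt (D.S i) *
    cfc (fun x : ℝ => x ^ (-(1 / 2) : ℝ))
      (cfc Real.sqrt (D.S i) * (D.S i - D.X i * D.bread k * (D.X i)ᵀ) * cfc Real.sqrt (D.S i)) *
    cfc Real.sqrt (D.S i)

/-- The adjustment matrix `(I - H_i)⁻¹`. -/
def adjust3 (i : ℕ) : Matrix (D.obs i) (D.obs i) ℝ := (1 - D.hat k i)⁻¹

/-- `E_i E_i' - Δ_i + Δ_i (I - diag H_i)⁻²`. -/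
def omega3star (i : ℕ) : Matrix (D.obs i) (D.obs i) ℝ :=
  D.omega k i - D.delta k i +
    D.delta k i * Matrix.diagonal fun r => ((1 - D.hat k i r r) ^ 2)⁻¹

/-- The exponent `min {4, h / h̄}` for the effect `r` of study `i`, where `h` is the
corresponding diagonal entry of the hat matrix. -/
def exponent4 (i : ℕ) (r : D.obs i) : ℝ := min 4 (D.hat k i r r / D.meanLeverage k)

/-- `E_i E_i' - Δ_i + Δ_i (I - diag H_i)^{-δ}`, with one exponent for each diagonal entry. -/
def omega4star (i : ℕ) : Matrix (D.obs i) (D.obs i) ℝ :=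
  D.omega k i - D.delta k i +
    D.delta k i * Matrix.diagonal fun r => (1 - D.hat k i r r) ^ (-D.exponent4 k i r)

/-- `(X' W X)⁻¹ (∑ i, X_i' W_i Ω_i W_i X_i) (X' W X)⁻¹`. -/
def sandwich (Ω : ∀ i, Matrix (D.obs i) (D.obs i) ℝ) : Matrix (Fin q) (Fin q) ℝ :=
  D.bread k * (∑ i ∈ Finset.range k, (D.X i)ᵀ * D.W i * Ω i * D.W i * D.X i) * D.bread k

end Data

/-- The names of the cluster-robust estimators. -/
inductive CR where
  | cr0 | cr1 | cr1star | cr2 | cr3 | cr3star | cr4star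

/-- The cluster-robust estimator of the covariance matrix of `β̂` from the first `k` studies. -/
def Data.crCov {p q : ℕ} (D : Data p q) (k : ℕ) : CR → Matrix (Fin q) (Fin q) ℝ
  | .cr0 => D.sandwich k (D.omega k)
  | .cr1 => ((k : ℝ) / ((k : ℝ) - 1)) • D.sandwich k (D.omega k)
  | .cr1star => ((k : ℝ) / ((k : ℝ) - (q : ℝ))) • D.sandwich k (D.omega k)
  | .cr2 => D.sandwich k fun i => D.adjust2 k i * D.omega k i * (D.adjust2 k i)ᵀ
  | .cr3 => D.sandwich k fun i => D.adjust3 k i * D.omega k i * (D.adjust3 k i)ᵀ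
  | .cr3star => D.sandwich k (D.omega3star k)
  | .cr4star => D.sandwich k (D.omega4star k)

/-- The chi-squared distribution with `n` degrees of freedom. -/
def chiSq (n : ℕ) : Measure ℝ :=
  (Measure.pi fun _ : Fin n => gaussianReal 0 1).map fun x => ∑ i, x i ^ 2

/-- The `F`-distribution with `m` and `n` degrees of freedom. -/
def fDist (m n : ℕ) : Measure ℝ :=
  ((chiSq m).prod (chiSq n)).map fun z => (z.1 / (m : ℝ)) / (z.2 / (n : ℝ))

/-- The quantile function of a distribution on the line. -/
def quantile (μ : Measure ℝ) (u : ℝ) : ℝ := sInf {x : ℝ | u ≤ cdf μ x}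

/-- The confidence region for `β` that is obtained by inverting the `F`-test with truncated
denominator degrees of freedom, based on the covariance estimator `Σ`. -/
def Data.confRegion {p q : ℕ} (D : Data p q) (k : ℕ) (c : CR) (α : ℝ) : Set (Fin q → ℝ) :=
  {b | (D.betaHat k - b) ⬝ᵥ ((D.crCov k c)⁻¹ *ᵥ (D.betaHat k - b)) ≤
    (q : ℝ) * quantile (fDist q (max 2 (k - q))) (1 - α)}

/-- Asymptotic equivalence of two sequences of random matrices that estimate covariance matrices
of order `1 / k`: both the difference and `k` times the difference tend to zero in probability. -/
def AsympEquiv {Ω : Type*} [MeasurableSpace Ω] (P : Measure Ω) {q : ℕ}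
    (A B : ℕ → Ω → Matrix (Fin q) (Fin q) ℝ) : Prop :=
  (∀ a b, TendstoInMeasure P (fun (k : ℕ) ω => A k ω a b - B k ω a b) atTop fun _ => 0) ∧
  (∀ a b, TendstoInMeasure P (fun (k : ℕ) ω => (k : ℝ) * (A k ω a b - B k ω a b)) atTop fun _ => 0)

end MetaRegression

end

/-! Write `S i` for the true total covariance of study `i` and `e i` for its error vector. With the
true weights, the score `s = ∑ X_i' S_i⁻¹ e_i` is a centred Gaussian vector whose covariance is the
information matrix `G = ∑ X_i' S_i⁻¹ X_i`. So `s' G⁻¹ s` is exactly chi-squared with `q` degrees of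
freedom once `G` is invertible, and no central limit theorem is needed
(`measureReal_quadratic_le_eq_cdf_chiSq`). Coverage follows if every Wald statistic differs from
this one by a term tending to zero in probability: the critical values converge to the chi-squared
quantile (`tendsto_mul_quantile_fDist`), and the chi-squared distribution function is continuous
(`tendsto_measureReal_le_of_tendsto_sub`).

The delicate point is that the estimate of `T` may depend on the errors in any way, so the score
with estimated weights is not a sum of independent terms. `exists_dominating_sub` therefore bounds
the change of the score simultaneously for all small perturbations `D` of `T`. The resolvent
identity pulls the `p²` entries of `D`, which are common to all studies, out of the sum over
studies; what remains are sums of the same kind with new nonrandom coefficients. Iteration produces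
a geometric series of terms whose means are of order `√k`, and after enough iterations the crude
remainder is negligible.

The rest is compactness. Convergence in probability is convergence along the filter `inProbability`,
and it can be tested on the finer ultrafilters that contain a set of high probability
(`tendsto_inProbability_of_ultrafilter`). Along such an ultrafilter bounded quantities converge: `k
(X'ŴX)⁻¹ → M₀`, `k⁻¹ G → G₀` and `s / √k → s₀` (`exists_limitSetting`). Now the argument is
deterministic. One has `M₀ G₀ = 1`; the entries of the hat matrix blocks are of order `1 / k`, so
all adjustments tend to the identity uniformly over the studies; the law of large numbers gives `G₀`
as the limit of the normalized middle factor. Hence `k` times each estimator tends to `M₀ G₀ M₀ =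
M₀` (`tendsto_smul_crCov`), and both quadratic forms tend to `s₀' M₀ s₀` (`tendsto_quadratic_sub`).
The limits depend on the ultrafilter, which is harmless because only differences are compared. -/

namespace MetaRegression

/-! ### Convergence in probability as convergence along a filter -/

section InProbability

variable {Ω : Type*} [MeasurableSpace Ω]

/-- The filter of the sets of pairs `(k, ω)` whose complements have sections of vanishing
(outer) probability; convergence along it is convergence in probability. -/
def inProbability (P : Measure Ω) : Filter (ℕ × Ω) where
  sets := {S | Tendsto (fun k => P {ω | (k, ω) ∉ S}) atTop (𝓝 0)}
  univ_sets := by simp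
  sets_of_superset := by
    intro S T hS hST
    refine tendsto_of_tendsto_of_tendsto_of_le_of_le tendsto_const_nhds hS (fun _ => zero_le)
      fun k => measure_mono fun ω hω h => hω (hST h)
  inter_sets := by
    intro S T hS hT
    have h := Tendsto.add hS hT
    rw [add_zero] at h
    refine tendsto_of_tendsto_of_tendsto_of_le_of_le tendsto_const_nhds h (fun _ => zero_le)
      fun k => (measure_mono ?_).trans (measure_union_le _ _)
    intro ω hω
    by_contra hc
    simp only [Set.mem_union, Set.mem_ofPred_eq, not_or, not_not] at hc
    exact hω hc

variable {P : Measure Ω}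

lemma mem_inProbability {S : Set (ℕ × Ω)} :
    S ∈ inProbability P ↔ Tendsto (fun k => P {ω | (k, ω) ∉ S}) atTop (𝓝 0) := Iff.rfl

lemma tendsto_fst_inProbability : Tendsto (Prod.fst : ℕ × Ω → ℕ) (inProbability P) atTop := by
  refine tendsto_atTop.2 fun n => mem_inProbability.2 ?_
  refine tendsto_const_nhds.congr' ?_
  filter_upwards [eventually_ge_atTop n] with k hk
  simp [hk]

lemma tendstoInMeasure_const_iff {f : ℕ → Ω → ℝ} {c : ℝ} :
    TendstoInMeasure P f atTop (fun _ => c) ↔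
      Tendsto (fun x : ℕ × Ω => f x.1 x.2) (inProbability P) (𝓝 c) := by
  rw [tendstoInMeasure_iff_dist, Metric.tendsto_nhds]
  refine forall₂_congr fun ε hε => ?_
  change _ ↔ _ ∈ inProbability P
  rw [mem_inProbability]
  simp

/-- A set belongs to a filter as soon as it belongs to every finer ultrafilter, and an exceptional
set of probability at most `η` costs nothing since `η` is arbitrary. This replaces the passage to
subsequences: along an ultrafilter, bounded quantities converge without any choice. -/
lemma tendsto_inProbability_of_ultrafilter {E : Type*} [TopologicalSpace E] {f : ℕ × Ω → E} {y : E}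
    (h : ∀ η : ENNReal, 0 < η → ∃ G : Set (ℕ × Ω), (∀ᶠ k in atTop, P {ω | (k, ω) ∉ G} ≤ η) ∧
      ∀ U : Ultrafilter (ℕ × Ω), (U : Filter (ℕ × Ω)) ≤ inProbability P → G ∈ U →
        Tendsto f U (𝓝 y)) :
    Tendsto f (inProbability P) (𝓝 y) := by
  intro N hN
  rw [mem_map, mem_inProbability, ENNReal.tendsto_atTop_zero]
  intro ε hε
  obtain ⟨G, hG, hU⟩ := h (ε / 2) (ENNReal.half_pos hε.ne')
  have h1 : f ⁻¹' N ∈ inProbability P ⊓ 𝓟 G := by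
    rw [mem_iff_ultrafilter]
    intro U hUle
    exact hU U (hUle.trans inf_le_left) (le_principal_iff.1 (hUle.trans inf_le_right)) hN
  rw [mem_inf_principal, mem_inProbability] at h1
  have h2 := (ENNReal.tendsto_atTop_zero.1 h1) (ε / 2) (ENNReal.half_pos hε.ne')
  obtain ⟨n, hn⟩ := h2
  obtain ⟨m, hm⟩ := eventually_atTop.1 hG
  refine ⟨max n m, fun k hk => ?_⟩
  calc P {ω | (k, ω) ∉ f ⁻¹' N}
      ≤ P ({ω | (k, ω) ∉ {x | x ∈ G → x ∈ f ⁻¹' N}} ∪ {ω | (k, ω) ∉ G}) := by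
        refine measure_mono fun ω hω => ?_
        by_cases hg : (k, ω) ∈ G
        · left; exact fun hc => hω (hc hg)
        · right; exact hg
    _ ≤ ε / 2 + ε / 2 := (measure_union_le _ _).trans
        (add_le_add (hn k ((le_max_left _ _).trans hk)) (hm k ((le_max_right _ _).trans hk)))
    _ = ε := ENNReal.add_halves ε

/-- Slutsky's lemma for distribution functions: a sequence whose terms have the continuous
distribution function `F` may be perturbed by a sequence that tends to zero in probability, and the
argument by a convergent one. -/
lemma tendsto_measureReal_le_of_tendsto_sub [IsProbabilityMeasure P] {F : ℝ → ℝ} {A R : ℕ → Ω → ℝ}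
    {t : ℕ → ℝ} {t₀ : ℝ} (hF : Continuous F) (hA : ∀ᶠ k in atTop, ∀ x, P.real {ω | A k ω ≤ x} = F x)
    (hR : Tendsto (fun x : ℕ × Ω => R x.1 x.2 - A x.1 x.2) (inProbability P) (𝓝 0))
    (ht : Tendsto t atTop (𝓝 t₀)) :
    Tendsto (fun k => P.real {ω | R k ω ≤ t k}) atTop (𝓝 (F t₀)) := by
  rw [Metric.tendsto_nhds]
  intro ε hε
  obtain ⟨δ, hδ, hFδ⟩ := Metric.continuous_iff.1 hF t₀ (ε / 2) (half_pos hε)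
  -- The perturbation of `A` and the drift of `t` each cost `δ / 3`, so the two comparison points
  -- `t₀ ± 2 (δ / 3)` stay within `δ` of `t₀`.
  have hη : 0 < δ / 3 := by positivity
  have h1 : {x : ℕ × Ω | |R x.1 x.2 - A x.1 x.2| < δ / 3} ∈ inProbability P := by
    have := (Metric.tendsto_nhds.1 hR) (δ / 3) hη
    filter_upwards [this] with x hx
    simpa [Real.dist_eq] using hx
  rw [mem_inProbability] at h1
  have h2 := (ENNReal.tendsto_toReal ENNReal.zero_ne_top).comp h1
  filter_upwards [hA, (Metric.tendsto_nhds.1 ht) (δ / 3) hη, (Metric.tendsto_nhds.1 h2) (ε / 2) (half_pos hε)]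
    with k hAk htk hPk
  simp only [Function.comp_apply, ENNReal.toReal_zero, Real.dist_eq, sub_zero] at hPk htk
  rw [abs_lt] at htk
  set B := {ω | (k, ω) ∉ {x : ℕ × Ω | |R x.1 x.2 - A x.1 x.2| < δ / 3}} with hB
  have hPB : P.real B < ε / 2 := (le_abs_self _).trans_lt hPk
  have hup : P.real {ω | R k ω ≤ t k} ≤ F (t₀ + 2 * (δ / 3)) + P.real B := by
    rw [← hAk]
    refine (measureReal_mono ?_).trans (measureReal_union_le _ _)
    intro ω hω
    by_cases hb : ω ∈ B
    · exact Or.inr hb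
    · left
      simp only [hB, Set.mem_ofPred_eq, not_not, abs_lt] at hb hω ⊢
      linarith [hb.1]
  have hlo : F (t₀ - 2 * (δ / 3)) ≤ P.real {ω | R k ω ≤ t k} + P.real B := by
    rw [← hAk]
    refine (measureReal_mono ?_).trans (measureReal_union_le _ _)
    intro ω hω
    by_cases hb : ω ∈ B
    · exact Or.inr hb
    · left
      simp only [hB, Set.mem_ofPred_eq, not_not, abs_lt] at hb hω ⊢
      linarith [hb.2]
  have d1 := hFδ (t₀ + 2 * (δ / 3)) (by rw [Real.dist_eq, abs_lt]; constructor <;> linarith)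
  have d2 := hFδ (t₀ - 2 * (δ / 3)) (by rw [Real.dist_eq, abs_lt]; constructor <;> linarith)
  rw [Real.dist_eq, abs_lt] at d1 d2 ⊢
  constructor <;> linarith [d1.1, d1.2, d2.1, d2.2]

end InProbability

end MetaRegression

namespace MetaRegression

/-! ### Chi-squared and F-distributions, and convergence of the critical values -/

section ChiSquared

lemma continuous_cdf_of_measure_singleton {μ : Measure ℝ} [IsProbabilityMeasure μ]
    (h : ∀ a, μ {a} = 0) : Continuous (cdf μ) := by
  refine continuous_iff_continuousAt.2 fun a => ?_
  rw [(monotone_cdf μ).continuousAt_iff_leftLim_eq_rightLim, (cdf μ).rightLim_eq]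
  have h1 := (cdf μ).measure_singleton a
  rw [measure_cdf, h, eq_comm, ENNReal.ofReal_eq_zero] at h1
  exact le_antisymm ((monotone_cdf μ).leftLim_le le_rfl) (by linarith)

lemma measurable_sum_sq (n : ℕ) : Measurable fun x : Fin n → ℝ => ∑ i, x i ^ 2 := by fun_prop

instance isProbabilityMeasure_chiSq (n : ℕ) : IsProbabilityMeasure (chiSq n) :=
  Measure.isProbabilityMeasure_map (measurable_sum_sq n).aemeasurable

lemma measurable_fRatio (m n : ℕ) :
    Measurable fun z : ℝ × ℝ => (z.1 / (m : ℝ)) / (z.2 / (n : ℝ)) := by fun_prop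

instance isProbabilityMeasure_fDist (m n : ℕ) : IsProbabilityMeasure (fDist m n) :=
  Measure.isProbabilityMeasure_map (measurable_fRatio m n).aemeasurable

/-- Fubini: when all coordinates but the first are fixed, the sphere leaves at most two values for
the first one, and a Gaussian has no atoms. The case `n = 0`, a point mass at zero, must be
excluded. -/
lemma chiSq_singleton {n : ℕ} (hn : 0 < n) (a : ℝ) : chiSq n {a} = 0 := by
  obtain ⟨n, rfl⟩ := Nat.exists_eq_succ_of_ne_zero hn.ne'
  have : NullSingletonClass (gaussianReal 0 1) := nullSingletonClass_gaussianReal one_ne_zero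
  have hm := measurePreserving_piFinSuccAbove (n := n) (α := fun _ => ℝ)
    (fun _ => gaussianReal 0 1) 0
  rw [chiSq, Measure.map_apply (measurable_sum_sq _) (measurableSet_singleton a)]
  have hset : (fun x : Fin (n + 1) → ℝ => ∑ i, x i ^ 2) ⁻¹' {a} =
      (MeasurableEquiv.piFinSuccAbove (fun _ => ℝ) 0) ⁻¹'
        {z : ℝ × (Fin n → ℝ) | z.1 ^ 2 + ∑ i, z.2 i ^ 2 = a} := by
    ext x
    simp [Fin.sum_univ_succ, MeasurableEquiv.piFinSuccAbove, Fin.tail,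
      Fin.insertNthEquiv]
  have hms : MeasurableSet {z : ℝ × (Fin n → ℝ) | z.1 ^ 2 + ∑ i, z.2 i ^ 2 = a} :=
    measurableSet_eq_fun (by fun_prop) (by fun_prop)
  rw [hset, hm.measure_preimage hms.nullMeasurableSet, Measure.prod_apply_symm hms]
  rw [lintegral_eq_zero_iff' (measurable_measure_prodMk_right hms).aemeasurable]
  refine Eventually.of_forall fun y => ?_
  refine Set.Finite.measure_zero ?_ _
  refine Set.Finite.subset (s := {Real.sqrt (a - ∑ i, y i ^ 2), -Real.sqrt (a - ∑ i, y i ^ 2)})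
    (Set.toFinite _) fun x hx => ?_
  have hx' : x ^ 2 = a - ∑ i, y i ^ 2 := by
    simp only [Set.mem_preimage, Set.mem_ofPred_eq] at hx
    linarith
  rw [← hx', Real.sqrt_sq_eq_abs]
  rcases abs_choice x with h | h <;> simp [h]

lemma continuous_cdf_chiSq {n : ℕ} (hn : 0 < n) : Continuous (cdf (chiSq n)) :=
  continuous_cdf_of_measure_singleton (chiSq_singleton hn)

lemma chiSq_Iio_zero (n : ℕ) : chiSq n (Set.Iio 0) = 0 := by
  rw [chiSq, Measure.map_apply (measurable_sum_sq n) measurableSet_Iio]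
  convert measure_empty
  · ext x
    simpa using Finset.sum_nonneg fun i _ => sq_nonneg (x i)
  · infer_instance

lemma cdf_chiSq_of_nonpos {n : ℕ} (hn : 0 < n) {x : ℝ} (hx : x ≤ 0) : cdf (chiSq n) x = 0 := by
  rw [cdf_eq_real, measureReal_def, ENNReal.toReal_eq_zero_iff]
  left
  refine measure_mono_null (Set.Iic_subset_Iic.2 hx) ?_
  rw [← Set.Iio_union_right, measure_union_null_iff]
  exact ⟨chiSq_Iio_zero n, chiSq_singleton hn 0⟩

/-- The Gaussian product measure charges every nonempty open set, in particular a spherical shell.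
Strict monotonicity is what makes quantiles converge when distribution functions do. -/
lemma cdf_chiSq_lt {n : ℕ} (hn : 0 < n) {a b : ℝ} (ha : 0 ≤ a) (hab : a < b) :
    cdf (chiSq n) a < cdf (chiSq n) b := by
  have hpos : 0 < chiSq n (Set.Ioo a b) := by
    have : (gaussianReal 0 1).IsOpenPosMeasure :=
      (gaussianReal_absolutelyContinuous' 0 one_ne_zero).isOpenPosMeasure
    rw [chiSq, Measure.map_apply (measurable_sum_sq n) measurableSet_Ioo]
    refine IsOpen.measure_pos _ ?_ ?_
    · exact isOpen_Ioo.preimage (by fun_prop)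
    · refine ⟨Pi.single ⟨0, hn⟩ (Real.sqrt ((a + b) / 2)), ?_⟩
      rw [Set.mem_preimage, Finset.sum_eq_single ⟨0, hn⟩]
      · rw [Pi.single_eq_same, Real.sq_sqrt (by linarith)]
        constructor <;> linarith
      · intro j _ hj
        simp [Pi.single_eq_of_ne hj]
      · simp
  rw [cdf_eq_real, cdf_eq_real]
  have h1 : (chiSq n).real (Set.Iic a) + (chiSq n).real (Set.Ioo a b) ≤
      (chiSq n).real (Set.Iic b) := by
    rw [← measureReal_union (by
      rw [Set.disjoint_left]; intro x hx hx'; exact absurd hx'.1 (not_lt.2 hx)) measurableSet_Ioo]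
    refine measureReal_mono ?_
    rintro x (hx | hx)
    · exact le_trans hx hab.le
    · exact hx.2.le
  have h2 : 0 < (chiSq n).real (Set.Ioo a b) := ENNReal.toReal_pos hpos.ne' (measure_ne_top _ _)
  linarith

lemma memLp_sq_gaussianReal : MemLp (fun x : ℝ => x ^ 2) 2 (gaussianReal 0 1) := by
  have h := (memLp_id_gaussianReal' (μ := 0) (v := 1) 4 (by norm_num))
  rw [memLp_two_iff_integrable_sq (by fun_prop)]
  have h4 := h.integrable_norm_pow (by norm_num)
  refine h4.congr (Eventually.of_forall fun x => ?_)
  simp only [id_eq, Real.norm_eq_abs]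
  rw [← pow_mul, Even.pow_abs (by decide)]

lemma integral_sq_gaussianReal : ∫ x, x ^ 2 ∂(gaussianReal 0 1) = 1 := by
  have h := variance_fun_id_gaussianReal (μ := 0) (v := 1)
  rw [variance_eq_integral (by fun_prop)] at h
  simpa [integral_id_gaussianReal] using h

/-- The law of large numbers for chi-squared distributions. -/
lemma tendsto_chiSq_deviation {η : ℝ} (hη : 0 < η) :
    Tendsto (fun n : ℕ => (chiSq n).real {b | η ≤ |b / n - 1|}) atTop (𝓝 0) := by
  set v := Var[fun x : ℝ => x ^ 2; gaussianReal 0 1]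
  have hbound : ∀ᶠ n : ℕ in atTop, (chiSq n).real {b | η ≤ |b / n - 1|} ≤ v / η ^ 2 * (1 / n) := by
    filter_upwards [eventually_gt_atTop 0] with n hn
    have hn' : (0 : ℝ) < n := Nat.cast_pos.2 hn
    set π := Measure.pi fun _ : Fin n => gaussianReal 0 1
    have hL : ∀ i : Fin n, MemLp (fun x : Fin n → ℝ => x i ^ 2) 2 π := fun i =>
      memLp_sq_gaussianReal.comp_measurePreserving
        (measurePreserving_eval (fun _ : Fin n => gaussianReal 0 1) i)
    have hmean : ∫ x, ∑ i, x i ^ 2 ∂π = n := by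
      rw [integral_finsetSum _ fun i _ => (hL i).integrable (by norm_num)]
      have : ∀ i : Fin n, ∫ x, x i ^ 2 ∂π = 1 := fun i => by
        have := integral_comp_eval (μ := fun _ : Fin n => gaussianReal 0 1) (i := i)
          (f := fun x : ℝ => x ^ 2) (by fun_prop)
        rw [← integral_sq_gaussianReal, ← this]
      simp [this]
    have hvar : Var[fun x : Fin n → ℝ => ∑ i, x i ^ 2; π] = n * v := by
      have := variance_sum_pi (μ := fun _ : Fin n => gaussianReal 0 1)
        (X := fun _ => fun x : ℝ => x ^ 2) (fun i => memLp_sq_gaussianReal)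
      have e : (fun x : Fin n → ℝ => ∑ i, x i ^ 2) = ∑ i : Fin n, fun x : Fin n → ℝ => x i ^ 2 := by
        ext x; simp
      rw [e, this]
      simp [v]
    have hcheb := meas_ge_le_variance_div_sq (memLp_finsetSum Finset.univ fun i _ => hL i)
      (mul_pos hη hn')
    rw [hmean, hvar] at hcheb
    have hms : MeasurableSet {b : ℝ | η ≤ |b / n - 1|} :=
      measurableSet_le (by fun_prop) (by fun_prop)
    rw [measureReal_def, chiSq, Measure.map_apply (measurable_sum_sq n) hms]
    refine ENNReal.toReal_le_of_le_ofReal (by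
      have : 0 ≤ v := variance_nonneg _ _
      positivity) ?_
    convert hcheb using 2
    · ext x
      simp only [Set.mem_preimage, Set.mem_ofPred_eq]
      rw [div_sub_one hn'.ne', abs_div, abs_of_pos hn', le_div_iff₀ hn']
    · field_simp
  refine tendsto_of_tendsto_of_tendsto_of_le_of_le' tendsto_const_nhds ?_
    (Eventually.of_forall fun _ => measureReal_nonneg) hbound
  simpa using tendsto_one_div_atTop_nhds_zero_nat.const_mul (v / η ^ 2)

/-- The denominator of the F-ratio concentrates at `1` by the law of large numbers, so only the
numerator, a chi-squared variable divided by `m`, survives in the limit. -/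
lemma tendsto_cdf_fDist {m : ℕ} (hm : 0 < m) {x : ℝ} (hx : 0 < x) :
    Tendsto (fun n => cdf (fDist m n) x) atTop (𝓝 (cdf (chiSq m) (m * x))) := by
  have hm' : (0 : ℝ) < m := Nat.cast_pos.2 hm
  rw [Metric.tendsto_nhds]
  intro ε hε
  obtain ⟨δ, hδ, hFδ⟩ := Metric.continuous_iff.1 (continuous_cdf_chiSq hm) (m * x) (ε / 2)
    (half_pos hε)
  have hmx : 0 < m * x := by positivity
  -- When the denominator is within `η` of `1`, the event is squeezed between the numerator
  -- thresholds `m x (1 ± η)`; the last condition keeps both of them within `δ` of `m x`.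
  obtain ⟨η, hη, hη1, hηδ⟩ : ∃ η : ℝ, 0 < η ∧ η < 1 ∧ m * x * η < δ := by
    refine ⟨min (1 / 2) (δ / (2 * (m * x))), by positivity, ?_, ?_⟩
    · exact (min_le_left _ _).trans_lt (by norm_num)
    · calc m * x * min (1 / 2) (δ / (2 * (m * x))) ≤ m * x * (δ / (2 * (m * x))) := by
            gcongr; exact min_le_right _ _
        _ = δ / 2 := by field_simp
        _ < δ := half_lt_self hδ
  have hdev := (Metric.tendsto_nhds.1 (tendsto_chiSq_deviation hη)) (ε / 2) (half_pos hε)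
  filter_upwards [hdev, eventually_gt_atTop 0] with n hn hn0
  have hn' : (0 : ℝ) < n := Nat.cast_pos.2 hn0
  rw [Real.dist_eq, sub_zero, abs_of_nonneg measureReal_nonneg] at hn
  set τ := (chiSq n).real {b | η ≤ |b / n - 1|}
  set π := (chiSq m).prod (chiSq n)
  have hfst : ∀ y, π.real {z : ℝ × ℝ | z.1 ≤ y} = cdf (chiSq m) y := fun y => by
    have : {z : ℝ × ℝ | z.1 ≤ y} = Set.Iic y ×ˢ Set.univ := by ext z; simp
    rw [this, measureReal_prod_prod, cdf_eq_real]; simp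
  have hsnd : π.real {z : ℝ × ℝ | η ≤ |z.2 / n - 1|} = τ := by
    have : {z : ℝ × ℝ | η ≤ |z.2 / n - 1|} = Set.univ ×ˢ {b : ℝ | η ≤ |b / n - 1|} := by ext z; simp
    rw [this, measureReal_prod_prod]; simp [τ]
  have hF : cdf (fDist m n) x = π.real {z : ℝ × ℝ | (z.1 / m) / (z.2 / n) ≤ x} := by
    rw [cdf_eq_real, fDist, measureReal_def, Measure.map_apply (measurable_fRatio m n)
      measurableSet_Iic]
    rfl
  have key : ∀ z : ℝ × ℝ, ¬ η ≤ |z.2 / n - 1| →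
      0 < z.2 / n ∧ 1 - η < z.2 / n ∧ z.2 / n < 1 + η ∧
      ((z.1 / m) / (z.2 / n) ≤ x ↔ z.1 ≤ m * x * (z.2 / n)) := by
    intro z hz
    rw [not_le, abs_lt] at hz
    have hpos : 0 < z.2 / n := by linarith
    refine ⟨hpos, by linarith, by linarith, ?_⟩
    rw [div_le_iff₀ hpos, div_le_iff₀ hm']
    constructor <;> intro h <;> linarith
  have hup : cdf (fDist m n) x ≤ cdf (chiSq m) (m * x * (1 + η)) + τ := by
    rw [hF, ← hfst, ← hsnd]
    refine (measureReal_mono ?_).trans (measureReal_union_le _ _)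
    intro z hz
    by_cases h : η ≤ |z.2 / n - 1|
    · exact Or.inr h
    · left
      obtain ⟨h1, h2, h3, h4⟩ := key z h
      exact (h4.1 hz).trans (mul_le_mul_of_nonneg_left h3.le hmx.le)
  have hlo : cdf (chiSq m) (m * x * (1 - η)) ≤ cdf (fDist m n) x + τ := by
    rw [hF, ← hfst, ← hsnd]
    refine (measureReal_mono ?_).trans (measureReal_union_le _ _)
    intro z hz
    by_cases h : η ≤ |z.2 / n - 1|
    · exact Or.inr h
    · left
      obtain ⟨h1, h2, h3, h4⟩ := key z h
      exact h4.2 (le_trans hz (mul_le_mul_of_nonneg_left h2.le hmx.le))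
  have hpos : 0 < m * x * η := by positivity
  have d1 := hFδ (m * x * (1 + η)) (by rw [Real.dist_eq, abs_lt]; constructor <;> linarith)
  have d2 := hFδ (m * x * (1 - η)) (by rw [Real.dist_eq, abs_lt]; constructor <;> linarith)
  rw [Real.dist_eq, abs_lt] at d1 d2 ⊢
  constructor <;> linarith [d1.1, d1.2, d2.1, d2.2]

lemma cdf_fDist_of_neg (m n : ℕ) {x : ℝ} (hx : x < 0) : cdf (fDist m n) x = 0 := by
  rw [cdf_eq_real, fDist, measureReal_def, Measure.map_apply (measurable_fRatio m n)
      measurableSet_Iic, ENNReal.toReal_eq_zero_iff]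
  left
  refine measure_mono_null (t := Set.Iio 0 ×ˢ Set.univ ∪ Set.univ ×ˢ Set.Iio 0) ?_ ?_
  · intro z hz
    by_contra hc
    simp only [Set.mem_union, Set.mem_prod, Set.mem_Iio, Set.mem_univ, and_true, true_and, not_or,
      not_lt] at hc
    have : 0 ≤ (z.1 / m) / (z.2 / n) := by
      have := hc.1; have := hc.2; positivity
    exact absurd (le_trans this hz) (not_le.2 hx)
  · rw [measure_union_null_iff, Measure.prod_prod, Measure.prod_prod, chiSq_Iio_zero,
      chiSq_Iio_zero]
    simp

lemma exists_cdf_chiSq_eq {n : ℕ} (hn : 0 < n) {u : ℝ} (hu₀ : 0 < u) (hu₁ : u < 1) :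
    ∃ t, 0 < t ∧ cdf (chiSq n) t = u := by
  obtain ⟨t, ht⟩ := mem_range_of_exists_le_of_exists_ge (continuous_cdf_chiSq hn)
    ⟨0, (cdf_chiSq_of_nonpos hn le_rfl).trans_le hu₀.le⟩
    (((tendsto_cdf_atTop (chiSq n)).eventually (lt_mem_nhds hu₁)).exists.imp fun _ h => h.le)
  refine ⟨t, ?_, ht⟩
  by_contra hc
  rw [cdf_chiSq_of_nonpos hn (not_lt.1 hc)] at ht
  exact hu₀.ne ht

lemma tendsto_mul_quantile_fDist {m : ℕ} (hm : 0 < m) {u t : ℝ} (hu₀ : 0 < u)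
    (ht : 0 < t) (htu : cdf (chiSq m) t = u) :
    Tendsto (fun n => (m : ℝ) * quantile (fDist m n) u) atTop (𝓝 t) := by
  have hm' : (0 : ℝ) < m := Nat.cast_pos.2 hm
  suffices h : Tendsto (fun n => quantile (fDist m n) u) atTop (𝓝 (t / m)) by
    have := h.const_mul (m : ℝ)
    rwa [mul_div_cancel₀ _ hm'.ne'] at this
  have hbdd : ∀ n, BddBelow {x | u ≤ cdf (fDist m n) x} := fun n => by
    refine ⟨0, fun x hx => ?_⟩
    by_contra hc
    rw [Set.mem_ofPred_eq, cdf_fDist_of_neg m n (not_le.1 hc)] at hx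
    linarith
  have htm : 0 < t / m := by positivity
  rw [tendsto_order]
  constructor
  · intro a ha
    -- Convergence of the distribution functions is available only at positive points, hence the
    -- maximum with zero.
    obtain ⟨b, hab, hb⟩ := exists_between (max_lt ha htm)
    have hb0 : 0 < b := (le_max_right _ _).trans_lt hab
    have hlt : cdf (chiSq m) (m * b) < u := by
      rw [← htu]
      refine cdf_chiSq_lt hm (by positivity) ?_
      rwa [lt_div_iff₀' hm'] at hb
    -- A lower bound for the infimum needs a nonempty set, since the infimum of the empty set has a
    -- default value. The point `t / m + 1`, where the limiting distribution function already
    -- exceeds `u`, is a witness for large `n`.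
    have hnon : ∀ᶠ n in atTop, {x | u ≤ cdf (fDist m n) x}.Nonempty := by
      have h1 : cdf (chiSq m) (m * (t / m + 1)) > u := by
        rw [← htu]
        refine cdf_chiSq_lt hm ht.le ?_
        rw [mul_add, mul_div_cancel₀ _ hm'.ne']; linarith
      filter_upwards [(tendsto_cdf_fDist hm (by positivity : 0 < t / m + 1)).eventually
        (lt_mem_nhds h1)] with n hn
      exact ⟨_, hn.le⟩
    filter_upwards [(tendsto_cdf_fDist hm hb0).eventually (gt_mem_nhds hlt), hnon] with n hn hnn
    refine ((le_max_left _ _).trans_lt hab).trans_le (le_csInf hnn fun x hx => ?_)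
    by_contra hc
    exact absurd (hx.trans (monotone_cdf _ (not_le.1 hc).le)) (not_le.2 hn)
  · intro a ha
    obtain ⟨b, hb, hba⟩ := exists_between ha
    have hgt : u < cdf (chiSq m) (m * b) := by
      rw [← htu]
      refine cdf_chiSq_lt hm ht.le ?_
      rwa [div_lt_iff₀' hm'] at hb
    filter_upwards [(tendsto_cdf_fDist hm (htm.trans hb)).eventually (lt_mem_nhds hgt)] with n hn
    exact (csInf_le (hbdd n) hn.le).trans_lt hba

end ChiSquared

end MetaRegression

namespace MetaRegression

/-! ### Linear and quadratic functionals of independent Gaussian errors -/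

section GaussianErrors

variable {Ω : Type*} [MeasurableSpace Ω] {P : Measure Ω}

lemma variance_sq_gaussianReal_nonneg : 0 ≤ Var[fun x : ℝ => x ^ 2; gaussianReal 0 1] :=
  variance_nonneg _ _

/-- This reduces moments of squares to the standard normal case. No sign condition on `v` is needed:
`Real.sqrt` and `Real.toNNReal` both send negative numbers to zero. -/
lemma gaussianReal_eq_map_sqrt_mul (v : ℝ) :
    gaussianReal 0 v.toNNReal = (gaussianReal 0 1).map (fun x => Real.sqrt v * x) := by
  rw [gaussianReal_map_const_mul]
  congr 1
  · simp
  · ext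
    simp only [mul_one, NNReal.coe_mk, Real.coe_toNNReal']
    rcases le_total 0 v with h | h
    · rw [Real.sq_sqrt h, max_eq_left h]
    · rw [Real.sqrt_eq_zero_of_nonpos h, max_eq_right h]; simp

lemma memLp_sq_of_hasLaw_gaussianReal {X : Ω → ℝ} {v : ℝ}
    (h : HasLaw X (gaussianReal 0 v.toNNReal) P) : MemLp (fun ω => X ω ^ 2) 2 P := by
  have h1 : MemLp (fun x : ℝ => x ^ 2) 2 (P.map X) := by
    rw [h.map_eq, gaussianReal_eq_map_sqrt_mul, memLp_map_measure_iff (by fun_prop) (by fun_prop)]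
    have := memLp_sq_gaussianReal.const_mul (Real.sqrt v ^ 2)
    refine this.ae_eq (Eventually.of_forall fun x => ?_)
    simp [mul_pow]
  exact (memLp_map_measure_iff (by fun_prop) h.aemeasurable).1 h1

lemma integral_sq_of_hasLaw_gaussianReal {X : Ω → ℝ} {v : ℝ} (hv : 0 ≤ v)
    (h : HasLaw X (gaussianReal 0 v.toNNReal) P) : ∫ ω, X ω ^ 2 ∂P = v := by
  have h1 := h.integral_comp (f := fun x : ℝ => x ^ 2) (by fun_prop)
  rw [gaussianReal_eq_map_sqrt_mul, integral_map (by fun_prop) (by fun_prop)] at h1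
  simp only [mul_pow, integral_const_mul, integral_sq_gaussianReal, Real.sq_sqrt hv, mul_one] at h1
  exact h1

lemma variance_sq_of_hasLaw_gaussianReal {X : Ω → ℝ} {v : ℝ} (hv : 0 ≤ v)
    (h : HasLaw X (gaussianReal 0 v.toNNReal) P) :
    Var[fun ω => X ω ^ 2; P] = v ^ 2 * Var[fun x : ℝ => x ^ 2; gaussianReal 0 1] := by
  have h1 : Var[fun x : ℝ => x ^ 2; P.map X] = Var[fun ω => X ω ^ 2; P] :=
    variance_map (by fun_prop) h.aemeasurable
  rw [← h1, h.map_eq, gaussianReal_eq_map_sqrt_mul, variance_map (by fun_prop) (by fun_prop)]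
  have : (fun x : ℝ => x ^ 2) ∘ (fun x => Real.sqrt v * x) = fun x => v * x ^ 2 := by
    ext x
    simp [mul_pow, Real.sq_sqrt hv]
  rw [this, variance_const_mul]

/-- The random vectors `e i` are independent centred Gaussian with covariance matrices `S i`:
linear functionals are Gaussian and independent. -/
structure IsGaussianErrors {m : ℕ → Type*} [∀ i, Fintype (m i)] (P : Measure Ω)
    (e : ∀ i, Ω → m i → ℝ) (S : ∀ i, Matrix (m i) (m i) ℝ) : Prop where
  posSemidef : ∀ i, (S i).PosSemidef
  hasLaw : ∀ i (a : m i → ℝ),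
    HasLaw (fun ω => a ⬝ᵥ e i ω) (gaussianReal 0 (a ⬝ᵥ S i *ᵥ a).toNNReal) P
  iIndepFun : ∀ a : ∀ i, m i → ℝ, iIndepFun (fun i ω => a i ⬝ᵥ e i ω) P

lemma hasLaw_add_gaussianReal {X Y : Ω → ℝ} {v w : ℝ} (hv : 0 ≤ v) (hw : 0 ≤ w)
    (hX : HasLaw X (gaussianReal 0 v.toNNReal) P) (hY : HasLaw Y (gaussianReal 0 w.toNNReal) P)
    (h : IndepFun X Y P) :
    HasLaw (fun ω => X ω + Y ω) (gaussianReal 0 (v + w).toNNReal) P where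
  aemeasurable := hX.aemeasurable.add hY.aemeasurable
  map_eq := by
    have := gaussianReal_add_gaussianReal_of_indepFun h hX.map_eq hY.map_eq
    rw [Real.toNNReal_add hv hw]
    rwa [add_zero] at this

lemma hasLaw_dotProduct_multivariateGaussian {n : Type*} [Fintype n] [DecidableEq n]
    {u : Ω → EuclideanSpace ℝ n} {S : Matrix n n ℝ} (hS : S.PosSemidef)
    (hu : HasLaw u (multivariateGaussian 0 S) P) (a : n → ℝ) :
    HasLaw (fun ω => a ⬝ᵥ (u ω).ofLp) (gaussianReal 0 (a ⬝ᵥ S *ᵥ a).toNNReal) P := by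
  set L : EuclideanSpace ℝ n →L[ℝ] ℝ := innerSL ℝ (WithLp.toLp 2 a)
  have hL : ∀ x : EuclideanSpace ℝ n, L x = a ⬝ᵥ x.ofLp := fun x => by
    simp only [L, innerSL_apply_apply, PiLp.inner_apply, dotProduct]
    simp [mul_comm]
  refine ⟨?_, ?_⟩
  · simp_rw [← hL]
    exact L.continuous.measurable.comp_aemeasurable hu.aemeasurable
  · have h1 : P.map (fun ω => a ⬝ᵥ (u ω).ofLp) = (multivariateGaussian 0 S).map L := by
      rw [← hu.map_eq, AEMeasurable.map_map_of_aemeasurable L.continuous.aemeasurable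
        hu.aemeasurable]
      congr 1
      ext ω
      simp [hL]
    rw [h1, IsGaussian.map_eq_gaussianReal]
    congr 1
    · rw [L.integral_comp_id_comm IsGaussian.integrable_id, integral_id_multivariateGaussian,
        map_zero]
    · congr 1
      have h2 := covarianceBilin_multivariateGaussian (μ := 0) hS (WithLp.toLp 2 a) (WithLp.toLp 2 a)
      rw [covarianceBilin_apply_eq_cov IsGaussian.memLp_two_id, covariance_self (by fun_prop)] at h2
      exact h2

/-- A linear functional of the total error is a sum of two independent centred Gaussians, so the
variances add. From here on the argument uses only functionals with nonrandom coefficients and no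
joint densities. -/
lemma isGaussianErrors_of_multivariateGaussian {m : ℕ → Type*} [∀ i, Fintype (m i)]
    [∀ i, DecidableEq (m i)] {u ε : ∀ i, Ω → EuclideanSpace ℝ (m i)}
    {T V : ∀ i, Matrix (m i) (m i) ℝ} (hT : ∀ i, (T i).PosSemidef) (hV : ∀ i, (V i).PosSemidef)
    (hu : ∀ i, HasLaw (u i) (multivariateGaussian 0 (T i)) P)
    (hε : ∀ i, HasLaw (ε i) (multivariateGaussian 0 (V i)) P)
    (huε : ∀ i, IndepFun (u i) (ε i) P)
    (hind : ProbabilityTheory.iIndepFun (fun i ω => (u i ω, ε i ω)) P) :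
    IsGaussianErrors P (fun i ω => (u i ω).ofLp + (ε i ω).ofLp) (fun i => T i + V i) where
  posSemidef i := (hT i).add (hV i)
  hasLaw i a := by
    have h0 : ∀ {A : Matrix (m i) (m i) ℝ}, A.PosSemidef → 0 ≤ a ⬝ᵥ A *ᵥ a := fun hA => by
      simpa using hA.dotProduct_mulVec_nonneg a
    have hm : Measurable fun x : EuclideanSpace ℝ (m i) => a ⬝ᵥ x.ofLp := by
      unfold dotProduct; fun_prop
    have := hasLaw_add_gaussianReal (h0 (hT i)) (h0 (hV i))
      (hasLaw_dotProduct_multivariateGaussian (hT i) (hu i) a)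
      (hasLaw_dotProduct_multivariateGaussian (hV i) (hε i) a)
      ((huε i).comp hm hm)
    simpa only [dotProduct_add, Matrix.add_mulVec] using this
  iIndepFun a := by
    have hm : ∀ i, Measurable fun x : EuclideanSpace ℝ (m i) × EuclideanSpace ℝ (m i) =>
        a i ⬝ᵥ (x.1.ofLp + x.2.ofLp) := fun i => by
      unfold dotProduct; simp only [Pi.add_apply]; fun_prop
    exact hind.comp (fun i x => a i ⬝ᵥ (x.1.ofLp + x.2.ofLp)) hm

namespace IsGaussianErrors

variable {m : ℕ → Type*} [∀ i, Fintype (m i)] {e : ∀ i, Ω → m i → ℝ}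
  {S : ∀ i, Matrix (m i) (m i) ℝ}

lemma quadratic_nonneg (h : IsGaussianErrors P e S) (i : ℕ) (a : m i → ℝ) :
    0 ≤ a ⬝ᵥ S i *ᵥ a := by
  simpa using (h.posSemidef i).dotProduct_mulVec_nonneg a

lemma hasLaw_sum [IsProbabilityMeasure P] (h : IsGaussianErrors P e S) (a : ∀ i, m i → ℝ) (k : ℕ) :
    HasLaw (fun ω => ∑ i ∈ Finset.range k, a i ⬝ᵥ e i ω)
      (gaussianReal 0 (∑ i ∈ Finset.range k, a i ⬝ᵥ S i *ᵥ a i).toNNReal) P := by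
  induction k with
  | zero =>
    simp only [Finset.range_zero, Finset.sum_empty, Real.toNNReal_zero, gaussianReal_zero_var]
    exact hasLaw_dirac_of_ae_eq (Eventually.of_forall fun _ => rfl)
  | succ k ih =>
    simp only [Finset.sum_range_succ]
    refine hasLaw_add_gaussianReal (Finset.sum_nonneg fun i _ => h.quadratic_nonneg i _)
      (h.quadratic_nonneg k _) ih (h.hasLaw k _) ?_
    have := (h.iIndepFun a).indepFun_finsetSum_of_notMem₀ (fun i => (h.hasLaw i _).aemeasurable)
      (Finset.notMem_range_self (n := k))
    convert this using 1
    ext ω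
    simp

lemma integral_sum_sq [IsProbabilityMeasure P] (h : IsGaussianErrors P e S) (a : ∀ i, m i → ℝ)
    (k : ℕ) : ∫ ω, (∑ i ∈ Finset.range k, a i ⬝ᵥ e i ω) ^ 2 ∂P =
      ∑ i ∈ Finset.range k, a i ⬝ᵥ S i *ᵥ a i :=
  integral_sq_of_hasLaw_gaussianReal (Finset.sum_nonneg fun i _ => h.quadratic_nonneg i _)
    (h.hasLaw_sum a k)

lemma integrable_sum_sq [IsProbabilityMeasure P] (h : IsGaussianErrors P e S) (a : ∀ i, m i → ℝ)
    (k : ℕ) : Integrable (fun ω => (∑ i ∈ Finset.range k, a i ⬝ᵥ e i ω) ^ 2) P :=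
  (memLp_sq_of_hasLaw_gaussianReal (h.hasLaw_sum a k)).integrable (by norm_num)

/-- The weak law of large numbers for squares of linear functionals of the errors. -/
lemma tendsto_average_sq [IsProbabilityMeasure P] (h : IsGaussianErrors P e S)
    {a : ∀ i, m i → ℝ} {C : ℝ} (ha : ∀ i, a i ⬝ᵥ S i *ᵥ a i ≤ C) :
    Tendsto (fun x : ℕ × Ω => (∑ i ∈ Finset.range x.1,
      ((a i ⬝ᵥ e i x.2) ^ 2 - a i ⬝ᵥ S i *ᵥ a i)) / x.1) (inProbability P) (𝓝 0) := by
  rw [← tendstoInMeasure_const_iff (f := fun k ω => (∑ i ∈ Finset.range k,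
      ((a i ⬝ᵥ e i ω) ^ 2 - a i ⬝ᵥ S i *ᵥ a i)) / k), tendstoInMeasure_iff_norm]
  intro ε hε
  set κ := Var[fun x : ℝ => x ^ 2; gaussianReal 0 1]
  have hκ : 0 ≤ κ := variance_sq_gaussianReal_nonneg
  have hL : ∀ i, MemLp (fun ω => (a i ⬝ᵥ e i ω) ^ 2) 2 P := fun i =>
    memLp_sq_of_hasLaw_gaussianReal (h.hasLaw i _)
  have hbound : ∀ᶠ k : ℕ in atTop, P {ω | ε ≤ ‖(∑ i ∈ Finset.range k,
      ((a i ⬝ᵥ e i ω) ^ 2 - a i ⬝ᵥ S i *ᵥ a i)) / k - 0‖} ≤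
      ENNReal.ofReal (C ^ 2 * κ / ε ^ 2 * (1 / k)) := by
    filter_upwards [eventually_gt_atTop 0] with k hk
    have hk' : (0 : ℝ) < k := Nat.cast_pos.2 hk
    have hmean : ∫ ω, ∑ i ∈ Finset.range k, (a i ⬝ᵥ e i ω) ^ 2 ∂P =
        ∑ i ∈ Finset.range k, a i ⬝ᵥ S i *ᵥ a i := by
      rw [integral_finsetSum _ fun i _ => (hL i).integrable (by norm_num)]
      exact Finset.sum_congr rfl fun i _ =>
        integral_sq_of_hasLaw_gaussianReal (h.quadratic_nonneg i _) (h.hasLaw i _)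
    have hvar : Var[fun ω => ∑ i ∈ Finset.range k, (a i ⬝ᵥ e i ω) ^ 2; P] ≤ k * (C ^ 2 * κ) := by
      have e1 : (fun ω => ∑ i ∈ Finset.range k, (a i ⬝ᵥ e i ω) ^ 2) =
          ∑ i ∈ Finset.range k, fun ω => (a i ⬝ᵥ e i ω) ^ 2 := by ext ω; simp
      rw [e1, IndepFun.variance_sum (fun i _ => hL i)]
      · calc _ ≤ ∑ i ∈ Finset.range k, C ^ 2 * κ := by
              refine Finset.sum_le_sum fun i _ => ?_
              rw [variance_sq_of_hasLaw_gaussianReal (h.quadratic_nonneg i _) (h.hasLaw i _)]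
              have := h.quadratic_nonneg i (a i)
              gcongr
              exact ha i
          _ = _ := by simp
      · intro i _ j _ hij
        exact ((h.iIndepFun a).indepFun hij).comp (φ := fun x : ℝ => x ^ 2)
          (ψ := fun x : ℝ => x ^ 2) (by fun_prop) (by fun_prop)
    have hcheb := meas_ge_le_variance_div_sq (memLp_finsetSum (Finset.range k) fun i _ => hL i)
      (mul_pos hε hk')
    rw [hmean] at hcheb
    refine (le_of_eq ?_).trans (hcheb.trans (ENNReal.ofReal_le_ofReal ?_))
    · congr 1
      ext ω
      simp only [Set.mem_ofPred_eq, sub_zero, norm_div, Real.norm_eq_abs, Finset.sum_sub_distrib,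
        abs_of_pos hk']
      rw [le_div_iff₀ hk']
    · rw [div_le_iff₀ (by positivity)]
      calc _ ≤ k * (C ^ 2 * κ) := hvar
        _ = _ := by field_simp
  refine tendsto_of_tendsto_of_tendsto_of_le_of_le' tendsto_const_nhds ?_
    (Eventually.of_forall fun _ => zero_le) hbound
  rw [← ENNReal.ofReal_zero]
  refine ENNReal.tendsto_ofReal ?_
  simpa using tendsto_one_div_atTop_nhds_zero_nat.const_mul (C ^ 2 * κ / ε ^ 2)

/-- Polarization: a product is half the difference between the square of a sum and the two squares.
The variance of the sum is at most `4 C`, because the form at the difference is nonnegative. -/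
lemma tendsto_average_mul [IsProbabilityMeasure P] (h : IsGaussianErrors P e S)
    {a b : ∀ i, m i → ℝ} {C : ℝ} (ha : ∀ i, a i ⬝ᵥ S i *ᵥ a i ≤ C)
    (hb : ∀ i, b i ⬝ᵥ S i *ᵥ b i ≤ C) :
    Tendsto (fun x : ℕ × Ω => (∑ i ∈ Finset.range x.1,
      ((a i ⬝ᵥ e i x.2) * (b i ⬝ᵥ e i x.2) - a i ⬝ᵥ S i *ᵥ b i)) / x.1)
      (inProbability P) (𝓝 0) := by
  have hsymm : ∀ i, b i ⬝ᵥ S i *ᵥ a i = a i ⬝ᵥ S i *ᵥ b i := fun i => by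
    have := (h.posSemidef i).isHermitian.eq
    rw [Matrix.conjTranspose_eq_transpose_of_trivial] at this
    rw [Matrix.dotProduct_mulVec, ← Matrix.mulVec_transpose, this, dotProduct_comm]
  have hsub : ∀ i, 0 ≤ (a i - b i) ⬝ᵥ S i *ᵥ (a i - b i) := fun i => h.quadratic_nonneg i _
  have hab : ∀ i, (a i + b i) ⬝ᵥ S i *ᵥ (a i + b i) ≤ 4 * C := fun i => by
    have h1 := hsub i
    simp only [Matrix.mulVec_sub, Matrix.mulVec_add, dotProduct_sub, dotProduct_add,
      sub_dotProduct, add_dotProduct, hsymm] at h1 ⊢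
    linarith [ha i, hb i]
  have h1 := ((h.tendsto_average_sq (a := fun i => a i + b i) hab).sub
    ((h.tendsto_average_sq ha).add (h.tendsto_average_sq hb))).const_mul (1 / 2)
  rw [add_zero, sub_zero, mul_zero] at h1
  refine h1.congr fun x => ?_
  rw [← add_div, ← sub_div, ← Finset.sum_add_distrib, ← Finset.sum_sub_distrib, ← mul_div_assoc,
    Finset.mul_sum]
  congr 1
  refine Finset.sum_congr rfl fun i _ => ?_
  simp only [Matrix.mulVec_add, dotProduct_add, add_dotProduct, hsymm]
  ring

end IsGaussianErrors

/-- Cramér–Wold: the characteristic function of the vector at `t` is that of the scalar `t ⬝ᵥ Z` at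
`1`. -/
lemma hasLaw_toLp_stdGaussian {q : ℕ} [IsProbabilityMeasure P] {Z : Ω → Fin q → ℝ}
    (hZ : ∀ t : Fin q → ℝ, HasLaw (fun ω => t ⬝ᵥ Z ω) (gaussianReal 0 (t ⬝ᵥ t).toNNReal) P) :
    HasLaw (fun ω => WithLp.toLp 2 (Z ω)) (stdGaussian (EuclideanSpace ℝ (Fin q))) P := by
  have hm : AEMeasurable Z P := by
    refine aemeasurable_pi_lambda _ fun i => ?_
    have := (hZ (Pi.single i 1)).aemeasurable
    simpa using this
  have hm' : AEMeasurable (fun ω => WithLp.toLp 2 (Z ω)) P :=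
    (WithLp.measurable_toLp 2 _).comp_aemeasurable hm
  refine ⟨hm', ?_⟩
  have := Measure.isProbabilityMeasure_map hm'
  refine Measure.ext_of_charFun (funext fun t => ?_)
  have h1 := congrArg (fun μ => charFun μ 1) (hZ t.ofLp).map_eq
  simp only [charFun_gaussianReal] at h1
  rw [charFun_apply, integral_map (hZ t.ofLp).aemeasurable (by fun_prop)] at h1
  rw [charFun_stdGaussian, charFun_apply, integral_map hm' (by fun_prop)]
  have h2 : ∀ ω, inner ℝ (WithLp.toLp 2 (Z ω)) t = inner ℝ (t.ofLp ⬝ᵥ Z ω) (1 : ℝ) := fun ω => by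
    simp [PiLp.inner_apply, dotProduct]
  simp only [h2, h1]
  have h3 : 0 ≤ t.ofLp ⬝ᵥ t.ofLp := Finset.sum_nonneg fun i _ => mul_self_nonneg _
  congr 1
  have h4 : ‖t‖ ^ 2 = t.ofLp ⬝ᵥ t.ofLp := by
    rw [EuclideanSpace.real_norm_sq_eq]
    simp [dotProduct, sq]
  rw [Real.coe_toNNReal _ h3, ← h4]
  push_cast
  ring

open scoped MatrixOrder in
lemma exists_eq_transpose_mul_self {n : Type*} [Fintype n] [DecidableEq n] {G : Matrix n n ℝ}
    (hG : G.PosSemidef) : ∃ B : Matrix n n ℝ, G = Bᵀ * B := by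
  refine ⟨CFC.sqrt G, ?_⟩
  have h1 : (CFC.sqrt G)ᴴ = CFC.sqrt G := (CFC.sqrt_nonneg G).isSelfAdjoint
  rw [← Matrix.conjTranspose_eq_transpose_of_trivial, h1, CFC.sqrt_mul_sqrt_self _ hG.nonneg]

/-- The quadratic form of a centred Gaussian vector in its inverse covariance matrix has a
chi-squared distribution. -/
lemma measureReal_quadratic_le_eq_cdf_chiSq {q : ℕ} [IsProbabilityMeasure P] {s : Ω → Fin q → ℝ}
    {G : Matrix (Fin q) (Fin q) ℝ} (hG : G.PosDef)
    (hs : ∀ t : Fin q → ℝ, HasLaw (fun ω => t ⬝ᵥ s ω) (gaussianReal 0 (t ⬝ᵥ G *ᵥ t).toNNReal) P)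
    (x : ℝ) : P.real {ω | s ω ⬝ᵥ G⁻¹ *ᵥ s ω ≤ x} = cdf (chiSq q) x := by
  obtain ⟨B, hB⟩ := exists_eq_transpose_mul_self hG.posSemidef
  have hBu : IsUnit B := by
    have := hG.isUnit
    rw [hB] at this
    exact isUnit_of_mul_isUnit_right this
  have hBdet : IsUnit B.det := (Matrix.isUnit_iff_isUnit_det B).1 hBu
  -- Whitening: with `G = Bᵀ * B`, the transformed vector has identity covariance and its squared
  -- length is the quadratic form in `G⁻¹`.
  set Z : Ω → Fin q → ℝ := fun ω => s ω ᵥ* B⁻¹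
  have hZ : ∀ t : Fin q → ℝ,
      HasLaw (fun ω => t ⬝ᵥ Z ω) (gaussianReal 0 (t ⬝ᵥ t).toNNReal) P := fun t => by
    have h1 := hs (B⁻¹ *ᵥ t)
    have e1 : (B⁻¹ *ᵥ t) ⬝ᵥ G *ᵥ (B⁻¹ *ᵥ t) = t ⬝ᵥ t := by
      have hBt : B *ᵥ (B⁻¹ *ᵥ t) = t := by
        rw [Matrix.mulVec_mulVec, Matrix.mul_nonsing_inv _ hBdet, Matrix.one_mulVec]
      rw [hB, ← Matrix.mulVec_mulVec, hBt, Matrix.dotProduct_mulVec, Matrix.vecMul_transpose, hBt]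
    rw [e1] at h1
    convert h1 using 2 with ω
    simp only [Z]
    rw [dotProduct_comm, ← Matrix.dotProduct_mulVec, dotProduct_comm]
  have hquad : ∀ ω, s ω ⬝ᵥ G⁻¹ *ᵥ s ω = ∑ i, Z ω i ^ 2 := fun ω => by
    rw [hB, Matrix.mul_inv_rev, ← Matrix.mulVec_mulVec, Matrix.dotProduct_mulVec,
      ← Matrix.transpose_nonsing_inv, Matrix.mulVec_transpose]
    simp [Z, dotProduct, sq]
  have hlaw := hasLaw_toLp_stdGaussian hZ
  rw [← map_pi_eq_stdGaussian] at hlaw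
  have hZlaw : HasLaw Z (Measure.pi fun _ => gaussianReal 0 1) P := by
    refine ⟨?_, ?_⟩
    · exact (WithLp.measurable_ofLp 2 _).comp_aemeasurable hlaw.aemeasurable
    · have := congrArg (Measure.map (WithLp.ofLp (p := 2))) hlaw.map_eq
      rw [AEMeasurable.map_map_of_aemeasurable (WithLp.measurable_ofLp 2 _).aemeasurable
        hlaw.aemeasurable, Measure.map_map (WithLp.measurable_ofLp 2 _)
        (WithLp.measurable_toLp 2 _)] at this
      simpa [Function.comp_def] using this
  simp only [hquad]
  rw [hZlaw.measureReal_eq (p := fun z => ∑ i, z i ^ 2 ≤ x)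
    (measurableSet_le (measurable_sum_sq q) measurable_const), cdf_eq_real, chiSq,
    map_measureReal_apply (measurable_sum_sq q) measurableSet_Iic]
  rfl

end GaussianErrors

end MetaRegression

namespace MetaRegression

/-! ### Entrywise matrix bounds that are uniform over dimensions up to `p` -/

section Entrywise

variable {l n o : Type*} [Fintype n] {p : ℕ}

lemma abs_dotProduct_le (hn : Fintype.card n ≤ p) {v w : n → ℝ} {a b : ℝ} (ha : 0 ≤ a) (hb : 0 ≤ b)
    (hv : ∀ r, |v r| ≤ a) (hw : ∀ r, |w r| ≤ b) : |v ⬝ᵥ w| ≤ p * (a * b) := by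
  calc |v ⬝ᵥ w| ≤ ∑ r, |v r * w r| := Finset.abs_sum_le_sum_abs _ _
    _ ≤ ∑ _r : n, a * b := Finset.sum_le_sum fun r _ => by
        rw [abs_mul]; exact mul_le_mul (hv r) (hw r) (abs_nonneg _) ha
    _ = Fintype.card n * (a * b) := by simp
    _ ≤ p * (a * b) := by gcongr

lemma abs_mul_apply_le (hn : Fintype.card n ≤ p) {A : Matrix l n ℝ} {B : Matrix n o ℝ} {a b : ℝ}
    (ha : 0 ≤ a) (hb : 0 ≤ b) (hA : ∀ r s, |A r s| ≤ a) (hB : ∀ r s, |B r s| ≤ b) (r : l) (s : o) :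
    |(A * B) r s| ≤ p * (a * b) :=
  abs_dotProduct_le hn ha hb (hA r) fun j => hB j s

lemma abs_mulVec_apply_le (hn : Fintype.card n ≤ p) {A : Matrix l n ℝ} {v : n → ℝ} {a b : ℝ}
    (ha : 0 ≤ a) (hb : 0 ≤ b) (hA : ∀ r s, |A r s| ≤ a) (hv : ∀ r, |v r| ≤ b) (r : l) :
    |(A *ᵥ v) r| ≤ p * (a * b) :=
  abs_dotProduct_le hn ha hb (hA r) hv

lemma abs_quadratic_le (hn : Fintype.card n ≤ p) {A : Matrix n n ℝ} {a : ℝ} (ha : 0 ≤ a)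
    (hA : ∀ r s, |A r s| ≤ a) (v : n → ℝ) : |v ⬝ᵥ A *ᵥ v| ≤ p * a * (v ⬝ᵥ v) := by
  calc |v ⬝ᵥ A *ᵥ v| ≤ ∑ r, |v r * (A *ᵥ v) r| := Finset.abs_sum_le_sum_abs _ _
    _ ≤ ∑ r, ∑ s, a * ((v r ^ 2 + v s ^ 2) / 2) := by
        refine Finset.sum_le_sum fun r _ => ?_
        rw [Matrix.mulVec, dotProduct, Finset.mul_sum]
        refine (Finset.abs_sum_le_sum_abs _ _).trans (Finset.sum_le_sum fun s _ => ?_)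
        rw [abs_mul, abs_mul, mul_left_comm]
        refine mul_le_mul (hA r s) ?_ (by positivity) ha
        nlinarith [sq_nonneg (|v r| - |v s|), sq_abs (v r), sq_abs (v s)]
    _ = Fintype.card n * a * (v ⬝ᵥ v) := by
        simp only [← Finset.mul_sum, ← Finset.sum_div, Finset.sum_add_distrib, Finset.sum_const,
          Finset.card_univ, nsmul_eq_mul, dotProduct, ← sq]
        ring
    _ ≤ p * a * (v ⬝ᵥ v) := by
        have : 0 ≤ v ⬝ᵥ v := Finset.sum_nonneg fun i _ => mul_self_nonneg _
        gcongr

lemma sq_apply_le_dotProduct_self (v : n → ℝ) (r : n) : v r ^ 2 ≤ v ⬝ᵥ v := by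
  rw [sq]
  exact Finset.single_le_sum (f := fun i => v i * v i) (fun i _ => mul_self_nonneg _)
    (Finset.mem_univ r)

variable [DecidableEq n]

lemma isUnit_of_quadratic_ge {S : Matrix n n ℝ} {c : ℝ} (hc : 0 < c)
    (hS : ∀ v, c * (v ⬝ᵥ v) ≤ v ⬝ᵥ S *ᵥ v) : IsUnit S := by
  rw [← Matrix.mulVec_injective_iff_isUnit]
  refine (injective_iff_map_eq_zero (Matrix.mulVecLin S)).2 fun v hv => ?_
  have h1 := hS v
  rw [show S *ᵥ v = 0 from hv, dotProduct_zero] at h1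
  have h2 : 0 ≤ v ⬝ᵥ v := Finset.sum_nonneg fun i _ => mul_self_nonneg _
  exact dotProduct_self_eq_zero.1 (le_antisymm (by nlinarith) h2)

/-- For a column `w` of the inverse, coercivity reads `c |w|² ≤ w s`. Since `w s` is at most `|w|`,
this forces `c |w| ≤ 1`. Symmetry of `S` plays no role. -/
lemma abs_inv_apply_le {S : Matrix n n ℝ} {c : ℝ} (hc : 0 < c)
    (hS : ∀ v, c * (v ⬝ᵥ v) ≤ v ⬝ᵥ S *ᵥ v) (r s : n) : |S⁻¹ r s| ≤ 1 / c := by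
  have hu := (Matrix.isUnit_iff_isUnit_det S).1 (isUnit_of_quadratic_ge hc hS)
  set w := S⁻¹ *ᵥ Pi.single s 1 with hw
  have hwr : ∀ r, w r = S⁻¹ r s := fun r => by simp [hw]
  have h1 := hS w
  have h2 : w ⬝ᵥ S *ᵥ w = w s := by
    rw [hw, Matrix.mulVec_mulVec, Matrix.mul_nonsing_inv _ hu, Matrix.one_mulVec]
    simp
  rw [h2] at h1
  have h3 := sq_apply_le_dotProduct_self w s
  have h4 := sq_apply_le_dotProduct_self w r
  rw [← hwr, le_div_iff₀ hc]
  have h5 : c * w s ≤ 1 := by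
    by_contra hcon
    push Not at hcon
    nlinarith [mul_le_mul_of_nonneg_left h3 hc.le]
  have h6 : (|w r| * c) ^ 2 ≤ 1 ^ 2 := by
    rw [mul_pow, sq_abs]
    nlinarith [mul_le_mul_of_nonneg_left h4 hc.le]
  have h7 := abs_le_of_sq_le_sq h6 zero_le_one
  exact (le_abs_self _).trans h7

omit [DecidableEq n] in
lemma quadratic_ge_of_abs_sub_le (hn : Fintype.card n ≤ p) {S S' : Matrix n n ℝ} {c δ : ℝ}
    (hδ : 0 ≤ δ) (hS : ∀ v, c * (v ⬝ᵥ v) ≤ v ⬝ᵥ S *ᵥ v) (h : ∀ r s, |S' r s - S r s| ≤ δ)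
    (hδc : p * δ ≤ c / 2) (v : n → ℝ) : c / 2 * (v ⬝ᵥ v) ≤ v ⬝ᵥ S' *ᵥ v := by
  have h1 := abs_quadratic_le hn hδ (A := S' - S) h v
  rw [Matrix.sub_mulVec, dotProduct_sub] at h1
  have h2 : 0 ≤ v ⬝ᵥ v := Finset.sum_nonneg fun i _ => mul_self_nonneg _
  have h3 := mul_le_mul_of_nonneg_right hδc h2
  linarith [hS v, (abs_le.1 h1).1]

/-- The order of the factors matters later: with the true `S` on the left, a nonrandom row absorbs
`S⁻¹` and becomes a new nonrandom row, while the perturbed inverse on the right is ready for the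
next expansion. -/
lemma inv_sub_inv_eq {S S' : Matrix n n ℝ} (hS : IsUnit S) (hS' : IsUnit S') :
    S'⁻¹ - S⁻¹ = -(S⁻¹ * (S' - S) * S'⁻¹) := by
  rw [Matrix.isUnit_iff_isUnit_det] at hS hS'
  rw [mul_sub, sub_mul, Matrix.nonsing_inv_mul _ hS, one_mul, Matrix.mul_assoc,
    Matrix.mul_nonsing_inv _ hS', mul_one]
  abel

/-- Inverses of matrices near the identity, entrywise. -/
lemma abs_inv_one_sub_sub_one_le (hn : Fintype.card n ≤ p) {H : Matrix n n ℝ} {h : ℝ} (hh : 0 ≤ h)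
    (hH : ∀ r s, |H r s| ≤ h) (hph : p * h ≤ 1 / 2) (r s : n) :
    |((1 - H)⁻¹ - 1) r s| ≤ p * (h * 2) := by
  have hq : ∀ v : n → ℝ, 1 / 2 * (v ⬝ᵥ v) ≤ v ⬝ᵥ (1 - H) *ᵥ v :=
    quadratic_ge_of_abs_sub_le hn hh (S := 1) (c := 1) (by simp) (by simpa using hH) hph
  have hu := (Matrix.isUnit_iff_isUnit_det _).1 (isUnit_of_quadratic_ge one_half_pos hq)
  have e : (1 - H)⁻¹ - 1 = H * (1 - H)⁻¹ := by
    have := Matrix.mul_nonsing_inv _ hu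
    rw [sub_mul, one_mul] at this
    rw [sub_eq_iff_eq_add, add_comm, ← sub_eq_iff_eq_add, this]
  rw [e]
  refine abs_mul_apply_le hn hh (by norm_num) hH (fun r s => ?_) r s
  simpa using abs_inv_apply_le one_half_pos hq r s

end Entrywise

/-! ### Matrix square roots and the CR2 adjustment -/

section Roots

variable {n : Type*} [Fintype n] [DecidableEq n]

open scoped MatrixOrder in
lemma posSemidef_cfc {A : Matrix n n ℝ} {f : ℝ → ℝ} (hf : ∀ x ∈ spectrum ℝ A, 0 ≤ f x) :
    (cfc f A).PosSemidef := Matrix.nonneg_iff_posSemidef.1 (cfc_nonneg hf)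

lemma cfc_sqrt_mul_self {A : Matrix n n ℝ} (hA : A.PosSemidef) :
    cfc Real.sqrt A * cfc Real.sqrt A = A := by
  have hs := (Matrix.posSemidef_iff_isHermitian_and_spectrum_nonneg.1 hA).2
  have hsa : IsSelfAdjoint A := hA.isHermitian
  rw [← cfc_mul _ _ A]
  conv_rhs => rw [← cfc_id ℝ A]
  exact cfc_congr fun x hx => Real.mul_self_sqrt (hs hx)

lemma cfc_rpow_neg_half_mul_self {A : Matrix n n ℝ} (hA : A.PosDef) :
    cfc (fun x : ℝ => x ^ (-(1 / 2) : ℝ)) A * cfc (fun x : ℝ => x ^ (-(1 / 2) : ℝ)) A = A⁻¹ := by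
  have hs : ∀ x ∈ spectrum ℝ A, 0 < x := fun x hx => by
    refine lt_of_le_of_ne
      ((Matrix.posSemidef_iff_isHermitian_and_spectrum_nonneg.1 hA.posSemidef).2 hx) ?_
    rintro rfl
    exact spectrum.zero_notMem ℝ hA.isUnit hx
  have hsa : IsSelfAdjoint A := hA.isHermitian
  have hcont : ContinuousOn (fun x : ℝ => x ^ (-(1 / 2) : ℝ)) (spectrum ℝ A) :=
    continuousOn_id.rpow_const fun x hx => Or.inl (hs x hx).ne'
  symm
  refine Matrix.inv_eq_left_inv ?_
  rw [← cfc_mul _ _ A]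
  nth_rewrite 2 [← cfc_id ℝ A]
  rw [← cfc_mul (fun x : ℝ => x ^ (-(1 / 2) : ℝ) * x ^ (-(1 / 2) : ℝ)) id A (hcont.mul hcont)
    continuousOn_id, ← cfc_one ℝ A]
  refine cfc_congr fun x hx => ?_
  have hx := hs x hx
  simp only [id_eq, Pi.one_apply]
  rw [← Real.rpow_add hx, show (-(1 / 2) + -(1 / 2) : ℝ) = -1 by norm_num, Real.rpow_neg_one,
    inv_mul_cancel₀ hx.ne']

omit [DecidableEq n] in
lemma trace_mul_mul_transpose_eq_sum (A B : Matrix n n ℝ) :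
    (A * B * Aᵀ).trace = ∑ r, A r ⬝ᵥ B *ᵥ A r := by
  simp only [Matrix.trace, Matrix.diag_apply]
  refine Finset.sum_congr rfl fun r _ => ?_
  rw [Matrix.mul_assoc, Matrix.mul_apply]
  rfl

/-- The square of positive semidefinite matrices is an open map: a Frobenius norm estimate. -/
lemma abs_sub_apply_le_of_mul_self_sub {p : ℕ} (hn : Fintype.card n ≤ p) {A B : Matrix n n ℝ}
    {m f : ℝ} (hm : 0 < m) (hf : 0 ≤ f) (hA : A.PosSemidef) (hB : B.IsHermitian)
    (hBm : ∀ v, m * (v ⬝ᵥ v) ≤ v ⬝ᵥ B *ᵥ v) (h : ∀ r s, |(A * A - B * B) r s| ≤ f) (r s : n) :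
    |A r s - B r s| ≤ p * f / m := by
  set Δ := A - B
  set F := A * A - B * B
  have hΔ : Δᵀ = Δ := by
    have := hA.isHermitian.sub hB
    rwa [Matrix.IsHermitian, Matrix.conjTranspose_eq_transpose_of_trivial] at this
  -- From `A² - B² = A Δ + Δ B`. The term with `A` is nonnegative and the term with `B` is at least
  -- `m` times the squared Frobenius norm of `Δ`; in `h3` half of that is used to absorb `Δ` on the
  -- other side by Young's inequality.
  have e1 : (Δ * F).trace = (Δ * A * Δᵀ).trace + (Δ * B * Δᵀ).trace := by
    have : Δ * F = Δ * A * Δ + Δ * Δ * B := by simp only [Δ, F]; noncomm_ring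
    rw [this, Matrix.trace_add, hΔ, Matrix.trace_mul_cycle Δ Δ B,
      Matrix.trace_mul_cycle B Δ Δ]
  have h1 : 0 ≤ (Δ * A * Δᵀ).trace := by
    have := (hA.mul_mul_conjTranspose_same Δ).trace_nonneg
    rwa [Matrix.conjTranspose_eq_transpose_of_trivial] at this
  set N := ∑ r, ∑ s, Δ r s ^ 2
  have h2 : m * N ≤ (Δ * B * Δᵀ).trace := by
    rw [trace_mul_mul_transpose_eq_sum, Finset.mul_sum]
    refine Finset.sum_le_sum fun r _ => ?_
    have := hBm (Δ r)
    simpa only [dotProduct, ← sq] using this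
  have h3 : (Δ * F).trace ≤ m / 2 * N + p ^ 2 * f ^ 2 / (2 * m) := by
    calc (Δ * F).trace = ∑ r, ∑ s, Δ r s * F s r := by
          simp [Matrix.trace, Matrix.mul_apply]
      _ ≤ ∑ r, ∑ s, (m / 2 * Δ r s ^ 2 + f ^ 2 / (2 * m)) := by
          refine Finset.sum_le_sum fun r _ => Finset.sum_le_sum fun s _ => ?_
          have hF : F s r ^ 2 ≤ f ^ 2 := sq_le_sq' (abs_le.1 (h s r)).1 (abs_le.1 (h s r)).2
          have : Δ r s * F s r ≤ m / 2 * Δ r s ^ 2 + F s r ^ 2 / (2 * m) := by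
            have e : m / 2 * Δ r s ^ 2 + F s r ^ 2 / (2 * m) - Δ r s * F s r =
                (m * Δ r s - F s r) ^ 2 / (2 * m) := by field_simp; ring
            have : 0 ≤ (m * Δ r s - F s r) ^ 2 / (2 * m) := by positivity
            linarith
          refine this.trans ?_
          gcongr
      _ = m / 2 * N + (Fintype.card n : ℝ) ^ 2 * f ^ 2 / (2 * m) := by
          simp only [Finset.sum_add_distrib, ← Finset.mul_sum, Finset.sum_const, Finset.card_univ,
            nsmul_eq_mul, N]
          ring
      _ ≤ _ := by gcongr
  have h4 : N ≤ (p * f / m) ^ 2 := by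
    have : m / 2 * N ≤ m / 2 * (p * f / m) ^ 2 := by
      have e : m / 2 * (p * f / m) ^ 2 = p ^ 2 * f ^ 2 / (2 * m) := by field_simp
      linarith
    exact le_of_mul_le_mul_left this (by positivity)
  have h5 : Δ r s ^ 2 ≤ N :=
    (Finset.single_le_sum (f := fun s => Δ r s ^ 2) (fun _ _ => sq_nonneg _)
      (Finset.mem_univ s)).trans
    (Finset.single_le_sum (f := fun r => ∑ s, Δ r s ^ 2)
      (fun _ _ => Finset.sum_nonneg fun _ _ => sq_nonneg _) (Finset.mem_univ r))
  exact abs_le_of_sq_le_sq (h5.trans h4) (by positivity)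

/-- The adjustment matrix of the bias reduced linearization estimator depends on the perturbation
`N` in a Lipschitz way, uniformly over well-conditioned working covariance matrices. -/
lemma exists_abs_adjustment_sub_one_le (p : ℕ) {c C : ℝ} (hc : 0 < c) (hC : 0 < C) :
    ∃ K δ : ℝ, 0 < δ ∧ 0 ≤ K ∧ ∀ {n : Type} [Fintype n] [DecidableEq n], Fintype.card n ≤ p →
      ∀ {S N : Matrix n n ℝ} {ν : ℝ}, S.IsHermitian → N.IsHermitian →
      (∀ v, c * (v ⬝ᵥ v) ≤ v ⬝ᵥ S *ᵥ v) → (∀ r s, |S r s| ≤ C) → 0 ≤ ν → ν ≤ δ →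
      (∀ r s, |N r s| ≤ ν) → ∀ r s, |(cfc Real.sqrt S *
        cfc (fun x : ℝ => x ^ (-(1 / 2) : ℝ)) (cfc Real.sqrt S * (S - N) * cfc Real.sqrt S) *
        cfc Real.sqrt S - 1) r s| ≤ K * ν := by
  -- The constants chosen below divide by `p`.
  rcases Nat.eq_zero_or_pos p with rfl | hp
  · refine ⟨0, 1, one_pos, le_rfl, ?_⟩
    intro n _ _ hn S N ν _ _ _ _ _ _ _ r
    exact ((Fintype.card_eq_zero_iff.1 (Nat.le_zero.1 hn)).false r).elim
  have hp' : (0 : ℝ) < p := Nat.cast_pos.2 hp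
  -- The first constant is the composition of the entrywise bounds below with `ν` replaced by `1`.
  -- The second is the value of `ν` at which the perturbation of `S * S` uses up half of its lower
  -- bound `c ^ 2`.
  refine ⟨p * (p * (√C * (p * (p * (p * (p * (1 / (c ^ 2 / 2) * (p * (p * (√C * 1) * √C))) *
    (1 / c)) * (1 / c))) / (1 / (p * C)))) * √C), c ^ 2 / 2 / (p * (p * (p * (√C * 1) * √C))),
    by positivity, by positivity, ?_⟩
  intro n _ _ hn S N ν hSh hNh hS hSC hν hνδ hN
  set R := cfc Real.sqrt S
  have hSpd : S.PosSemidef := Matrix.PosSemidef.of_dotProduct_mulVec_nonneg hSh fun v => by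
    have : 0 ≤ v ⬝ᵥ v := Finset.sum_nonneg fun i _ => mul_self_nonneg _
    have := hS v
    simp only [star_trivial]
    exact le_trans (by positivity) this
  have hRR : R * R = S := cfc_sqrt_mul_self hSpd
  have hRh : R.IsHermitian := (posSemidef_cfc fun x _ => Real.sqrt_nonneg x).isHermitian
  have hRt : Rᵀ = R := by
    rwa [Matrix.IsHermitian, Matrix.conjTranspose_eq_transpose_of_trivial] at hRh
  have hSt : Sᵀ = S := by
    rwa [Matrix.IsHermitian, Matrix.conjTranspose_eq_transpose_of_trivial] at hSh
  have hRC : ∀ r s, |R r s| ≤ √C := fun r s => by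
    refine Real.abs_le_sqrt ?_
    calc R r s ^ 2 ≤ R r ⬝ᵥ R r := sq_apply_le_dotProduct_self _ _
      _ = (R * Rᵀ) r r := rfl
      _ = S r r := by rw [hRt, hRR]
      _ ≤ C := (le_abs_self _).trans (hSC r r)
  have hsC := Real.sqrt_nonneg C
  set N' := R * N * R
  have hN' : ∀ r s, |N' r s| ≤ p * (p * (√C * ν) * √C) :=
    abs_mul_apply_le hn (by positivity) hsC (abs_mul_apply_le hn hsC hν hRC hN) hRC
  -- For `N = 0` the bracket is `S * S`, its inverse root is `S⁻¹`, and the outer roots cancel it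
  -- because `R * S⁻¹ * R = 1`. So it is enough to compare the inverse root of `B` with `S⁻¹`, by
  -- way of their squares.
  have hB : R * (S - N) * R = S * S - N' := by
    rw [mul_sub, sub_mul, ← hRR]; simp only [N', Matrix.mul_assoc]
  have hSS : ∀ v, c ^ 2 * (v ⬝ᵥ v) ≤ v ⬝ᵥ (S * S) *ᵥ v := fun v => by
    have h1 : v ⬝ᵥ (S * S) *ᵥ v = (S *ᵥ v) ⬝ᵥ (S *ᵥ v) := by
      rw [← Matrix.mulVec_mulVec, Matrix.dotProduct_mulVec, ← Matrix.mulVec_transpose, hSt]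
    have h2 : 0 ≤ (S *ᵥ v - c • v) ⬝ᵥ (S *ᵥ v - c • v) :=
      Finset.sum_nonneg fun i _ => mul_self_nonneg _
    simp only [sub_dotProduct, dotProduct_sub, smul_dotProduct, dotProduct_smul, smul_eq_mul] at h2
    rw [dotProduct_comm (S *ᵥ v) v] at h2
    rw [h1]
    nlinarith [mul_le_mul_of_nonneg_left (hS v) hc.le]
  set B := R * (S - N) * R with hBdef
  have hBq : ∀ v, c ^ 2 / 2 * (v ⬝ᵥ v) ≤ v ⬝ᵥ B *ᵥ v := by
    refine quadratic_ge_of_abs_sub_le hn (by positivity) hSS (δ := p * (p * (√C * ν) * √C)) ?_ ?_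
    · intro r s
      rw [hB, ← Matrix.sub_apply, sub_sub_cancel_left, Matrix.neg_apply, abs_neg]
      exact hN' r s
    · rw [le_div_iff₀ (by positivity)] at hνδ
      calc _ = ν * (p * (p * (p * (√C * 1) * √C))) := by ring
        _ ≤ _ := hνδ
  have hBh : B.IsHermitian := by
    have := Matrix.isHermitian_mul_mul_conjTranspose R (hSh.sub hNh)
    rwa [hRh.eq] at this
  have hBpd : B.PosDef := Matrix.PosDef.of_dotProduct_mulVec_pos hBh fun v hv => by
    have : 0 < v ⬝ᵥ v := lt_of_le_of_ne (Finset.sum_nonneg fun i _ => mul_self_nonneg _)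
      fun h => hv (dotProduct_self_eq_zero.1 h.symm)
    simp only [star_trivial]
    exact lt_of_lt_of_le (by positivity) (hBq v)
  set Q := cfc (fun x : ℝ => x ^ (-(1 / 2) : ℝ)) B
  have hQQ : Q * Q = B⁻¹ := cfc_rpow_neg_half_mul_self hBpd
  have hQ : Q.PosSemidef := posSemidef_cfc fun x hx => by
    have := (Matrix.posSemidef_iff_isHermitian_and_spectrum_nonneg.1 hBpd.posSemidef).2 hx
    exact Real.rpow_nonneg this _
  have hSu := isUnit_of_quadratic_ge hc hS
  have hSu' := (Matrix.isUnit_iff_isUnit_det S).1 hSu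
  have hF : ∀ r s, |(Q * Q - S⁻¹ * S⁻¹) r s| ≤
      p * (p * (p * (1 / (c ^ 2 / 2) * (p * (p * (√C * ν) * √C))) * (1 / c)) * (1 / c)) := by
    have e : Q * Q - S⁻¹ * S⁻¹ = B⁻¹ * N' * S⁻¹ * S⁻¹ := by
      have h1 := inv_sub_inv_eq hBpd.isUnit (hSu.mul hSu)
      rw [hQQ, ← Matrix.mul_inv_rev, ← neg_inj, neg_sub, h1, hB, sub_sub_cancel,
        Matrix.mul_inv_rev]
      simp only [Matrix.mul_assoc]
    rw [e]
    have hS1 := abs_inv_apply_le hc hS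
    refine abs_mul_apply_le hn (by positivity) (by positivity) ?_ hS1
    refine abs_mul_apply_le hn (by positivity) (by positivity) ?_ hS1
    exact abs_mul_apply_le hn (by positivity) (by positivity)
      (abs_inv_apply_le (by positivity) hBq) hN'
  -- The comparison of roots needs a lower bound for one of them. With `v = S y` both sides become
  -- quadratic forms in `R y`, and the bound `p * C` for the form of `S` applies.
  have hSinv : ∀ v, 1 / (p * C) * (v ⬝ᵥ v) ≤ v ⬝ᵥ S⁻¹ *ᵥ v := fun v => by
    set y := S⁻¹ *ᵥ v with hy
    have hv : v = S *ᵥ y := by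
      rw [hy, Matrix.mulVec_mulVec, Matrix.mul_nonsing_inv _ hSu', Matrix.one_mulVec]
    have h1 : v ⬝ᵥ y = (R *ᵥ y) ⬝ᵥ (R *ᵥ y) := by
      rw [hv, ← hRR, ← Matrix.mulVec_mulVec, dotProduct_comm, Matrix.dotProduct_mulVec,
        ← Matrix.mulVec_transpose, hRt]
    have h2 : v ⬝ᵥ v = (R *ᵥ y) ⬝ᵥ S *ᵥ (R *ᵥ y) := by
      rw [hv, ← hRR]
      simp only [← Matrix.mulVec_mulVec]
      rw [dotProduct_comm, Matrix.dotProduct_mulVec, ← Matrix.mulVec_transpose, hRt,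
        dotProduct_comm]
    have h3 := (abs_le.1 (abs_quadratic_le hn hC.le hSC (R *ᵥ y))).2
    rw [h1, h2, one_div, inv_mul_le_iff₀ (by positivity)]
    exact h3
  have hΔ := abs_sub_apply_le_of_mul_self_sub hn (by positivity) (by positivity) hQ hSh.inv hSinv hF
  have e : R * Q * R - 1 = R * (Q - S⁻¹) * R := by
    have hRu : IsUnit R.det := by
      rw [← Matrix.isUnit_iff_isUnit_det]
      rw [← hRR] at hSu
      exact isUnit_of_mul_isUnit_left hSu
    have : R * S⁻¹ * R = 1 := by
      rw [← hRR, Matrix.mul_inv_rev, ← Matrix.mul_assoc, Matrix.mul_nonsing_inv _ hRu, one_mul,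
        Matrix.nonsing_inv_mul _ hRu]
    rw [mul_sub, sub_mul, this]
  intro r s
  rw [e]
  refine (abs_mul_apply_le hn (by positivity) hsC
    (abs_mul_apply_le hn hsC (by positivity) hRC hΔ) hRC r s).trans (le_of_eq ?_)
  ring

end Roots

end MetaRegression

namespace MetaRegression

/-! ### Uniform control of the score over perturbed weights -/

section Equicontinuity

variable {Ω : Type*} [MeasurableSpace Ω] {P : Measure Ω} {p : ℕ}

/-- The coordinate functional `b`, weighted with the entry `a` of `v`; zero unless both effects
are observed. -/
def entryVec {s : Finset (Fin p)} (v : s → ℝ) (a b : Fin p) : s → ℝ := fun r =>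
  if h : a ∈ s then (if r.1 = b then v ⟨a, h⟩ else 0) else 0

lemma abs_entryVec_le {s : Finset (Fin p)} {v : s → ℝ} {A : ℝ} (hA : 0 ≤ A) (hv : ∀ r, |v r| ≤ A)
    (a b : Fin p) (r : s) : |entryVec v a b r| ≤ A := by
  unfold entryVec
  split_ifs
  · exact hv _
  · simpa using hA
  · simpa using hA

/-- The perturbation `D` is shared by all studies, so after summing over studies its entries factor
out as `p²` scalars. Each remaining sum has nonrandom coefficients, even if `D` depends on the data.
-/
lemma dotProduct_block_mulVec (s : Finset (Fin p)) (D : Matrix (Fin p) (Fin p) ℝ) (v w : s → ℝ) :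
    v ⬝ᵥ block D s *ᵥ w = ∑ a, ∑ b, D a b * (entryVec v a b ⬝ᵥ w) := by
  have h1 : ∀ a b, entryVec v a b ⬝ᵥ w =
      (if h : a ∈ s then v ⟨a, h⟩ else 0) * (if h : b ∈ s then w ⟨b, h⟩ else 0) := fun a b => by
    unfold entryVec dotProduct
    by_cases ha : a ∈ s
    · by_cases hb : b ∈ s
      · rw [Finset.sum_eq_single ⟨b, hb⟩]
        · simp [ha, hb]
        · intro r _ hr
          have : r.1 ≠ b := fun h => hr (Subtype.ext h)
          simp [this]
        · simp
      · have : ∀ r : s, r.1 ≠ b := fun r h => hb (h ▸ r.2)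
        simp [hb, this]
    · simp [ha]
  have h2 : ∀ f : s → ℝ, ∑ r, f r = ∑ a, if h : a ∈ s then f ⟨a, h⟩ else 0 := fun f => by
    rw [Finset.univ_eq_attach, Finset.sum_dite]
    simp only [Finset.sum_const_zero, add_zero]
    refine Finset.sum_bij (fun r _ => ⟨r.1, by simp⟩) ?_ ?_ ?_ ?_
    · simp
    · intro a _ b _ h; exact Subtype.ext (Subtype.mk.inj h)
    · intro b _
      exact ⟨⟨b.1, (Finset.mem_filter.1 b.2).2⟩, Finset.mem_attach _ _, rfl⟩
    · simp
  simp only [h1]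
  simp only [dotProduct, Matrix.mulVec, h2]
  refine Finset.sum_congr rfl fun a _ => ?_
  by_cases ha : a ∈ s
  · simp only [ha, dite_true]
    rw [Finset.mul_sum]
    refine Finset.sum_congr rfl fun b _ => ?_
    by_cases hb : b ∈ s
    · simp only [hb, dite_true, block, Matrix.submatrix_apply]; ring
    · simp [hb]
  · simp [ha]

/-- The variance of `|X|` is nonnegative. -/
lemma integral_abs_le_of_integral_sq_le [IsProbabilityMeasure P] {X : Ω → ℝ} {b : ℝ} (hb : 0 ≤ b)
    (hX : AEStronglyMeasurable X P) (hX2 : Integrable (fun ω => X ω ^ 2) P)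
    (h : ∫ ω, X ω ^ 2 ∂P ≤ b ^ 2) : Integrable X P ∧ ∫ ω, |X ω| ∂P ≤ b := by
  have hL : MemLp X 2 P := (memLp_two_iff_integrable_sq hX).2 hX2
  refine ⟨hL.integrable (by norm_num), ?_⟩
  have h1 := variance_nonneg (fun ω => |X ω|) P
  rw [variance_eq_sub (X := fun ω => |X ω|) hL.abs] at h1
  have h4 : (∫ ω, |X ω| ∂P) ^ 2 ≤ b ^ 2 := by
    have : ∫ ω, ((fun ω => |X ω|) ^ 2) ω ∂P = ∫ ω, X ω ^ 2 ∂P := by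
      refine integral_congr_ae (Eventually.of_forall fun ω => ?_)
      simp
    rw [this] at h1
    linarith
  exact (le_abs_self _).trans (abs_le_of_sq_le_sq h4 hb)

variable {obs : ℕ → Finset (Fin p)} {e : ∀ i, Ω → obs i → ℝ}
  {S : ∀ i, Matrix (obs i) (obs i) ℝ} {c C : ℝ}

lemma card_obs_le (i : ℕ) : Fintype.card (obs i) ≤ p := by
  simpa using Finset.card_le_univ (obs i)

/-- The bound for a single study from the nondegeneracy of its covariance matrix. -/
lemma quadratic_block_add_ge (hS : ∀ i v, c * (v ⬝ᵥ v) ≤ v ⬝ᵥ S i *ᵥ v)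
    {δ : ℝ} (hδ : 0 ≤ δ) (hδc : p * δ ≤ c / 2) {D : Matrix (Fin p) (Fin p) ℝ}
    (hD : ∀ a b, |D a b| ≤ δ) (i : ℕ) (v : obs i → ℝ) :
    c / 2 * (v ⬝ᵥ v) ≤ v ⬝ᵥ (S i + block D (obs i)) *ᵥ v :=
  quadratic_ge_of_abs_sub_le (card_obs_le i) hδ (hS i) (fun r t => by simpa [block] using hD r t)
    hδc v

lemma dotProduct_inv_mulVec_eq (hc : 0 < c) (hS : ∀ i v, c * (v ⬝ᵥ v) ≤ v ⬝ᵥ S i *ᵥ v)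
    {δ : ℝ} (hδ : 0 ≤ δ) (hδc : p * δ ≤ c / 2) {D : Matrix (Fin p) (Fin p) ℝ}
    (hD : ∀ a b, |D a b| ≤ δ) (i : ℕ) (v w : obs i → ℝ) :
    v ⬝ᵥ (S i + block D (obs i))⁻¹ *ᵥ w - v ⬝ᵥ (S i)⁻¹ *ᵥ w =
      -∑ a, ∑ b, D a b * (entryVec (v ᵥ* (S i)⁻¹) a b ⬝ᵥ (S i + block D (obs i))⁻¹ *ᵥ w) := by
  rw [← dotProduct_block_mulVec, ← dotProduct_sub, ← Matrix.sub_mulVec,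
    inv_sub_inv_eq (isUnit_of_quadratic_ge hc (hS i))
      (isUnit_of_quadratic_ge (half_pos hc) (quadratic_block_add_ge hS hδ hδc hD i)),
    add_sub_cancel_left, Matrix.neg_mulVec, dotProduct_neg, Matrix.mul_assoc,
    ← Matrix.mulVec_mulVec, Matrix.dotProduct_mulVec, ← Matrix.mulVec_mulVec]

lemma abs_vecMul_inv_le (hc : 0 < c) (hS : ∀ i v, c * (v ⬝ᵥ v) ≤ v ⬝ᵥ S i *ᵥ v) (i : ℕ) {A : ℝ}
    (hA : 0 ≤ A) {v : obs i → ℝ} (hv : ∀ r, |v r| ≤ A) (r : obs i) :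
    |(v ᵥ* (S i)⁻¹) r| ≤ A * (p * (1 / c)) := by
  have := abs_dotProduct_le (card_obs_le i) hA (by positivity) hv
    (fun j => abs_inv_apply_le hc (hS i) j r)
  calc _ ≤ _ := this
    _ = _ := by ring

lemma integral_abs_sum_dotProduct_le [IsProbabilityMeasure P] (h : IsGaussianErrors P e S)
    (hC : 0 ≤ C) (hSC : ∀ i r t, |S i r t| ≤ C) {A : ℝ} (hA : 0 ≤ A) {a : ∀ i, obs i → ℝ}
    (ha : ∀ i r, |a i r| ≤ A) (k : ℕ) :
    Integrable (fun ω => ∑ i ∈ Finset.range k, a i ⬝ᵥ e i ω) P ∧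
    ∫ ω, |∑ i ∈ Finset.range k, a i ⬝ᵥ e i ω| ∂P ≤ A * (p * √C) * √k := by
  refine integral_abs_le_of_integral_sq_le (by positivity)
    (h.hasLaw_sum a k).aemeasurable.aestronglyMeasurable (h.integrable_sum_sq a k) ?_
  rw [h.integral_sum_sq]
  calc _ ≤ ∑ i ∈ Finset.range k, (p : ℝ) * (A * (p * (C * A))) := by
        refine Finset.sum_le_sum fun i _ => (le_abs_self _).trans ?_
        exact abs_dotProduct_le (card_obs_le i) hA (by positivity) (ha i)
          (abs_mulVec_apply_le (card_obs_le i) hC hA (hSC i) (ha i))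
    _ = (A * (p * √C) * √k) ^ 2 := by
        rw [Finset.sum_const, Finset.card_range, nsmul_eq_mul, mul_pow, mul_pow, mul_pow,
          Real.sq_sqrt hC, Real.sq_sqrt (Nat.cast_nonneg k)]
        ring

lemma integrable_apply [IsProbabilityMeasure P] (h : IsGaussianErrors P e S)
    (hC : 0 ≤ C) (hSC : ∀ i r t, |S i r t| ≤ C) (i : ℕ) (r : obs i) :
    Integrable (fun ω => e i ω r) P ∧ ∫ ω, |e i ω r| ∂P ≤ √C := by
  have hl := h.hasLaw i (Pi.single r 1)
  have hv : Pi.single r 1 ⬝ᵥ S i *ᵥ Pi.single r 1 = S i r r := by simp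
  rw [hv] at hl
  simp only [single_one_dotProduct] at hl
  have h0 : 0 ≤ S i r r := (h.posSemidef i).diag_nonneg
  refine integral_abs_le_of_integral_sq_le (Real.sqrt_nonneg C) hl.aemeasurable.aestronglyMeasurable
    ((memLp_sq_of_hasLaw_gaussianReal hl).integrable (by norm_num)) ?_
  rw [integral_sq_of_hasLaw_gaussianReal h0 hl, Real.sq_sqrt hC]
  exact (le_abs_self _).trans (hSC i r r)

/-- A maximal inequality over the perturbations of the working covariance matrices: the
weighted sums of the errors are dominated by a random variable whose expectation is of order `√k`,
up to an error term that is as small as desired. -/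
lemma exists_dominating_aux [IsProbabilityMeasure P] (h : IsGaussianErrors P e S)
    (hc : 0 < c) (hS : ∀ i v, c * (v ⬝ᵥ v) ≤ v ⬝ᵥ S i *ᵥ v)
    (hC : 0 ≤ C) (hSC : ∀ i r t, |S i r t| ≤ C) {δ : ℝ} (hδ : 0 ≤ δ) (hδc : p * δ ≤ c / 2)
    (hδp : δ * (p * (p * (p * (1 / c)))) ≤ 1 / 2) (k n : ℕ) :
    ∀ (A : ℝ) (a : ∀ i, obs i → ℝ), 0 ≤ A → (∀ i r, |a i r| ≤ A) →
    ∃ B : Ω → ℝ, Integrable B P ∧ (∀ ω, 0 ≤ B ω) ∧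
      ∫ ω, B ω ∂P ≤ A * (2 * (p * (1 / c) * (p * √C)) * √k +
        (1 / 2) ^ n * (p * (p * (1 / (c / 2)) * √C) * k)) ∧
      ∀ ω (D : Matrix (Fin p) (Fin p) ℝ), (∀ a b, |D a b| ≤ δ) →
        |∑ i ∈ Finset.range k, a i ⬝ᵥ (S i + block D (obs i))⁻¹ *ᵥ e i ω| ≤ B ω := by
  induction n with
  | zero =>
    intro A a hA ha
    -- Without expansion there is only the triangle inequality, with perturbed inverses bounded by
    -- `1 / (c / 2)`: a bound of order `k`, which later steps shrink.
    refine ⟨fun ω => ∑ i ∈ Finset.range k, A * (p * (1 / (c / 2)) * ∑ t, |e i ω t|), ?_, ?_, ?_, ?_⟩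
    · refine integrable_finsetSum _ fun i _ => Integrable.const_mul (Integrable.const_mul ?_ _) _
      exact integrable_finsetSum _ fun t _ => (integrable_apply h hC hSC i t).1.abs
    · intro ω
      exact Finset.sum_nonneg fun i _ => mul_nonneg hA (mul_nonneg (by positivity)
        (Finset.sum_nonneg fun _ _ => abs_nonneg _))
    · rw [integral_finsetSum]
      · calc _ ≤ ∑ i ∈ Finset.range k, A * (p * (1 / (c / 2)) * (p * √C)) := by
              refine Finset.sum_le_sum fun i _ => ?_
              rw [integral_const_mul, integral_const_mul, integral_finsetSum]
              · gcongr
                calc _ ≤ ∑ _t : obs i, √C :=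
                      Finset.sum_le_sum fun t _ => (integrable_apply h hC hSC i t).2
                  _ = Fintype.card (obs i) * √C := by simp
                  _ ≤ p * √C := by gcongr; exact card_obs_le i
              · exact fun t _ => (integrable_apply h hC hSC i t).1.abs
          _ ≤ _ := by
              rw [Finset.sum_const, Finset.card_range, nsmul_eq_mul, pow_zero, one_mul, mul_add]
              have : 0 ≤ A * (2 * (p * (1 / c) * (p * √C)) * √k) := by positivity
              have e1 : (k : ℝ) * (A * (p * (1 / (c / 2)) * (p * √C))) =
                A * (p * (p * (1 / (c / 2)) * √C) * k) := by ring
              linarith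
      · exact fun i _ => Integrable.const_mul (Integrable.const_mul
          (integrable_finsetSum _ fun t _ => (integrable_apply h hC hSC i t).1.abs) _) _
    · intro ω D hD
      refine (Finset.abs_sum_le_sum_abs _ _).trans (Finset.sum_le_sum fun i _ => ?_)
      have h1 : ∀ r, |((S i + block D (obs i))⁻¹ *ᵥ e i ω) r| ≤ 1 / (c / 2) * ∑ t, |e i ω t| := by
        intro r
        rw [Finset.mul_sum]
        refine (Finset.abs_sum_le_sum_abs _ _).trans (Finset.sum_le_sum fun t _ => ?_)
        rw [abs_mul]
        gcongr
        exact abs_inv_apply_le (half_pos hc) (quadratic_block_add_ge hS hδ hδc hD i) r t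
      calc _ ≤ p * (A * (1 / (c / 2) * ∑ t, |e i ω t|)) :=
            abs_dotProduct_le (card_obs_le i) hA
              (mul_nonneg (by positivity) (Finset.sum_nonneg fun _ _ => abs_nonneg _)) (ha i) h1
        _ = _ := by ring
  | succ n ih =>
    intro A a hA ha
    -- One resolvent expansion. The term with the true inverse is a Gaussian sum with mean absolute
    -- value of order `√k`. In the correction, each of the `p²` entries of `D` multiplies a sum of
    -- the original form with coefficients bounded by `A'`. The factor `δ p³ / c ≤ 1 / 2` halves the
    -- induction bound, and the `2` in the `√k` term is the resulting geometric series.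
    set A' := A * (p * (1 / c)) with hA'
    have hA'0 : 0 ≤ A' := by positivity
    have hw : ∀ i r, |(a i ᵥ* (S i)⁻¹) r| ≤ A' := fun i r => abs_vecMul_inv_le hc hS i hA (ha i) r
    have hB := fun x y : Fin p => ih A' (fun i => entryVec (a i ᵥ* (S i)⁻¹) x y) hA'0
      (fun i r => abs_entryVec_le hA'0 (hw i) x y r)
    choose B hBi hB0 hBE hBD using hB
    obtain ⟨hWi, hWE⟩ := integral_abs_sum_dotProduct_le h hC hSC hA'0 hw k
    refine ⟨fun ω => |∑ i ∈ Finset.range k, (a i ᵥ* (S i)⁻¹) ⬝ᵥ e i ω| + δ * ∑ x, ∑ y, B x y ω,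
      ?_, ?_, ?_, ?_⟩
    · exact hWi.abs.add (Integrable.const_mul (integrable_finsetSum _ fun x _ =>
        integrable_finsetSum _ fun y _ => hBi x y) _)
    · intro ω
      have : 0 ≤ ∑ x, ∑ y, B x y ω :=
        Finset.sum_nonneg fun x _ => Finset.sum_nonneg fun y _ => hB0 x y ω
      positivity
    · rw [integral_add hWi.abs (Integrable.const_mul (integrable_finsetSum _ fun x _ =>
        integrable_finsetSum _ fun y _ => hBi x y) _), integral_const_mul,
        integral_finsetSum _ fun x _ => integrable_finsetSum _ fun y _ => hBi x y]
      set M := 2 * (p * (1 / c) * (p * √C)) * √k + (1 / 2) ^ n * (p * (p * (1 / (c / 2)) * √C) * k)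
        with hM
      have hM0 : 0 ≤ M := by positivity
      have h1 : ∑ x, ∫ ω, ∑ y, B x y ω ∂P ≤ p * (p * (A' * M)) := by
        calc _ ≤ ∑ _x : Fin p, ∑ _y : Fin p, A' * M := by
              refine Finset.sum_le_sum fun x _ => ?_
              rw [integral_finsetSum _ fun y _ => hBi x y]
              exact Finset.sum_le_sum fun y _ => hBE x y
          _ = _ := by simp
      calc _ ≤ A' * (p * √C) * √k + δ * (p * (p * (A' * M))) := by gcongr
        _ = A' * (p * √C) * √k + A * M * (δ * (p * (p * (p * (1 / c))))) := by rw [hA']; ring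
        _ ≤ A' * (p * √C) * √k + A * M * (1 / 2) := by gcongr
        _ = _ := by rw [hA', hM, pow_succ]; ring
    · intro ω D hD
      have h1 : ∑ i ∈ Finset.range k, a i ⬝ᵥ (S i + block D (obs i))⁻¹ *ᵥ e i ω =
          ∑ i ∈ Finset.range k, (a i ᵥ* (S i)⁻¹) ⬝ᵥ e i ω - ∑ x, ∑ y, D x y *
            ∑ i ∈ Finset.range k, entryVec (a i ᵥ* (S i)⁻¹) x y ⬝ᵥ
              (S i + block D (obs i))⁻¹ *ᵥ e i ω := by
        simp_rw [Finset.mul_sum]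
        rw [Finset.sum_congr rfl fun x _ => Finset.sum_comm, Finset.sum_comm,
          ← Finset.sum_sub_distrib]
        refine Finset.sum_congr rfl fun i _ => ?_
        have := dotProduct_inv_mulVec_eq hc hS hδ hδc hD i (a i) (e i ω)
        rw [← Matrix.dotProduct_mulVec]
        linarith
      rw [h1]
      refine (abs_sub _ _).trans (add_le_add le_rfl ?_)
      rw [Finset.mul_sum]
      refine (Finset.abs_sum_le_sum_abs _ _).trans (Finset.sum_le_sum fun x _ => ?_)
      rw [Finset.mul_sum]
      refine (Finset.abs_sum_le_sum_abs _ _).trans (Finset.sum_le_sum fun y _ => ?_)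
      rw [abs_mul]
      exact mul_le_mul (hD x y) (hBD x y ω D hD) (abs_nonneg _) hδ

/-- Stochastic equicontinuity: replacing the covariance matrices in the weights by perturbed ones
changes the weighted sums of the errors by the size of the perturbation times a random variable of
order `√k`. -/
lemma exists_dominating_sub [IsProbabilityMeasure P] (h : IsGaussianErrors P e S)
    (hc : 0 < c) (hS : ∀ i v, c * (v ⬝ᵥ v) ≤ v ⬝ᵥ S i *ᵥ v)
    (hC : 0 ≤ C) (hSC : ∀ i r t, |S i r t| ≤ C) {A : ℝ} (hA : 0 ≤ A) {a : ∀ i, obs i → ℝ}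
    (ha : ∀ i r, |a i r| ≤ A) :
    ∃ δ K : ℝ, 0 < δ ∧ 0 ≤ K ∧ ∀ k : ℕ, ∃ B : Ω → ℝ, Integrable B P ∧ (∀ ω, 0 ≤ B ω) ∧
      ∫ ω, B ω ∂P ≤ K * √k ∧ ∀ ω (D : Matrix (Fin p) (Fin p) ℝ) (d : ℝ), d ≤ δ →
        (∀ a b, |D a b| ≤ d) →
        |∑ i ∈ Finset.range k, (a i ⬝ᵥ (S i + block D (obs i))⁻¹ *ᵥ e i ω -
          a i ⬝ᵥ (S i)⁻¹ *ᵥ e i ω)| ≤ d * B ω := by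
  obtain ⟨δ, hδ, hδc, hδp⟩ : ∃ δ : ℝ, 0 < δ ∧ p * δ ≤ c / 2 ∧
      δ * (p * (p * (p * (1 / c)))) ≤ 1 / 2 := by
    -- The first entry keeps the perturbed covariances coercive, the second makes the expansion
    -- contract; adding `1` to the denominators covers `p = 0`.
    refine ⟨min (c / 2 / (p + 1)) (1 / 2 / (p * (p * (p * (1 / c))) + 1)), by positivity, ?_, ?_⟩
    · calc (p : ℝ) * min (c / 2 / (p + 1)) _ ≤ (p + 1) * (c / 2 / (p + 1)) := by
            gcongr
            · linarith
            · exact min_le_left _ _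
        _ = c / 2 := by field_simp
    · calc _ ≤ 1 / 2 / (p * (p * (p * (1 / c))) + 1) * (p * (p * (p * (1 / c))) + 1) := by
            gcongr
            · exact min_le_right _ _
            · linarith
        _ = 1 / 2 := div_mul_cancel₀ _ (by positivity)
  set A' := A * (p * (1 / c)) with hA'
  have hA'0 : 0 ≤ A' := by positivity
  have hw : ∀ i r, |(a i ᵥ* (S i)⁻¹) r| ≤ A' := fun i r => abs_vecMul_inv_le hc hS i hA (ha i) r
  refine ⟨δ, p * (p * (A' * (2 * (p * (1 / c) * (p * √C)) + p * (p * (1 / (c / 2)) * √C)))), hδ,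
    by positivity, fun k => ?_⟩
  -- The number of expansions is taken to be `k` itself, so that the remainder `2⁻ᵏ k` is at most
  -- `√k`. One further expansion, done outside the auxiliary lemma, exposes the factor `d`.
  have hB := fun x y : Fin p => exists_dominating_aux h hc hS hC hSC hδ.le hδc hδp k k A'
    (fun i => entryVec (a i ᵥ* (S i)⁻¹) x y) hA'0
    (fun i r => abs_entryVec_le hA'0 (hw i) x y r)
  choose B hBi hB0 hBE hBD using hB
  refine ⟨fun ω => ∑ x, ∑ y, B x y ω, integrable_finsetSum _ fun x _ =>
    integrable_finsetSum _ fun y _ => hBi x y, fun ω => Finset.sum_nonneg fun x _ =>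
    Finset.sum_nonneg fun y _ => hB0 x y ω, ?_, ?_⟩
  · have hk : (1 / 2 : ℝ) ^ k * k ≤ √k := by
      rcases Nat.eq_zero_or_pos k with rfl | hk
      · simp
      · have h1 : (k : ℝ) ≤ 2 ^ k := by exact_mod_cast (Nat.lt_two_pow_self).le
        have h2 : (1 : ℝ) ≤ √k := Real.one_le_sqrt.2 (by exact_mod_cast hk)
        calc (1 / 2 : ℝ) ^ k * k ≤ (1 / 2 : ℝ) ^ k * 2 ^ k := by gcongr
          _ = 1 := by rw [← mul_pow]; norm_num
          _ ≤ _ := h2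
    rw [integral_finsetSum _ fun x _ => integrable_finsetSum _ fun y _ => hBi x y]
    calc _ ≤ ∑ _x : Fin p, ∑ _y : Fin p,
          A' * ((2 * (p * (1 / c) * (p * √C)) + p * (p * (1 / (c / 2)) * √C)) * √k) := by
          refine Finset.sum_le_sum fun x _ => ?_
          rw [integral_finsetSum _ fun y _ => hBi x y]
          refine Finset.sum_le_sum fun y _ => (hBE x y).trans ?_
          gcongr
          calc _ = 2 * (p * (1 / c) * (p * √C)) * √k +
                p * (p * (1 / (c / 2)) * √C) * ((1 / 2) ^ k * k) := by ring
            _ ≤ 2 * (p * (1 / c) * (p * √C)) * √k + p * (p * (1 / (c / 2)) * √C) * √k := by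
                gcongr
            _ = _ := by ring
      _ = _ := by simp; ring
  · intro ω D d hd hD
    -- For `p = 0` the bound on the entries of `D` is vacuous and does not give `0 ≤ d`, but then
    -- all sums vanish.
    rcases isEmpty_or_nonempty (Fin p) with hp | ⟨⟨x₀⟩⟩
    · have : ∀ i, IsEmpty (obs i) := fun i => ⟨fun r => hp.false r.1⟩
      simp [dotProduct]
    have hd0 : 0 ≤ d := (abs_nonneg _).trans (hD x₀ x₀)
    have hDδ : ∀ a b, |D a b| ≤ δ := fun a b => (hD a b).trans hd
    have h1 : ∑ i ∈ Finset.range k, (a i ⬝ᵥ (S i + block D (obs i))⁻¹ *ᵥ e i ω -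
          a i ⬝ᵥ (S i)⁻¹ *ᵥ e i ω) = -∑ x, ∑ y, D x y *
            ∑ i ∈ Finset.range k, entryVec (a i ᵥ* (S i)⁻¹) x y ⬝ᵥ
              (S i + block D (obs i))⁻¹ *ᵥ e i ω := by
      simp_rw [Finset.mul_sum]
      rw [Finset.sum_congr rfl fun x _ => Finset.sum_comm, Finset.sum_comm,
        ← Finset.sum_neg_distrib]
      exact Finset.sum_congr rfl fun i _ =>
        dotProduct_inv_mulVec_eq hc hS hδ.le hδc hDδ i (a i) (e i ω)
    rw [h1, abs_neg, Finset.mul_sum]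
    refine (Finset.abs_sum_le_sum_abs _ _).trans (Finset.sum_le_sum fun x _ => ?_)
    rw [Finset.mul_sum]
    refine (Finset.abs_sum_le_sum_abs _ _).trans (Finset.sum_le_sum fun y _ => ?_)
    rw [abs_mul]
    exact mul_le_mul (hD x y) (hBD x y ω D hDδ) (abs_nonneg _) hd0

end Equicontinuity

end MetaRegression

namespace MetaRegression

/-! ### Approximation of matrix families, uniformly over the studies -/

section UnifApprox

variable {ι : Type*} {l : Filter ι} {m n o : ℕ → Type}

/-- Families of matrices `f x i` and `g x i` that are close along `l`, uniformly in the study `i`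
and relative to the weights `ν x i`, where `g` is bounded relative to the same weights. -/
def UnifApprox (l : Filter ι) (ν : ι → ℕ → ℝ) (f g : ι → ∀ i, Matrix (m i) (n i) ℝ) : Prop :=
  (∃ C, 0 ≤ C ∧ ∀ᶠ x in l, ∀ i r s, |g x i r s| ≤ C * ν x i) ∧
    ∀ ε > 0, ∀ᶠ x in l, ∀ i r s, |f x i r s - g x i r s| ≤ ε * ν x i

namespace UnifApprox

variable {ν ν' : ι → ℕ → ℝ}

lemma of_bounded {g : ι → ∀ i, Matrix (m i) (n i) ℝ} {C : ℝ} (hC : 0 ≤ C) (hν : ∀ x i, 0 ≤ ν x i)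
    (h : ∀ᶠ x in l, ∀ i r s, |g x i r s| ≤ C * ν x i) : UnifApprox l ν g g :=
  ⟨⟨C, hC, h⟩, fun ε hε => Eventually.of_forall fun x i r s => by
    simpa using mul_nonneg hε.le (hν x i)⟩

lemma bounded {f g : ι → ∀ i, Matrix (m i) (n i) ℝ} (h : UnifApprox l ν f g) :
    ∃ C, 0 ≤ C ∧ ∀ᶠ x in l, ∀ i r s, |f x i r s| ≤ C * ν x i := by
  obtain ⟨⟨C, hC, hg⟩, hfg⟩ := h
  refine ⟨C + 1, by positivity, ?_⟩
  filter_upwards [hg, hfg 1 one_pos] with x hx hx' i r s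
  have := abs_sub_abs_le_abs_sub (f x i r s) (g x i r s)
  linarith [hx i r s, hx' i r s]

lemma mul [∀ i, Fintype (n i)] {N : ℕ} (hN : ∀ i, Fintype.card (n i) ≤ N)
    {f g : ι → ∀ i, Matrix (m i) (n i) ℝ} {f' g' : ι → ∀ i, Matrix (n i) (o i) ℝ}
    (hν : ∀ x i, 0 ≤ ν x i) (hν' : ∀ x i, 0 ≤ ν' x i)
    (h : UnifApprox l ν f g) (h' : UnifApprox l ν' f' g') :
    UnifApprox l (fun x i => ν x i * ν' x i) (fun x i => f x i * f' x i)
      (fun x i => g x i * g' x i) := by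
  obtain ⟨C', hC', hf'⟩ := h'.bounded
  obtain ⟨⟨C, hC, hg⟩, hfg⟩ := h
  obtain ⟨⟨C₁, hC₁, hg'⟩, hfg'⟩ := h'
  refine ⟨⟨N * (C * C₁), by positivity, ?_⟩, fun ε hε => ?_⟩
  · filter_upwards [hg, hg'] with x hx hx' i r s
    calc _ ≤ N * (C * ν x i * (C₁ * ν' x i)) :=
          abs_mul_apply_le (hN i) (mul_nonneg hC (hν x i)) (mul_nonneg hC₁ (hν' x i)) (hx i) (hx' i)
            r s
      _ = _ := by ring
  · set η := ε / (N * (C + C') + 1) with hη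
    have hη0 : 0 < η := by positivity
    filter_upwards [hg, hf', hfg η hη0, hfg' η hη0] with x hgx hfx hd hd' i r s
    have e : f x i * f' x i - g x i * g' x i = (f x i - g x i) * f' x i +
        g x i * (f' x i - g' x i) := by
      rw [Matrix.sub_mul, Matrix.mul_sub]; abel
    have h1 := hν x i
    have h2 := hν' x i
    rw [← Matrix.sub_apply, e, Matrix.add_apply]
    calc _ ≤ N * (η * ν x i * (C' * ν' x i)) + N * (C * ν x i * (η * ν' x i)) :=
          (abs_add_le _ _).trans (add_le_add
            (abs_mul_apply_le (hN i) (by positivity) (by positivity) (hd i) (hfx i) r s)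
            (abs_mul_apply_le (hN i) (by positivity) (by positivity) (hgx i) (hd' i) r s))
      _ = N * (C + C') * η * (ν x i * ν' x i) := by ring
      _ ≤ ε * (ν x i * ν' x i) := by
          gcongr
          rw [hη, mul_div_assoc', div_le_iff₀ (by positivity)]
          nlinarith

lemma mul_one_left [∀ i, Fintype (n i)] {N : ℕ} (hN : ∀ i, Fintype.card (n i) ≤ N)
    {f g : ι → ∀ i, Matrix (m i) (n i) ℝ} {f' g' : ι → ∀ i, Matrix (n i) (o i) ℝ}
    (hν' : ∀ x i, 0 ≤ ν' x i)
    (h : UnifApprox l (fun _ _ => 1) f g) (h' : UnifApprox l ν' f' g') :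
    UnifApprox l ν' (fun x i => f x i * f' x i) (fun x i => g x i * g' x i) := by
  simpa using h.mul hN (fun _ _ => zero_le_one) hν' h'

lemma mul_one_right [∀ i, Fintype (n i)] {N : ℕ} (hN : ∀ i, Fintype.card (n i) ≤ N)
    {f g : ι → ∀ i, Matrix (m i) (n i) ℝ} {f' g' : ι → ∀ i, Matrix (n i) (o i) ℝ}
    (hν : ∀ x i, 0 ≤ ν x i)
    (h : UnifApprox l ν f g) (h' : UnifApprox l (fun _ _ => 1) f' g') :
    UnifApprox l ν (fun x i => f x i * f' x i) (fun x i => g x i * g' x i) := by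
  simpa using h.mul hN hν (fun _ _ => zero_le_one) h'

lemma transpose {f g : ι → ∀ i, Matrix (m i) (n i) ℝ} (h : UnifApprox l ν f g) :
    UnifApprox l ν (fun x i => (f x i)ᵀ) (fun x i => (g x i)ᵀ) := by
  obtain ⟨⟨C, hC, hg⟩, hfg⟩ := h
  refine ⟨⟨C, hC, ?_⟩, fun ε hε => ?_⟩
  · filter_upwards [hg] with x hx i r s using hx i s r
  · filter_upwards [hfg ε hε] with x hx i r s using hx i s r

lemma add {f g f' g' : ι → ∀ i, Matrix (m i) (n i) ℝ} (h : UnifApprox l ν f g)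
    (h' : UnifApprox l ν f' g') :
    UnifApprox l ν (fun x i => f x i + f' x i) (fun x i => g x i + g' x i) := by
  obtain ⟨⟨C, hC, hg⟩, hfg⟩ := h
  obtain ⟨⟨C', hC', hg'⟩, hfg'⟩ := h'
  refine ⟨⟨C + C', by positivity, ?_⟩, fun ε hε => ?_⟩
  · filter_upwards [hg, hg'] with x hx hx' i r s
    rw [Matrix.add_apply]
    linarith [abs_add_le (g x i r s) (g' x i r s), hx i r s, hx' i r s]
  · filter_upwards [hfg _ (half_pos hε), hfg' _ (half_pos hε)] with x hx hx' i r s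
    rw [Matrix.add_apply, Matrix.add_apply, add_sub_add_comm]
    linarith [abs_add_le (f x i r s - g x i r s) (f' x i r s - g' x i r s), hx i r s, hx' i r s]

lemma neg {f g : ι → ∀ i, Matrix (m i) (n i) ℝ} (h : UnifApprox l ν f g) :
    UnifApprox l ν (fun x i => -f x i) (fun x i => -g x i) := by
  obtain ⟨⟨C, hC, hg⟩, hfg⟩ := h
  refine ⟨⟨C, hC, ?_⟩, fun ε hε => ?_⟩
  · filter_upwards [hg] with x hx i r s
    simpa using hx i r s
  · filter_upwards [hfg ε hε] with x hx i r s
    rw [Matrix.neg_apply, Matrix.neg_apply, neg_sub_neg, abs_sub_comm]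
    exact hx i r s

lemma sub {f g f' g' : ι → ∀ i, Matrix (m i) (n i) ℝ} (h : UnifApprox l ν f g)
    (h' : UnifApprox l ν f' g') :
    UnifApprox l ν (fun x i => f x i - f' x i) (fun x i => g x i - g' x i) := by
  simpa only [sub_eq_add_neg] using h.add h'.neg

lemma mono {f g : ι → ∀ i, Matrix (m i) (n i) ℝ} (h : UnifApprox l ν f g)
    (hν : ∀ x i, ν x i ≤ ν' x i) : UnifApprox l ν' f g := by
  obtain ⟨⟨C, hC, hg⟩, hfg⟩ := h
  refine ⟨⟨C, hC, ?_⟩, fun ε hε => ?_⟩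
  · filter_upwards [hg] with x hx i r s
    exact (hx i r s).trans (mul_le_mul_of_nonneg_left (hν x i) hC)
  · filter_upwards [hfg ε hε] with x hx i r s
    exact (hx i r s).trans (mul_le_mul_of_nonneg_left (hν x i) hε.le)

lemma diagonal [∀ i, DecidableEq (m i)] {f g : ι → ∀ i, Matrix (m i) (m i) ℝ}
    (hν : ∀ x i, 0 ≤ ν x i) (h : UnifApprox l ν f g) :
    UnifApprox l ν (fun x i => Matrix.diagonal (f x i).diag)
      (fun x i => Matrix.diagonal (g x i).diag) := by
  obtain ⟨⟨C, hC, hg⟩, hfg⟩ := h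
  refine ⟨⟨C, hC, ?_⟩, fun ε hε => ?_⟩
  · filter_upwards [hg] with x hx i r s
    by_cases hrs : r = s
    · subst hrs; simpa using hx i r r
    · simpa [Matrix.diagonal_apply_ne _ hrs] using mul_nonneg hC (hν x i)
  · filter_upwards [hfg ε hε] with x hx i r s
    by_cases hrs : r = s
    · subst hrs; simpa using hx i r r
    · simpa [Matrix.diagonal_apply_ne _ hrs] using mul_nonneg hε.le (hν x i)

lemma of_tendsto {a b : Type} [Finite a] [Finite b] {M : ι → Matrix a b ℝ} {M₀ : Matrix a b ℝ}
    (h : Tendsto M l (𝓝 M₀)) :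
    UnifApprox l (fun _ _ => 1) (fun x (_ : ℕ) => M x) (fun _ _ => M₀) := by
  have := Fintype.ofFinite a
  have := Fintype.ofFinite b
  refine ⟨⟨∑ r, ∑ s, |M₀ r s|, Finset.sum_nonneg fun _ _ => Finset.sum_nonneg fun _ _ =>
    abs_nonneg _, Eventually.of_forall fun x _ r s => ?_⟩, fun ε hε => ?_⟩
  · rw [mul_one]
    exact (Finset.single_le_sum (f := fun s => |M₀ r s|) (fun _ _ => abs_nonneg _)
      (Finset.mem_univ s)).trans (Finset.single_le_sum (f := fun r => ∑ s, |M₀ r s|)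
      (fun _ _ => Finset.sum_nonneg fun _ _ => abs_nonneg _) (Finset.mem_univ r))
  · have h1 : ∀ r s, ∀ᶠ x in l, |M x r s - M₀ r s| ≤ ε * 1 := fun r s => by
      have := (tendsto_pi_nhds.1 ((tendsto_pi_nhds.1 h) r)) s
      filter_upwards [(Metric.tendsto_nhds.1 this) ε hε] with x hx
      rw [mul_one]
      exact hx.le
    filter_upwards [eventually_all.2 fun r => eventually_all.2 (h1 r)] with x hx i r s using hx r s

lemma one [∀ i, DecidableEq (m i)] {f : ι → ∀ i, Matrix (m i) (m i) ℝ}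
    (h : ∀ ε > 0, ∀ᶠ x in l, ∀ i r s, |(f x i - 1) r s| ≤ ε) :
    UnifApprox l (fun _ _ => 1) f (fun _ _ => 1) := by
  refine ⟨⟨1, zero_le_one, Eventually.of_forall fun x i r s => ?_⟩, fun ε hε => ?_⟩
  · change |(1 : Matrix (m i) (m i) ℝ) r s| ≤ 1 * 1
    rw [Matrix.one_apply]
    split_ifs <;> simp
  · filter_upwards [h ε hε] with x hx i r s
    simpa using hx i r s

lemma diagonal_one [∀ i, DecidableEq (m i)] {f : ι → ∀ i, m i → ℝ}
    (h : ∀ ε > 0, ∀ᶠ x in l, ∀ i r, |f x i r - 1| ≤ ε) :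
    UnifApprox l (fun _ _ => 1) (fun x i => Matrix.diagonal (f x i)) (fun _ _ => 1) := by
  refine one fun ε hε => ?_
  filter_upwards [h ε hε] with x hx i r s
  by_cases hrs : r = s
  · subst hrs; simpa using hx i r
  · simpa [Matrix.diagonal_apply_ne _ hrs, Matrix.one_apply_ne hrs] using hε.le

/-- Averages of close families are close. -/
lemma tendsto_average {a b : Type} {f g : ι → ℕ → Matrix a b ℝ} {k : ι → ℕ}
    (h : UnifApprox l ν f g) {C : ℝ}
    (hν : ∀ᶠ x in l, ∑ i ∈ Finset.range (k x), ν x i ≤ C * k x) :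
    Tendsto (fun x => (k x : ℝ)⁻¹ • ∑ i ∈ Finset.range (k x), f x i -
      (k x : ℝ)⁻¹ • ∑ i ∈ Finset.range (k x), g x i) l (𝓝 0) := by
  refine tendsto_pi_nhds.2 fun r => tendsto_pi_nhds.2 fun s => ?_
  rw [Metric.tendsto_nhds]
  intro ε hε
  have hη : 0 < ε / (|C| + 1) := by positivity
  filter_upwards [hν, h.2 _ hη] with x hx hd
  rw [Real.dist_eq, Matrix.zero_apply, sub_zero, ← smul_sub, ← Finset.sum_sub_distrib,
    Matrix.smul_apply, Matrix.sum_apply, smul_eq_mul]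
  rcases Nat.eq_zero_or_pos (k x) with h0 | h0
  · simpa [h0] using hε
  have h0' : (0 : ℝ) < k x := Nat.cast_pos.2 h0
  rw [abs_mul, abs_of_pos (inv_pos.2 h0'), inv_mul_lt_iff₀ h0']
  calc _ ≤ ∑ i ∈ Finset.range (k x), ε / (|C| + 1) * ν x i :=
        (Finset.abs_sum_le_sum_abs _ _).trans (Finset.sum_le_sum fun i _ => hd i r s)
    _ ≤ ε / (|C| + 1) * (|C| * k x) := by
        rw [← Finset.mul_sum]
        gcongr
        exact hx.trans (by gcongr; exact le_abs_self C)
    _ = ε * (|C| / (|C| + 1)) * k x := by ring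
    _ < ε * 1 * k x := by
        gcongr
        rw [div_lt_one (by positivity)]
        linarith
    _ = k x * ε := by ring

end UnifApprox

/-- The power is `exp (log (1 - h) * y)`, and `log (1 - h)` is small while `y` stays bounded. The
uniformity in `y` is needed since the CR4 exponents vary with the study and the effect. -/
lemma exists_abs_rpow_sub_one_le (L : ℝ) {ε : ℝ} (hε : 0 < ε) :
    ∃ δ > 0, ∀ h y : ℝ, |h| ≤ δ → |y| ≤ L → |(1 - h) ^ y - 1| ≤ ε := by
  obtain ⟨η, hη, hexp⟩ := Metric.continuousAt_iff.1 (Real.continuous_exp.continuousAt (x := 0)) ε hε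
  have hlog : ContinuousAt (fun h : ℝ => Real.log (1 - h)) 0 :=
    ContinuousAt.log (by fun_prop) (by norm_num)
  have hL : 0 < |L| + 1 := by positivity
  obtain ⟨δ, hδ, hlogδ⟩ := Metric.continuousAt_iff.1 hlog (η / (|L| + 1)) (by positivity)
  refine ⟨min (δ / 2) (1 / 2), by positivity, fun h y hh hy => ?_⟩
  have h1 : |h| < δ := (hh.trans (min_le_left _ _)).trans_lt (half_lt_self hδ)
  have h2 : |h| ≤ 1 / 2 := hh.trans (min_le_right _ _)
  have h3 : 0 < 1 - h := by linarith [(abs_le.1 h2).2]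
  rw [Real.rpow_def_of_pos h3]
  have h4 := hlogδ (x := h) (by simpa [Real.dist_eq] using h1)
  simp only [Real.dist_eq, sub_zero, Real.log_one] at h4
  have h5 : |Real.log (1 - h) * y| < η := by
    rw [abs_mul]
    calc _ ≤ |Real.log (1 - h)| * (|L| + 1) := by
          gcongr
          linarith [le_abs_self L]
      _ < η / (|L| + 1) * (|L| + 1) := by gcongr
      _ = η := div_mul_cancel₀ _ hL.ne'
  have h6 := hexp (x := Real.log (1 - h) * y) (by simpa [Real.dist_eq, abs_mul] using h5)
  rw [Real.dist_eq, Real.exp_zero] at h6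
  exact h6.le

lemma tendsto_matrix_inv {n : Type*} [Fintype n] [DecidableEq n] {A : ι → Matrix n n ℝ}
    {A₀ : Matrix n n ℝ} (h : Tendsto A l (𝓝 A₀)) (hA : IsUnit A₀) :
    Tendsto (fun x => (A x)⁻¹) l (𝓝 A₀⁻¹) := by
  have hdet : A₀.det ≠ 0 := ((Matrix.isUnit_iff_isUnit_det A₀).1 hA).ne_zero
  simp only [Matrix.inv_def, Ring.inverse_eq_inv']
  have h1 : Tendsto (fun x => (A x).det) l (𝓝 A₀.det) :=
    ((continuous_id.matrix_det).tendsto A₀).comp h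
  have h2 : Tendsto (fun x => (A x).adjugate) l (𝓝 A₀.adjugate) :=
    ((continuous_id.matrix_adjugate).tendsto A₀).comp h
  exact (h1.inv₀ hdet).smul h2

end UnifApprox

end MetaRegression

namespace MetaRegression

/-! ### The deterministic argument along a filter with convergent normalizations -/

section LimitSetting

variable {ι : Type*} {l : Filter ι} {p q : ℕ} {k : ι → ℕ} {obs : ℕ → Finset (Fin p)}
  {X : ∀ i, Matrix (obs i) (Fin q) ℝ} {S : ∀ i, Matrix (obs i) (obs i) ℝ}
  {Sh : ι → ∀ i, Matrix (obs i) (obs i) ℝ} {e : ι → ∀ i, obs i → ℝ} {β : Fin q → ℝ}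
  {M₀ G₀ : Matrix (Fin q) (Fin q) ℝ} {s₀ : Fin q → ℝ}

/-- The data with working covariance matrices `S`, errors `e` and true coefficients `β`. -/
abbrev errorData (X : ∀ i, Matrix (obs i) (Fin q) ℝ) (S : ∀ i, Matrix (obs i) (obs i) ℝ)
    (β : Fin q → ℝ) (e : ∀ i, obs i → ℝ) : Data p q :=
  { obs := obs, X := X, S := S, Y := fun i => X i *ᵥ β + e i }

/-- Everything that the deterministic part of the argument uses about a filter `l` (an ultrafilter
that refines convergence in probability): the true and estimated weights get close uniformly, and
the normalized matrices and scores converge. -/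
structure LimitSetting (l : Filter ι) (k : ι → ℕ) (X : ∀ i, Matrix (obs i) (Fin q) ℝ)
    (S : ∀ i, Matrix (obs i) (obs i) ℝ) (Sh : ι → ∀ i, Matrix (obs i) (obs i) ℝ)
    (e : ι → ∀ i, obs i → ℝ) (M₀ G₀ : Matrix (Fin q) (Fin q) ℝ) (s₀ : Fin q → ℝ) : Prop where
  tendsto_k : Tendsto k l atTop
  lower : ∃ c, 0 < c ∧ ∀ i v, c * (v ⬝ᵥ v) ≤ v ⬝ᵥ S i *ᵥ v
  bddX : ∃ C, ∀ i r a, |X i r a| ≤ C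
  bddS : ∃ C, ∀ i r t, |S i r t| ≤ C
  isHermitian : ∀ x i, (Sh x i).IsHermitian
  approxS : ∀ ε > 0, ∀ᶠ x in l, ∀ i r t, |Sh x i r t - S i r t| ≤ ε
  isUnit_gram : ∀ᶠ x in l, IsUnit (∑ i ∈ Finset.range (k x), (X i)ᵀ * (Sh x i)⁻¹ * X i)
  tendsto_bread : Tendsto (fun x =>
    (k x : ℝ) • (∑ i ∈ Finset.range (k x), (X i)ᵀ * (Sh x i)⁻¹ * X i)⁻¹) l (𝓝 M₀)
  tendsto_gram : Tendsto (fun x =>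
    (k x : ℝ)⁻¹ • ∑ i ∈ Finset.range (k x), (X i)ᵀ * (S i)⁻¹ * X i) l (𝓝 G₀)
  tendsto_score : Tendsto (fun x =>
    (√(k x))⁻¹ • ∑ i ∈ Finset.range (k x), ((X i)ᵀ * (S i)⁻¹) *ᵥ e x i) l (𝓝 s₀)
  tendsto_score_sub : Tendsto (fun x => (√(k x))⁻¹ • ∑ i ∈ Finset.range (k x),
    (((X i)ᵀ * (Sh x i)⁻¹) *ᵥ e x i - ((X i)ᵀ * (S i)⁻¹) *ᵥ e x i)) l (𝓝 0)
  average_sq : ∃ C, ∀ᶠ x in l, ∑ i ∈ Finset.range (k x), (1 + e x i ⬝ᵥ e x i) ≤ C * k x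
  tendsto_meat : Tendsto (fun x => (k x : ℝ)⁻¹ • ∑ i ∈ Finset.range (k x),
    (X i)ᵀ * (S i)⁻¹ * Matrix.vecMulVec (e x i) (e x i) * (S i)⁻¹ * X i) l (𝓝 G₀)

lemma weight_nonneg (x : ι) (i : ℕ) : 0 ≤ 1 + e x i ⬝ᵥ e x i :=
  add_nonneg zero_le_one (Finset.sum_nonneg fun _ _ => mul_self_nonneg _)

namespace LimitSetting

variable (h : LimitSetting l k X S Sh e M₀ G₀ s₀)
include h

lemma eventually_pos : ∀ᶠ x in l, 0 < k x := h.tendsto_k.eventually_gt_atTop 0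

lemma exists_lower : ∃ c, 0 < c ∧ ∀ᶠ x in l, ∀ i v, c * (v ⬝ᵥ v) ≤ v ⬝ᵥ Sh x i *ᵥ v := by
  obtain ⟨c, hc, hS⟩ := h.lower
  refine ⟨c / 2, half_pos hc, ?_⟩
  filter_upwards [h.approxS (c / 2 / (p + 1)) (by positivity)] with x hx i v
  refine quadratic_ge_of_abs_sub_le (card_obs_le i) (by positivity) (hS i) (hx i) ?_ v
  rw [mul_div_assoc', div_le_iff₀ (by positivity)]
  nlinarith

lemma exists_bddX : ∃ C, 0 ≤ C ∧ ∀ i r a, |X i r a| ≤ C := by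
  obtain ⟨C, hC⟩ := h.bddX
  exact ⟨|C|, abs_nonneg _, fun i r a => (hC i r a).trans (le_abs_self _)⟩

lemma exists_bddS : ∃ C, 0 < C ∧ ∀ i r a, |S i r a| ≤ C := by
  obtain ⟨C, hC⟩ := h.bddS
  exact ⟨|C| + 1, by positivity, fun i r a => (hC i r a).trans (by linarith [le_abs_self C])⟩

lemma approxX : UnifApprox l (fun _ _ => 1) (fun _ => X) (fun _ => X) := by
  obtain ⟨C, hC, hX⟩ := h.exists_bddX
  exact UnifApprox.of_bounded hC (fun _ _ => zero_le_one)
    (Eventually.of_forall fun _ i r s => by simpa using hX i r s)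

lemma approxW : UnifApprox l (fun _ _ => 1) (fun x i => (Sh x i)⁻¹) (fun _ i => (S i)⁻¹) := by
  obtain ⟨c, hc, hS⟩ := h.lower
  obtain ⟨c', hc', hSh⟩ := h.exists_lower
  refine ⟨⟨1 / c, by positivity, Eventually.of_forall fun _ i r s => ?_⟩, fun ε hε => ?_⟩
  · rw [mul_one]; exact abs_inv_apply_le hc (hS i) r s
  · set η := ε / (p * (p * (1 / c * (1 / c'))) + 1) with hη
    have hη0 : 0 < η := by positivity
    filter_upwards [hSh, h.approxS η hη0] with x hx hd i r s
    rw [← Matrix.sub_apply, inv_sub_inv_eq (isUnit_of_quadratic_ge hc (hS i))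
      (isUnit_of_quadratic_ge hc' (hx i)), Matrix.neg_apply, abs_neg]
    calc _ ≤ p * (p * (1 / c * η) * (1 / c')) :=
          abs_mul_apply_le (card_obs_le i) (by positivity) (by positivity)
            (abs_mul_apply_le (card_obs_le i) (by positivity) hη0.le (abs_inv_apply_le hc (hS i))
              (hd i)) (abs_inv_apply_le hc' (hx i)) r s
      _ = p * (p * (1 / c * (1 / c'))) * η := by ring
      _ ≤ ε * 1 := by
          rw [hη, mul_div_assoc', div_le_iff₀ (by positivity)]
          nlinarith [show 0 ≤ (p : ℝ) * (p * (1 / c * (1 / c'))) by positivity]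

lemma tendsto_gramHat : Tendsto (fun x =>
    (k x : ℝ)⁻¹ • ∑ i ∈ Finset.range (k x), (X i)ᵀ * (Sh x i)⁻¹ * X i) l (𝓝 G₀) := by
  have h1 := ((h.approxX.transpose.mul_one_left (fun i => card_obs_le i)
    (fun _ _ => zero_le_one) h.approxW).mul_one_left (fun i => card_obs_le i)
    (fun _ _ => zero_le_one) h.approxX).tendsto_average (k := k) (C := 1)
      (Eventually.of_forall fun x => by simp)
  simpa using h1.add h.tendsto_gram

/-- The product is the identity before the limit when both factors carry the estimated weights, and
exchanging estimated for true weights does not change the limit of the second factor. This ties the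
limit of the estimated bread to the true covariance of the score. -/
lemma bread_mul_gram [l.NeBot] : M₀ * G₀ = 1 := by
  refine tendsto_nhds_unique ((h.tendsto_bread.mul h.tendsto_gramHat).congr' ?_)
    tendsto_const_nhds
  filter_upwards [h.isUnit_gram, h.eventually_pos] with x hx hk
  have hk' : (k x : ℝ) ≠ 0 := by exact_mod_cast hk.ne'
  rw [Matrix.smul_mul, Matrix.mul_smul, smul_smul, mul_inv_cancel₀ hk', one_smul,
    Matrix.nonsing_inv_mul _ ((Matrix.isUnit_iff_isUnit_det _).1 hx)]

lemma tendsto_scoreHat : Tendsto (fun x =>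
    (√(k x))⁻¹ • ∑ i ∈ Finset.range (k x), ((X i)ᵀ * (Sh x i)⁻¹) *ᵥ e x i) l (𝓝 s₀) := by
  have h1 := h.tendsto_score_sub.add h.tendsto_score
  rw [zero_add] at h1
  refine h1.congr fun x => ?_
  rw [← smul_add, ← Finset.sum_add_distrib]
  simp

lemma betaHat_sub : ∀ᶠ x in l, (errorData X (Sh x) β (e x)).betaHat (k x) - β =
    (∑ i ∈ Finset.range (k x), (X i)ᵀ * (Sh x i)⁻¹ * X i)⁻¹ *ᵥ
      ∑ i ∈ Finset.range (k x), ((X i)ᵀ * (Sh x i)⁻¹) *ᵥ e x i := by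
  filter_upwards [h.isUnit_gram] with x hx
  change (∑ i ∈ Finset.range (k x), (X i)ᵀ * (Sh x i)⁻¹ * X i)⁻¹ *ᵥ
    (∑ i ∈ Finset.range (k x), ((X i)ᵀ * (Sh x i)⁻¹) *ᵥ (X i *ᵥ β + e x i)) - β = _
  have h1 : ∑ i ∈ Finset.range (k x), ((X i)ᵀ * (Sh x i)⁻¹) *ᵥ (X i *ᵥ β + e x i) =
      (∑ i ∈ Finset.range (k x), (X i)ᵀ * (Sh x i)⁻¹ * X i) *ᵥ β +
      ∑ i ∈ Finset.range (k x), ((X i)ᵀ * (Sh x i)⁻¹) *ᵥ e x i := by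
    rw [Matrix.sum_mulVec, ← Finset.sum_add_distrib]
    refine Finset.sum_congr rfl fun i _ => ?_
    rw [Matrix.mulVec_add, Matrix.mulVec_mulVec]
  rw [h1, Matrix.mulVec_add, Matrix.mulVec_mulVec,
    Matrix.nonsing_inv_mul _ ((Matrix.isUnit_iff_isUnit_det _).1 hx), Matrix.one_mulVec,
    add_sub_cancel_left]

lemma tendsto_sqrt_smul_betaHat_sub : Tendsto (fun x =>
    √(k x) • ((errorData X (Sh x) β (e x)).betaHat (k x) - β)) l (𝓝 (M₀ *ᵥ s₀)) := by
  have h1 : Tendsto (fun x => ((k x : ℝ) • (∑ i ∈ Finset.range (k x),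
      (X i)ᵀ * (Sh x i)⁻¹ * X i)⁻¹) *ᵥ ((√(k x))⁻¹ • ∑ i ∈ Finset.range (k x),
      ((X i)ᵀ * (Sh x i)⁻¹) *ᵥ e x i)) l (𝓝 (M₀ *ᵥ s₀)) :=
    ((Continuous.matrix_mulVec continuous_fst continuous_snd).tendsto (M₀, s₀)).comp
      (h.tendsto_bread.prodMk_nhds h.tendsto_scoreHat)
  refine h1.congr' ?_
  filter_upwards [h.betaHat_sub (β := β), h.eventually_pos] with x hx hk
  have hk' : (0 : ℝ) < k x := by exact_mod_cast hk
  rw [hx, Matrix.smul_mulVec, Matrix.mulVec_smul, smul_smul]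
  congr 1
  rw [← div_eq_mul_inv, Real.div_sqrt]

lemma tendsto_inv_k : Tendsto (fun x => (k x : ℝ)⁻¹) l (𝓝 0) :=
  tendsto_inv_atTop_zero.comp (tendsto_natCast_atTop_atTop.comp h.tendsto_k)

lemma tendsto_inv_sqrt_k : Tendsto (fun x => (√(k x))⁻¹) l (𝓝 0) :=
  tendsto_inv_atTop_zero.comp
    (Real.tendsto_sqrt_atTop.comp (tendsto_natCast_atTop_atTop.comp h.tendsto_k))

lemma tendsto_betaHat_sub : Tendsto (fun x =>
    (errorData X (Sh x) β (e x)).betaHat (k x) - β) l (𝓝 0) := by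
  have h1 := h.tendsto_inv_sqrt_k.smul (h.tendsto_sqrt_smul_betaHat_sub (β := β))
  rw [zero_smul] at h1
  refine h1.congr' ?_
  filter_upwards [h.eventually_pos] with x hk
  have hk' : (0 : ℝ) < k x := by exact_mod_cast hk
  rw [smul_smul, inv_mul_cancel₀ (Real.sqrt_pos.2 hk').ne', one_smul]

/-- The factor `k` is absorbed by the bread, which converges after this normalization; all other
factors are bounded. Hence the blocks of the hat matrix are of order `1 / k`, uniformly over the
studies. -/
lemma approx_smul_hat : UnifApprox l (fun _ _ => 1)
    (fun x i => (k x : ℝ) • (errorData X (Sh x) β (e x)).hat (k x) i)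
    (fun _ i => X i * M₀ * (X i)ᵀ * (S i)⁻¹) := by
  have h1 := ((h.approxX.mul_one_left (N := q) (fun i => by simp) (fun _ _ => zero_le_one)
    (UnifApprox.of_tendsto h.tendsto_bread)).mul_one_left (N := q) (fun i => by simp)
    (fun _ _ => zero_le_one) h.approxX.transpose).mul_one_left (N := p) (fun i => card_obs_le i)
    (fun _ _ => zero_le_one) h.approxW
  convert h1 using 3 with x i
  rw [Matrix.mul_smul, Matrix.smul_mul, Matrix.smul_mul]
  rfl

/-- The entries of the diagonal blocks of the hat matrix are of order `1 / k`. -/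
lemma exists_abs_hat_le : ∃ C, 0 ≤ C ∧ ∀ᶠ x in l, ∀ i (r t : obs i),
    |(errorData X (Sh x) β (e x)).hat (k x) i r t| ≤ C * (k x : ℝ)⁻¹ := by
  obtain ⟨C, hC, hb⟩ := (h.approx_smul_hat (β := β)).bounded
  refine ⟨C, hC, ?_⟩
  filter_upwards [hb, h.eventually_pos] with x hx hk i r t
  have hk' : (0 : ℝ) < k x := by exact_mod_cast hk
  have := hx i r t
  rw [Matrix.smul_apply, smul_eq_mul, abs_mul, abs_of_pos hk', mul_one] at this
  rw [← div_eq_mul_inv, le_div_iff₀ hk', mul_comm]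
  exact this

lemma eventually_abs_hat_le {δ : ℝ} (hδ : 0 < δ) : ∀ᶠ x in l, ∀ i (r t : obs i),
    |(errorData X (Sh x) β (e x)).hat (k x) i r t| ≤ δ := by
  obtain ⟨C, hC, hb⟩ := h.exists_abs_hat_le (β := β)
  have h1 := h.tendsto_inv_k.const_mul C
  rw [mul_zero] at h1
  filter_upwards [hb, h1.eventually (ge_mem_nhds hδ)] with x hx hk i r t using (hx i r t).trans hk

lemma approx_adjust3 : UnifApprox (m := fun i => obs i) (n := fun i => obs i) l (fun _ _ => 1)
    (fun x i => (errorData X (Sh x) β (e x)).adjust3 (k x) i) (fun _ _ => 1) := by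
  refine UnifApprox.one fun ε hε => ?_
  set η : ℝ := min (1 / 2 / (p + 1)) (ε / (2 * (p + 1))) with hη
  have hη0 : 0 < η := by positivity
  filter_upwards [h.eventually_abs_hat_le (β := β) hη0] with x hx i r t
  have h1 : (p : ℝ) * η ≤ 1 / 2 := by
    calc (p : ℝ) * η ≤ (p + 1) * (1 / 2 / (p + 1)) := by
          gcongr
          · linarith
          · exact min_le_left _ _
      _ = 1 / 2 := by field_simp
  refine (abs_inv_one_sub_sub_one_le (card_obs_le i) hη0.le (hx i) h1 r t).trans ?_
  calc (p : ℝ) * (η * 2) ≤ (p + 1) * (ε / (2 * (p + 1)) * 2) := by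
        gcongr
        · linarith
        · exact min_le_right _ _
    _ = ε := by field_simp

lemma isHermitian_bread (x : ι) :
    ((errorData X (Sh x) β (e x)).bread (k x)).IsHermitian := by
  refine Matrix.IsHermitian.inv ?_
  unfold Data.gram Matrix.IsHermitian
  rw [Matrix.conjTranspose_sum]
  refine Finset.sum_congr rfl fun i _ => ?_
  have := Matrix.isHermitian_conjTranspose_mul_mul (X i) (h.isHermitian x i).inv
  rw [Matrix.conjTranspose_eq_transpose_of_trivial] at this
  exact this

lemma tendsto_breadHat : Tendsto (fun x => (errorData X (Sh x) β (e x)).bread (k x)) l (𝓝 0) := by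
  have h1 := h.tendsto_inv_k.smul h.tendsto_bread
  rw [zero_smul] at h1
  refine h1.congr' ?_
  filter_upwards [h.eventually_pos] with x hk
  have hk' : (k x : ℝ) ≠ 0 := by exact_mod_cast hk.ne'
  rw [smul_smul, inv_mul_cancel₀ hk', one_smul]
  rfl

/-- The perturbation `X_i M X_i'` tends to zero uniformly over the studies, and the adjustment is
Lipschitz in it near zero. -/
lemma approx_adjust2 : UnifApprox (m := fun i => obs i) (n := fun i => obs i) l (fun _ _ => 1)
    (fun x i => (errorData X (Sh x) β (e x)).adjust2 (k x) i) (fun _ _ => 1) := by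
  refine UnifApprox.one fun ε hε => ?_
  obtain ⟨c, hc, hSh⟩ := h.exists_lower
  obtain ⟨C, hC, hS⟩ := h.exists_bddS
  obtain ⟨K, δ, hδ, hK, hadj⟩ := exists_abs_adjustment_sub_one_le p hc
    (show 0 < C + 1 by positivity)
  have h1 := (h.approxX.mul_one_left (N := q) (fun i => by simp) (fun _ _ => zero_le_one)
    (UnifApprox.of_tendsto (h.tendsto_breadHat (β := β)))).mul_one_left (N := q) (fun i => by simp)
    (fun _ _ => zero_le_one) h.approxX.transpose
  set η := min δ (ε / (K + 1)) with hη
  have hη0 : 0 < η := by positivity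
  filter_upwards [hSh, h.approxS 1 one_pos, h1.2 η hη0] with x hx hd hN i r t
  have h2 : ∀ r t, |(X i * (errorData X (Sh x) β (e x)).bread (k x) * (X i)ᵀ) r t| ≤ η :=
    fun r t => by simpa using hN i r t
  have hNh : (X i * (errorData X (Sh x) β (e x)).bread (k x) * (X i)ᵀ).IsHermitian := by
    have := Matrix.isHermitian_mul_mul_conjTranspose (X i) (h.isHermitian_bread (β := β) x)
    rwa [Matrix.conjTranspose_eq_transpose_of_trivial] at this
  have h3 := hadj (card_obs_le i) (h.isHermitian x i) hNh (hx i) (fun r t => by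
    have := abs_sub_abs_le_abs_sub (Sh x i r t) (S i r t)
    linarith [hd i r t, hS i r t]) hη0.le (min_le_left _ _) h2 r t
  refine h3.trans ?_
  calc K * η ≤ (K + 1) * (ε / (K + 1)) := by
        gcongr
        · linarith
        · exact min_le_right _ _
    _ = ε := by field_simp

/-- The residual is `e_i - X_i (β̂ - β)`, whose second part tends to zero uniformly over the
studies. Residuals are treated as columns of weight `√(1 + |e_i|²)`, so that the product rule yields
the weight `1 + |e_i|²`, which is bounded on average. The summand `1` makes the weight dominate the
correction even where the error is small. -/
lemma approx_omega : UnifApprox l (fun x i => 1 + e x i ⬝ᵥ e x i)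
    (fun x i => (errorData X (Sh x) β (e x)).omega (k x) i)
    (fun x i => Matrix.vecMulVec (e x i) (e x i)) := by
  have hpos : ∀ x i, 0 ≤ e x i ⬝ᵥ e x i := fun x i =>
    Finset.sum_nonneg fun _ _ => mul_self_nonneg _
  have he : UnifApprox l (fun x i => √(1 + e x i ⬝ᵥ e x i))
      (fun x i => Matrix.replicateCol Unit (e x i)) (fun x i => Matrix.replicateCol Unit (e x i)) :=
    UnifApprox.of_bounded zero_le_one (fun _ _ => Real.sqrt_nonneg _)
      (Eventually.of_forall fun x i r s => by
        rw [one_mul]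
        refine Real.abs_le_sqrt ?_
        have := sq_apply_le_dotProduct_self (e x i) r
        simp only [Matrix.replicateCol_apply]
        linarith)
  have hb : Tendsto (fun x => Matrix.replicateCol Unit
      ((errorData X (Sh x) β (e x)).betaHat (k x) - β)) l (𝓝 0) := by
    refine tendsto_pi_nhds.2 fun r => tendsto_pi_nhds.2 fun _ => ?_
    exact (tendsto_pi_nhds.1 (h.tendsto_betaHat_sub (β := β))) r
  have hE : UnifApprox l (fun x i => √(1 + e x i ⬝ᵥ e x i))
      (fun x i => Matrix.replicateCol Unit ((errorData X (Sh x) β (e x)).resid (k x) i))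
      (fun x i => Matrix.replicateCol Unit (e x i)) := by
    have h1 := he.sub (((h.approxX.mul_one_left (N := q) (fun i => by simp)
      (fun _ _ => zero_le_one) (UnifApprox.of_tendsto hb))).mono fun x i => by
        rw [Real.one_le_sqrt]; linarith [hpos x i])
    simp only [Matrix.mul_zero, sub_zero] at h1
    convert h1 using 3 with x i
    rw [← Matrix.replicateCol_mulVec, Matrix.mulVec_sub]
    ext r t
    simp only [Matrix.replicateCol_apply, Matrix.sub_apply, Pi.sub_apply, Data.resid, Pi.add_apply]
    ring
  have h2 := hE.mul (N := 1) (fun i => by simp) (fun _ _ => Real.sqrt_nonneg _)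
    (fun _ _ => Real.sqrt_nonneg _) hE.transpose
  have h3 : (fun x i => √(1 + e x i ⬝ᵥ e x i) * √(1 + e x i ⬝ᵥ e x i)) =
      fun x i => 1 + e x i ⬝ᵥ e x i := by
    ext x i
    exact Real.mul_self_sqrt (by linarith [hpos x i])
  rw [h3] at h2
  simp only [Data.omega, Matrix.vecMulVec_eq Unit]
  simpa only [Matrix.transpose_replicateCol] using h2

/-- Adjustments by matrices close to the identity do not matter. -/
lemma approx_conj_omega {A : ι → ∀ i, Matrix (obs i) (obs i) ℝ}
    (hA : UnifApprox l (fun _ _ => 1) A (fun _ _ => 1)) :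
    UnifApprox l (fun x i => 1 + e x i ⬝ᵥ e x i)
    (fun x i => A x i * (errorData X (Sh x) β (e x)).omega (k x) i * (A x i)ᵀ)
    (fun x i => Matrix.vecMulVec (e x i) (e x i)) := by
  have := (hA.mul_one_left (fun i => card_obs_le i) weight_nonneg
    (h.approx_omega (β := β))).mul_one_right (fun i => card_obs_le i) weight_nonneg hA.transpose
  simpa using this

lemma approx_delta_omega {τ : ι → ∀ i, obs i → ℝ}
    (hτ : ∀ ε > 0, ∀ᶠ x in l, ∀ i r, |τ x i r - 1| ≤ ε) :
    UnifApprox l (fun x i => 1 + e x i ⬝ᵥ e x i)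
    (fun x i => (errorData X (Sh x) β (e x)).omega (k x) i -
      (errorData X (Sh x) β (e x)).delta (k x) i +
      (errorData X (Sh x) β (e x)).delta (k x) i * Matrix.diagonal (τ x i))
    (fun x i => Matrix.vecMulVec (e x i) (e x i)) := by
  have hω := h.approx_omega (β := β)
  have hδ := hω.diagonal weight_nonneg
  have := (hω.sub hδ).add (hδ.mul_one_right (fun i => card_obs_le i) weight_nonneg
    (UnifApprox.diagonal_one hτ))
  simp only [mul_one, sub_add_cancel] at this
  exact this

lemma approx_omega3star : UnifApprox l (fun x i => 1 + e x i ⬝ᵥ e x i)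
    (fun x i => (errorData X (Sh x) β (e x)).omega3star (k x) i)
    (fun x i => Matrix.vecMulVec (e x i) (e x i)) := by
  refine h.approx_delta_omega fun ε hε => ?_
  have hc : ContinuousAt (fun y : ℝ => ((1 - y) ^ 2)⁻¹) 0 :=
    ContinuousAt.inv₀ (by fun_prop) (by norm_num)
  obtain ⟨δ, hδ, hcδ⟩ := Metric.continuousAt_iff.1 hc ε hε
  filter_upwards [h.eventually_abs_hat_le (β := β) (half_pos hδ)] with x hx i r
  have h1 := hcδ (x := (errorData X (Sh x) β (e x)).hat (k x) i r r) (by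
    rw [Real.dist_eq, sub_zero]
    exact (hx i r r).trans_lt (half_lt_self hδ))
  rw [Real.dist_eq] at h1
  simpa using h1.le

lemma sum_trace_hat : ∀ᶠ x in l, ∑ i ∈ Finset.range (k x),
    ((errorData X (Sh x) β (e x)).hat (k x) i).trace = q := by
  filter_upwards [h.isUnit_gram] with x hx
  have h1 : ∀ i, ((errorData X (Sh x) β (e x)).hat (k x) i).trace =
      ((errorData X (Sh x) β (e x)).bread (k x) * ((X i)ᵀ * (Sh x i)⁻¹ * X i)).trace := fun i => by
    change (X i * (errorData X (Sh x) β (e x)).bread (k x) * (X i)ᵀ * (Sh x i)⁻¹).trace = _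
    rw [Matrix.mul_assoc, Matrix.mul_assoc, Matrix.trace_mul_comm]
    simp only [Matrix.mul_assoc]
  simp only [h1]
  rw [← Matrix.trace_sum, ← Finset.mul_sum]
  change ((∑ i ∈ Finset.range (k x), (X i)ᵀ * (Sh x i)⁻¹ * X i)⁻¹ * _).trace = _
  rw [Matrix.nonsing_inv_mul _ ((Matrix.isUnit_iff_isUnit_det _).1 hx)]
  simp

/-- The hat matrix has trace `q` and there are at most `k p` effects, so the mean leverage is at
least of order `1 / k`, the order of each leverage; their ratio is therefore bounded. The truncation
at `4` would give an upper bound only, and no sign of the leverages is used. -/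
lemma exists_abs_exponent4_le (hq : 0 < q) : ∃ L, ∀ᶠ x in l, ∀ i (r : obs i),
    |-(errorData X (Sh x) β (e x)).exponent4 (k x) i r| ≤ L := by
  have hq' : (0 : ℝ) < q := Nat.cast_pos.2 hq
  obtain ⟨C, hC, hb⟩ := h.exists_abs_hat_le (β := β)
  refine ⟨4 + C * p / q, ?_⟩
  filter_upwards [hb, h.sum_trace_hat (β := β), h.eventually_pos] with x hx ht hk i r
  have hk' : (0 : ℝ) < k x := by exact_mod_cast hk
  have hnum : ((errorData X (Sh x) β (e x)).numEffects (k x) : ℝ) ≤ k x * p := by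
    have : (errorData X (Sh x) β (e x)).numEffects (k x) ≤ k x * p := by
      refine (Finset.sum_le_card_nsmul _ _ p fun i _ => ?_).trans (by simp)
      simpa using Finset.card_le_univ (obs i)
    exact_mod_cast this
  have hn0 : (0 : ℝ) ≤ (errorData X (Sh x) β (e x)).numEffects (k x) := Nat.cast_nonneg _
  have h1 : |(errorData X (Sh x) β (e x)).hat (k x) i r r /
      (errorData X (Sh x) β (e x)).meanLeverage (k x)| ≤ C * p / q := by
    unfold Data.meanLeverage
    rw [ht, div_div_eq_mul_div, abs_div, abs_mul, abs_of_pos hq',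
      abs_of_nonneg hn0]
    refine div_le_div_of_nonneg_right ?_ hq'.le
    calc _ ≤ C * (k x : ℝ)⁻¹ * (k x * p) := mul_le_mul (hx i r r) hnum hn0 (by positivity)
      _ = C * p := by field_simp
  rw [abs_neg, Data.exponent4, abs_le]
  have h2 : 0 ≤ C * p / q := by positivity
  constructor
  · rw [le_min_iff]
    constructor
    · linarith
    · linarith [(abs_le.1 h1).1]
  · exact (min_le_left _ _).trans (by linarith)

lemma approx_omega4star (hq : 0 < q) : UnifApprox l (fun x i => 1 + e x i ⬝ᵥ e x i)
    (fun x i => (errorData X (Sh x) β (e x)).omega4star (k x) i)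
    (fun x i => Matrix.vecMulVec (e x i) (e x i)) := by
  refine h.approx_delta_omega fun ε hε => ?_
  obtain ⟨L, hL⟩ := h.exists_abs_exponent4_le (β := β) hq
  obtain ⟨δ, hδ, hpow⟩ := exists_abs_rpow_sub_one_le L hε
  filter_upwards [hL, h.eventually_abs_hat_le (β := β) hδ] with x hx hd i r
  exact hpow _ _ (hd i r r) (hx i r)

/-- The factor `k` is split as `k · k⁻¹ · k` over bread, meat and bread, so the limit is `M₀ G₀ M₀ =
M₀`. Only weighted closeness of the middle matrices matters, which is why one proof serves all
estimators. -/
lemma tendsto_smul_sandwich [l.NeBot] {Ω : ι → ∀ i, Matrix (obs i) (obs i) ℝ}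
    (hΩ : UnifApprox l (fun x i => 1 + e x i ⬝ᵥ e x i) Ω
      (fun x i => Matrix.vecMulVec (e x i) (e x i))) :
    Tendsto (fun x => (k x : ℝ) • (errorData X (Sh x) β (e x)).sandwich (k x) (Ω x)) l (𝓝 M₀) := by
  obtain ⟨C, hC⟩ := h.average_sq
  have hp := fun i => card_obs_le (obs := obs) i
  have h1 := ((((h.approxX.transpose.mul_one_left hp (fun _ _ => zero_le_one)
    h.approxW).mul_one_left hp weight_nonneg hΩ).mul_one_right hp weight_nonneg
    h.approxW).mul_one_right hp weight_nonneg h.approxX).tendsto_average hC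
  have h2 := h1.add h.tendsto_meat
  rw [zero_add] at h2
  have h3 := (h.tendsto_bread.mul h2).mul h.tendsto_bread
  rw [h.bread_mul_gram, one_mul] at h3
  refine h3.congr' ?_
  filter_upwards [h.eventually_pos] with x hk
  have hk' : (k x : ℝ) ≠ 0 := by exact_mod_cast hk.ne'
  have e1 : ∀ A B : Matrix (Fin q) (Fin q) ℝ,
      ((k x : ℝ) • A) * ((k x : ℝ)⁻¹ • B) * ((k x : ℝ) • A) = (k x : ℝ) • (A * B * A) := by
    intro A B
    simp only [Matrix.smul_mul, Matrix.mul_smul, smul_smul]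
    congr 1
    field_simp
  rw [sub_add_cancel, e1]
  rfl

lemma tendsto_div_sub (a : ℝ) : Tendsto (fun x => (k x : ℝ) / ((k x : ℝ) - a)) l (𝓝 1) := by
  have h1 : Tendsto (fun x => (1 - a * (k x : ℝ)⁻¹)⁻¹) l (𝓝 (1 - a * 0)⁻¹) :=
    (tendsto_const_nhds.sub (h.tendsto_inv_k.const_mul a)).inv₀ (by simp)
  rw [mul_zero, sub_zero, inv_one] at h1
  refine h1.congr' ?_
  filter_upwards [h.eventually_pos] with x hk
  have hk' : (k x : ℝ) ≠ 0 := by exact_mod_cast hk.ne'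
  rw [← inv_div, sub_div, div_self hk', div_eq_mul_inv]

lemma tendsto_smul_crCov [l.NeBot] (hq : 0 < q) (c : CR) :
    Tendsto (fun x => (k x : ℝ) • (errorData X (Sh x) β (e x)).crCov (k x) c) l (𝓝 M₀) := by
  have h0 := h.tendsto_smul_sandwich (β := β) (h.approx_omega (β := β))
  cases c with
  | cr0 => exact h0
  | cr1 =>
    have := (h.tendsto_div_sub 1).smul h0
    rw [one_smul] at this
    exact this.congr fun x => smul_comm _ _ _
  | cr1star =>
    have := (h.tendsto_div_sub q).smul h0
    rw [one_smul] at this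
    exact this.congr fun x => smul_comm _ _ _
  | cr2 => exact h.tendsto_smul_sandwich (h.approx_conj_omega (h.approx_adjust2 (β := β)))
  | cr3 => exact h.tendsto_smul_sandwich (h.approx_conj_omega (h.approx_adjust3 (β := β)))
  | cr3star => exact h.tendsto_smul_sandwich (h.approx_omega3star (β := β))
  | cr4star => exact h.tendsto_smul_sandwich (h.approx_omega4star (β := β) hq)

lemma isUnit_bread [l.NeBot] : IsUnit M₀ :=
  (Matrix.isUnit_iff_isUnit_det _).2 (Matrix.isUnit_det_of_right_inverse h.bread_mul_gram)

lemma isUnit_gram_limit [l.NeBot] : IsUnit G₀ :=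
  (Matrix.isUnit_iff_isUnit_det _).2 (Matrix.isUnit_det_of_left_inverse h.bread_mul_gram)

/-- Boundedness is assumed for the bread with estimated weights only. Invertibility with the true
weights is inherited through the limit, whose determinant does not vanish. -/
lemma eventually_isUnit_gram [l.NeBot] :
    ∀ᶠ x in l, IsUnit (∑ i ∈ Finset.range (k x), (X i)ᵀ * (S i)⁻¹ * X i) := by
  have h1 : Tendsto (fun x => ((k x : ℝ)⁻¹ • ∑ i ∈ Finset.range (k x),
      (X i)ᵀ * (S i)⁻¹ * X i).det) l (𝓝 G₀.det) :=
    ((continuous_id.matrix_det).tendsto G₀).comp h.tendsto_gram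
  have hdet : G₀.det ≠ 0 := ((Matrix.isUnit_iff_isUnit_det G₀).1 h.isUnit_gram_limit).ne_zero
  filter_upwards [h1.eventually_ne hdet] with x hx
  rw [Matrix.isUnit_iff_isUnit_det, isUnit_iff_ne_zero]
  rw [Matrix.det_smul] at hx
  exact right_ne_zero_of_mul hx

/-- After normalization the two forms tend to `(M₀ s₀)' M₀⁻¹ (M₀ s₀)` and `s₀' G₀⁻¹ s₀`, which agree
because `G₀⁻¹ = M₀`. -/
lemma tendsto_quadratic_sub [l.NeBot] (hq : 0 < q) (c : CR) : Tendsto (fun x =>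
    ((errorData X (Sh x) β (e x)).betaHat (k x) - β) ⬝ᵥ
      (((errorData X (Sh x) β (e x)).crCov (k x) c)⁻¹ *ᵥ
        ((errorData X (Sh x) β (e x)).betaHat (k x) - β)) -
    (∑ i ∈ Finset.range (k x), ((X i)ᵀ * (S i)⁻¹) *ᵥ e x i) ⬝ᵥ
      (∑ i ∈ Finset.range (k x), (X i)ᵀ * (S i)⁻¹ * X i)⁻¹ *ᵥ
        ∑ i ∈ Finset.range (k x), ((X i)ᵀ * (S i)⁻¹) *ᵥ e x i) l (𝓝 0) := by
  have hcont : Continuous fun z : (Fin q → ℝ) × Matrix (Fin q) (Fin q) ℝ =>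
      z.1 ⬝ᵥ z.2 *ᵥ z.1 :=
    continuous_fst.dotProduct (continuous_snd.matrix_mulVec continuous_fst)
  have h1 := (hcont.tendsto (M₀ *ᵥ s₀, M₀⁻¹)).comp
    ((h.tendsto_sqrt_smul_betaHat_sub (β := β)).prodMk_nhds
      (tendsto_matrix_inv (h.tendsto_smul_crCov (β := β) hq c) h.isUnit_bread))
  have h2 := (hcont.tendsto (s₀, G₀⁻¹)).comp
    (h.tendsto_score.prodMk_nhds (tendsto_matrix_inv h.tendsto_gram h.isUnit_gram_limit))
  have hG : G₀⁻¹ = M₀ := Matrix.inv_eq_left_inv h.bread_mul_gram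
  have hM : (M₀ *ᵥ s₀) ⬝ᵥ M₀⁻¹ *ᵥ (M₀ *ᵥ s₀) = s₀ ⬝ᵥ G₀⁻¹ *ᵥ s₀ := by
    rw [Matrix.mulVec_mulVec, Matrix.nonsing_inv_mul _
      ((Matrix.isUnit_iff_isUnit_det _).1 h.isUnit_bread), Matrix.one_mulVec, hG, dotProduct_comm]
  have h3 := h1.sub h2
  simp only [hM, sub_self] at h3
  refine h3.congr' ?_
  filter_upwards [h.eventually_pos] with x hk
  have hk' : (0 : ℝ) < k x := by exact_mod_cast hk
  have hsq : √(k x) * √(k x) = k x := Real.mul_self_sqrt hk'.le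
  have hs0 : √(k x : ℝ) ≠ 0 := (Real.sqrt_pos.2 hk').ne'
  -- The estimator may be singular for some indices. Then both inverses are zero by convention, and
  -- the scaling rule persists.
  have hinv : ∀ (a : ℝ) (A : Matrix (Fin q) (Fin q) ℝ), a ≠ 0 → (a • A)⁻¹ = a⁻¹ • A⁻¹ :=
    fun a A ha => by
      by_cases hA : A.det = 0
      · rw [Matrix.nonsing_inv_apply_not_isUnit _ (by simp [hA]),
          Matrix.nonsing_inv_apply_not_isUnit _ (by simp [hA]), smul_zero]
      · have := Matrix.inv_smul' A (Units.mk0 a ha)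
        simpa [Units.smul_def, hA] using this
  set Z := (errorData X (Sh x) β (e x)).betaHat (k x) - β
  set s := ∑ i ∈ Finset.range (k x), ((X i)ᵀ * (S i)⁻¹) *ᵥ e x i
  simp only [Function.comp_apply, hinv _ _ hk'.ne', hinv _ _ (inv_ne_zero hk'.ne'),
    Matrix.smul_mulVec, Matrix.mulVec_smul, dotProduct_smul, smul_dotProduct, smul_eq_mul]
  have e1 : (k x : ℝ)⁻¹ * (√(k x) * √(k x)) = 1 := by rw [hsq, inv_mul_cancel₀ hk'.ne']
  have e2 : ((k x : ℝ)⁻¹)⁻¹ * ((√(k x))⁻¹ * (√(k x))⁻¹) = 1 := by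
    rw [← mul_inv, hsq, inv_inv, mul_inv_cancel₀ hk'.ne']
  congr 1
  · linear_combination (Z ⬝ᵥ ((errorData X (Sh x) β (e x)).crCov (k x) c)⁻¹ *ᵥ Z) * e1
  · linear_combination
      (s ⬝ᵥ (∑ i ∈ Finset.range (k x), (X i)ᵀ * (S i)⁻¹ * X i)⁻¹ *ᵥ s) * e2

end LimitSetting

end LimitSetting

end MetaRegression

namespace MetaRegression

/-! ### Compactness along ultrafilters -/

section UltrafilterLimits

variable {ι : Type*} (U : Ultrafilter ι)

lemma exists_tendsto_of_bounded {f : ι → ℝ} {C : ℝ} (h : ∀ᶠ x in (U : Filter ι), |f x| ≤ C) :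
    ∃ y, Tendsto f U (𝓝 y) := by
  obtain ⟨y, -, hy⟩ := (isCompact_Icc (a := -C) (b := C)).ultrafilter_le_nhds (U.map f)
    (le_principal_iff.2 (show f ⁻¹' Set.Icc (-C) C ∈ (U : Filter ι) by
      filter_upwards [h] with x hx using abs_le.1 hx))
  exact ⟨y, hy⟩

lemma exists_tendsto_vector_of_bounded {a : Type*} {f : ι → a → ℝ} {C : ℝ}
    (h : ∀ r, ∀ᶠ x in (U : Filter ι), |f x r| ≤ C) : ∃ y, Tendsto f U (𝓝 y) := by
  choose y hy using fun r => exists_tendsto_of_bounded U (h r)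
  exact ⟨y, tendsto_pi_nhds.2 hy⟩

lemma exists_tendsto_matrix_of_bounded {a b : Type*} {f : ι → Matrix a b ℝ} {C : ℝ}
    (h : ∀ r s, ∀ᶠ x in (U : Filter ι), |f x r s| ≤ C) : ∃ y, Tendsto f U (𝓝 y) := by
  choose y hy using fun r => exists_tendsto_vector_of_bounded U (h r)
  exact ⟨Matrix.of y, tendsto_pi_nhds.2 hy⟩

end UltrafilterLimits

/-! ### Stochastic bounds that produce a limit setting -/

section Model

variable {Ω : Type*} [MeasurableSpace Ω] {P : Measure Ω} [IsProbabilityMeasure P] {p q : ℕ}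
  {obs : ℕ → Finset (Fin p)} {X : ∀ i, Matrix (obs i) (Fin q) ℝ} {e : ∀ i, Ω → obs i → ℝ}
  {S : ∀ i, Matrix (obs i) (obs i) ℝ} {c C CX : ℝ}

omit [IsProbabilityMeasure P] in
lemma transpose_eq_of_isGaussianErrors (hE : IsGaussianErrors P e S) (i : ℕ) : (S i)ᵀ = S i := by
  have := (hE.posSemidef i).isHermitian
  rwa [Matrix.IsHermitian, Matrix.conjTranspose_eq_transpose_of_trivial] at this

/-- The rows of `X' W`. -/
noncomputable abbrev weightRow (X : ∀ i, Matrix (obs i) (Fin q) ℝ) (S : ∀ i, Matrix (obs i) (obs i) ℝ)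
    (r : Fin q) (i : ℕ) : obs i → ℝ := ((X i)ᵀ * (S i)⁻¹) r

lemma abs_weightRow_le (hc : 0 < c) (hS : ∀ i v, c * (v ⬝ᵥ v) ≤ v ⬝ᵥ S i *ᵥ v) (hCX : 0 ≤ CX)
    (hX : ∀ i r a, |X i r a| ≤ CX) (r : Fin q) (i : ℕ) (t : obs i) :
    |weightRow X S r i t| ≤ p * (CX * (1 / c)) :=
  abs_mul_apply_le (card_obs_le i) hCX (by positivity) (fun r t => hX i t r)
    (abs_inv_apply_le hc (hS i)) r t

omit [IsProbabilityMeasure P] in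
-- Inverse variance weighting: the covariance of `X_i' S_i⁻¹ e_i` is the contribution of study `i`
-- to the information matrix. This is why bread and meat have mutually inverse limits.
lemma weightRow_dotProduct (hE : IsGaussianErrors P e S) (hc : 0 < c)
    (hS : ∀ i v, c * (v ⬝ᵥ v) ≤ v ⬝ᵥ S i *ᵥ v) (r t : Fin q) (i : ℕ) :
    weightRow X S r i ⬝ᵥ S i *ᵥ weightRow X S t i = ((X i)ᵀ * (S i)⁻¹ * X i) r t := by
  have hu := (Matrix.isUnit_iff_isUnit_det _).1 (isUnit_of_quadratic_ge hc (hS i))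
  have e1 : (X i)ᵀ * (S i)⁻¹ * X i = (X i)ᵀ * (S i)⁻¹ * (S i * ((X i)ᵀ * (S i)⁻¹)ᵀ) := by
    rw [Matrix.transpose_mul, Matrix.transpose_transpose, Matrix.transpose_nonsing_inv,
      transpose_eq_of_isGaussianErrors hE, ← Matrix.mul_assoc (S i), Matrix.mul_nonsing_inv _ hu,
      Matrix.one_mul]
  rw [e1]
  rfl

lemma abs_gram_apply_le (hc : 0 < c) (hS : ∀ i v, c * (v ⬝ᵥ v) ≤ v ⬝ᵥ S i *ᵥ v) (hCX : 0 ≤ CX)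
    (hX : ∀ i r a, |X i r a| ≤ CX) (r t : Fin q) (i : ℕ) :
    |((X i)ᵀ * (S i)⁻¹ * X i) r t| ≤ p * (p * (CX * (1 / c)) * CX) :=
  abs_mul_apply_le (card_obs_le i) (by positivity) hCX
    (fun r t => abs_weightRow_le hc hS hCX hX r i t) (hX i) r t

lemma hasLaw_score (hE : IsGaussianErrors P e S) (hc : 0 < c)
    (hS : ∀ i v, c * (v ⬝ᵥ v) ≤ v ⬝ᵥ S i *ᵥ v) (k : ℕ) (t : Fin q → ℝ) :
    HasLaw (fun ω => t ⬝ᵥ ∑ i ∈ Finset.range k, ((X i)ᵀ * (S i)⁻¹) *ᵥ e i ω)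
      (gaussianReal 0
        (t ⬝ᵥ (∑ i ∈ Finset.range k, (X i)ᵀ * (S i)⁻¹ * X i) *ᵥ t).toNNReal) P := by
  have h1 := hE.hasLaw_sum (fun i => t ᵥ* ((X i)ᵀ * (S i)⁻¹)) k
  convert h1 using 2
  · rw [dotProduct_sum]
    exact Finset.sum_congr rfl fun i _ => Matrix.dotProduct_mulVec _ _ _
  · rw [Matrix.sum_mulVec, dotProduct_sum]
    congr 1
    refine Finset.sum_congr rfl fun i _ => ?_
    have hu := (Matrix.isUnit_iff_isUnit_det _).1 (isUnit_of_quadratic_ge hc (hS i))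
    have e1 : S i *ᵥ (t ᵥ* ((X i)ᵀ * (S i)⁻¹)) = X i *ᵥ t := by
      rw [← Matrix.mulVec_transpose, Matrix.transpose_mul, Matrix.transpose_transpose,
        Matrix.transpose_nonsing_inv, transpose_eq_of_isGaussianErrors hE, Matrix.mulVec_mulVec,
        ← Matrix.mul_assoc, Matrix.mul_nonsing_inv _ hu, Matrix.one_mul]
    rw [e1, ← Matrix.dotProduct_mulVec, Matrix.mulVec_mulVec]

omit [IsProbabilityMeasure P] in
lemma posSemidef_gram (hE : IsGaussianErrors P e S) (k : ℕ) :
    (∑ i ∈ Finset.range k, (X i)ᵀ * (S i)⁻¹ * X i).PosSemidef :=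
  Matrix.posSemidef_sum _ fun i _ => by
    have := (hE.posSemidef i).inv.conjTranspose_mul_mul_same (X i)
    rwa [Matrix.conjTranspose_eq_transpose_of_trivial] at this

omit [MeasurableSpace Ω] in
lemma score_apply (k : ℕ) (r : Fin q) (ω : Ω) :
    (∑ i ∈ Finset.range k, ((X i)ᵀ * (S i)⁻¹) *ᵥ e i ω) r =
      ∑ i ∈ Finset.range k, weightRow X S r i ⬝ᵥ e i ω := by
  rw [Finset.sum_apply]
  rfl

/-- All stochastic bounds in one: a random sequence, bounded in mean, that controls the
score, the squared errors, and the influence of the estimated weights on the score. -/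
lemma exists_control (hE : IsGaussianErrors P e S) (hc : 0 < c)
    (hS : ∀ i v, c * (v ⬝ᵥ v) ≤ v ⬝ᵥ S i *ᵥ v) (hC : 0 ≤ C) (hSC : ∀ i r t, |S i r t| ≤ C)
    (hCX : 0 ≤ CX) (hX : ∀ i r a, |X i r a| ≤ CX) :
    ∃ δ K : ℝ, 0 < δ ∧ 0 ≤ K ∧ ∀ k : ℕ, 0 < k → ∃ R : Ω → ℝ, Integrable R P ∧ (∀ ω, 0 ≤ R ω) ∧
      ∫ ω, R ω ∂P ≤ K ∧ ∀ ω,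
        (∀ r, (∑ i ∈ Finset.range k, weightRow X S r i ⬝ᵥ e i ω) ^ 2 ≤ R ω * k) ∧
        ∑ i ∈ Finset.range k, (1 + e i ω ⬝ᵥ e i ω) ≤ R ω * k ∧
        ∀ (D : Matrix (Fin p) (Fin p) ℝ) (d : ℝ), 0 ≤ d → d ≤ δ → (∀ a b, |D a b| ≤ d) → ∀ r,
          |∑ i ∈ Finset.range k, (((X i)ᵀ * (S i + block D (obs i))⁻¹) *ᵥ e i ω -
            ((X i)ᵀ * (S i)⁻¹) *ᵥ e i ω) r| ≤ d * (R ω * √k) := by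
  have hB := fun r : Fin q => exists_dominating_sub hE hc hS hC hSC hCX
    (a := fun i => (X i)ᵀ r) (fun i t => hX i t r)
  choose δ K hδ hK B hBi hB0 hBE hBD using hB
  -- One radius for the finitely many coordinates of the score.
  obtain ⟨δ', hδ', hδr⟩ : ∃ δ' > 0, ∀ r, δ' ≤ δ r := by
    rcases isEmpty_or_nonempty (Fin q) with hq | hq
    · exact ⟨1, one_pos, fun r => hq.elim r⟩
    · obtain ⟨r₀, hr₀⟩ := Finite.exists_min δ
      exact ⟨δ r₀, hδ r₀, hr₀⟩
  set g := (p : ℝ) * (p * (CX * (1 / c)) * CX)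
  have hg : 0 ≤ g := by positivity
  refine ⟨δ', q * g + (1 + p * C) + ∑ r, K r, hδ', by
    have := Finset.sum_nonneg fun r (_ : r ∈ Finset.univ) => hK r
    positivity, fun k hk => ?_⟩
  have hk' : (0 : ℝ) < k := Nat.cast_pos.2 hk
  have hsk : 0 < √(k : ℝ) := Real.sqrt_pos.2 hk'
  set R₁ : Ω → ℝ := fun ω => ∑ r, (∑ i ∈ Finset.range k, weightRow X S r i ⬝ᵥ e i ω) ^ 2
  set R₂ : Ω → ℝ := fun ω => ∑ i ∈ Finset.range k, (1 + e i ω ⬝ᵥ e i ω)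
  set R₃ : Ω → ℝ := fun ω => ∑ r, B r k ω
  have h1i : Integrable R₁ P := integrable_finsetSum _ fun r _ => hE.integrable_sum_sq _ k
  have hei : ∀ i t, HasLaw (fun ω => e i ω t) (gaussianReal 0 (S i t t).toNNReal) P :=
    fun i t => by simpa using hE.hasLaw i (Pi.single t 1)
  have hei2 : ∀ i t, Integrable (fun ω => e i ω t * e i ω t) P := fun i t => by
    simpa only [sq] using (memLp_sq_of_hasLaw_gaussianReal (hei i t)).integrable (by norm_num)
  have h2i' : ∀ i, Integrable (fun ω => 1 + e i ω ⬝ᵥ e i ω) P := fun i =>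
    (integrable_const 1).add (integrable_finsetSum _ fun t _ => hei2 i t)
  have h2i : Integrable R₂ P := integrable_finsetSum _ fun i _ => h2i' i
  have h3i : Integrable R₃ P := integrable_finsetSum _ fun r _ => hBi r k
  have h10 : ∀ ω, 0 ≤ R₁ ω := fun ω => Finset.sum_nonneg fun _ _ => sq_nonneg _
  have h20 : ∀ ω, 0 ≤ R₂ ω := fun ω => Finset.sum_nonneg fun i _ =>
    weight_nonneg (e := fun _ j => e j ω) () i
  have h30 : ∀ ω, 0 ≤ R₃ ω := fun ω => Finset.sum_nonneg fun r _ => hB0 r k ω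
  have h1E : ∫ ω, R₁ ω ∂P ≤ q * g * k := by
    rw [integral_finsetSum _ fun r _ => hE.integrable_sum_sq _ k]
    calc _ ≤ ∑ _r : Fin q, (k : ℝ) * g := by
          refine Finset.sum_le_sum fun r _ => ?_
          rw [hE.integral_sum_sq]
          calc _ ≤ ∑ _i ∈ Finset.range k, g := by
                refine Finset.sum_le_sum fun i _ => ?_
                rw [weightRow_dotProduct hE hc hS]
                exact (le_abs_self _).trans (abs_gram_apply_le hc hS hCX hX r r i)
            _ = _ := by simp
      _ = _ := by simp; ring
  have h2E : ∫ ω, R₂ ω ∂P ≤ (1 + p * C) * k := by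
    rw [integral_finsetSum _ fun i _ => h2i' i]
    calc _ ≤ ∑ _i ∈ Finset.range k, (1 + p * C) := by
          refine Finset.sum_le_sum fun i _ => ?_
          have hi : Integrable (fun ω => e i ω ⬝ᵥ e i ω) P :=
            integrable_finsetSum _ fun t _ => hei2 i t
          rw [integral_add (integrable_const 1) hi]
          simp only [integral_const, probReal_univ, smul_eq_mul, one_mul]
          gcongr
          simp only [dotProduct]
          rw [integral_finsetSum _ fun t _ => hei2 i t]
          calc _ ≤ ∑ _t : obs i, C := by
                refine Finset.sum_le_sum fun t _ => ?_
                have := integral_sq_of_hasLaw_gaussianReal (hE.posSemidef i).diag_nonneg (hei i t)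
                simp only [sq] at this
                rw [this]
                exact (le_abs_self _).trans (hSC i t t)
            _ = Fintype.card (obs i) * C := by simp
            _ ≤ p * C := by gcongr; exact card_obs_le i
      _ = _ := by simp; ring
  have h3E : ∫ ω, R₃ ω ∂P ≤ (∑ r, K r) * √k := by
    rw [integral_finsetSum _ fun r _ => hBi r k, Finset.sum_mul]
    exact Finset.sum_le_sum fun r _ => hBE r k
  -- Each of the three quantities is divided by its own order of magnitude. All three are
  -- nonnegative, so the sum dominates each of them.
  refine ⟨fun ω => R₁ ω / k + R₂ ω / k + R₃ ω / √k, ?_, ?_, ?_, ?_⟩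
  · exact ((h1i.div_const _).add (h2i.div_const _)).add (h3i.div_const _)
  · intro ω
    have := h10 ω; have := h20 ω; have := h30 ω
    positivity
  · have i12 : Integrable (fun ω => R₁ ω / k + R₂ ω / k) P := (h1i.div_const _).add (h2i.div_const _)
    rw [integral_add i12 (h3i.div_const _), integral_add (h1i.div_const _) (h2i.div_const _), integral_div, integral_div, integral_div]
    have e1 : (∫ ω, R₁ ω ∂P) / k ≤ q * g := (div_le_iff₀ hk').2 h1E
    have e2 : (∫ ω, R₂ ω ∂P) / k ≤ 1 + p * C := (div_le_iff₀ hk').2 h2E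
    have e3 : (∫ ω, R₃ ω ∂P) / √k ≤ ∑ r, K r := (div_le_iff₀ hsk).2 h3E
    linarith
  · intro ω
    have n1 : 0 ≤ R₁ ω / k := div_nonneg (h10 ω) hk'.le
    have n2 : 0 ≤ R₂ ω / k := div_nonneg (h20 ω) hk'.le
    have n3 : 0 ≤ R₃ ω / √k := div_nonneg (h30 ω) hsk.le
    refine ⟨fun r => ?_, ?_, ?_⟩
    · rw [← div_le_iff₀ hk']
      have : (∑ i ∈ Finset.range k, weightRow X S r i ⬝ᵥ e i ω) ^ 2 / k ≤ R₁ ω / k := by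
        gcongr
        exact Finset.single_le_sum
          (f := fun r => (∑ i ∈ Finset.range k, weightRow X S r i ⬝ᵥ e i ω) ^ 2)
          (fun _ _ => sq_nonneg _) (Finset.mem_univ r)
      linarith
    · rw [← div_le_iff₀ hk']
      change R₂ ω / k ≤ _
      linarith
    · intro D d hd0 hd hD r
      have h1 := hBD r k ω D d (hd.trans (hδr r)) hD
      have h2 : ∀ i, (((X i)ᵀ * (S i + block D (obs i))⁻¹) *ᵥ e i ω -
            ((X i)ᵀ * (S i)⁻¹) *ᵥ e i ω) r = (X i)ᵀ r ⬝ᵥ (S i + block D (obs i))⁻¹ *ᵥ e i ω -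
          (X i)ᵀ r ⬝ᵥ (S i)⁻¹ *ᵥ e i ω := fun i => by
        rw [← Matrix.mulVec_mulVec, ← Matrix.mulVec_mulVec]
        rfl
      simp only [h2]
      refine h1.trans ?_
      gcongr
      rw [← div_le_iff₀ hsk]
      have : B r k ω / √k ≤ R₃ ω / √k := by
        gcongr
        exact Finset.single_le_sum (f := fun r => B r k ω) (fun r _ => hB0 r k ω)
          (Finset.mem_univ r)
      linarith

/-- The law of large numbers for the middle factor of the sandwich estimator. -/
lemma tendsto_meat_sub_gram (hE : IsGaussianErrors P e S) (hc : 0 < c)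
    (hS : ∀ i v, c * (v ⬝ᵥ v) ≤ v ⬝ᵥ S i *ᵥ v) (hCX : 0 ≤ CX) (hX : ∀ i r a, |X i r a| ≤ CX) :
    Tendsto (fun x : ℕ × Ω => (x.1 : ℝ)⁻¹ • ∑ i ∈ Finset.range x.1,
      (X i)ᵀ * (S i)⁻¹ * Matrix.vecMulVec (e i x.2) (e i x.2) * (S i)⁻¹ * X i -
      (x.1 : ℝ)⁻¹ • ∑ i ∈ Finset.range x.1, (X i)ᵀ * (S i)⁻¹ * X i) (inProbability P) (𝓝 0) := by
  refine tendsto_pi_nhds.2 fun r => tendsto_pi_nhds.2 fun t => ?_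
  have hb : ∀ r i, weightRow X S r i ⬝ᵥ S i *ᵥ weightRow X S r i ≤
      p * (p * (CX * (1 / c)) * CX) := fun r i => by
    rw [weightRow_dotProduct hE hc hS]
    exact (le_abs_self _).trans (abs_gram_apply_le hc hS hCX hX r r i)
  refine (hE.tendsto_average_mul (hb r) (hb t)).congr fun x => ?_
  rw [← smul_sub, ← Finset.sum_sub_distrib, Matrix.smul_apply, Matrix.sum_apply, smul_eq_mul,
    div_eq_inv_mul]
  congr 1
  refine Finset.sum_congr rfl fun i _ => ?_
  rw [Matrix.sub_apply, weightRow_dotProduct hE hc hS]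
  congr 1
  have e1 : (X i)ᵀ * (S i)⁻¹ * Matrix.vecMulVec (e i x.2) (e i x.2) * (S i)⁻¹ * X i =
      Matrix.vecMulVec (((X i)ᵀ * (S i)⁻¹) *ᵥ e i x.2) (((X i)ᵀ * (S i)⁻¹) *ᵥ e i x.2) := by
    rw [Matrix.mul_vecMulVec, Matrix.mul_assoc, Matrix.vecMulVec_mul]
    congr 1
    rw [← Matrix.mulVec_transpose, Matrix.transpose_mul, Matrix.transpose_nonsing_inv,
      transpose_eq_of_isGaussianErrors hE]
  rw [e1]
  rfl

variable {Δ : ℕ × Ω → Matrix (Fin p) (Fin p) ℝ}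

/-- With probability arbitrarily close to one, every ultrafilter refining convergence in
probability is a limit setting. -/
lemma exists_limitSetting (hE : IsGaussianErrors P e S) (hc : 0 < c)
    (hS : ∀ i v, c * (v ⬝ᵥ v) ≤ v ⬝ᵥ S i *ᵥ v) (hC : 0 ≤ C) (hSC : ∀ i r t, |S i r t| ≤ C)
    (hCX : 0 ≤ CX) (hX : ∀ i r a, |X i r a| ≤ CX)
    (hΔ : ∀ a b, Tendsto (fun x => Δ x a b) (inProbability P) (𝓝 0)) (hΔs : ∀ x, (Δ x).IsSymm)
    (hB : ∀ η : ℝ, 0 < η → ∃ (k₀ : ℕ) (L : ℝ), ∀ k ≥ k₀, P.real {ω | ¬ (IsUnit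
        (∑ i ∈ Finset.range k, (X i)ᵀ * (S i + block (Δ (k, ω)) (obs i))⁻¹ * X i) ∧
      ∀ a b, |(k : ℝ) * (∑ i ∈ Finset.range k,
        (X i)ᵀ * (S i + block (Δ (k, ω)) (obs i))⁻¹ * X i)⁻¹ a b| ≤ L)} ≤ η)
    (η : ENNReal) (hη : 0 < η) :
    ∃ G : Set (ℕ × Ω), (∀ᶠ k in atTop, P {ω | (k, ω) ∉ G} ≤ η) ∧
      ∀ U : Ultrafilter (ℕ × Ω), (U : Filter (ℕ × Ω)) ≤ inProbability P → G ∈ U →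
        ∃ M₀ G₀ s₀, LimitSetting (U : Filter (ℕ × Ω)) Prod.fst X S
          (fun x i => S i + block (Δ x) (obs i)) (fun x i => e i x.2) M₀ G₀ s₀ := by
  obtain ⟨δ, K, hδ, hK, hR⟩ := exists_control hE hc hS hC hSC hCX hX
  choose! R hRi hR0 hRE hRc using hR
  -- Two exceptional sets share the budget; the minimum with `1` guards against an infinite `η`.
  set η' : ℝ := (min η 1).toReal / 2
  have hmin : min η 1 ≠ ⊤ := ne_top_of_le_ne_top ENNReal.one_ne_top (min_le_right _ _)
  have hη' : 0 < η' := half_pos (ENNReal.toReal_pos (lt_min hη one_pos).ne' hmin)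
  obtain ⟨k₀, L, hL⟩ := hB η' hη'
  -- The level at which Markov's inequality leaves probability at most `η'`; the added `1` keeps it
  -- positive when `K = 0`.
  set L' := (K + 1) / η'
  have hL' : 0 < L' := by positivity
  set G₁ : Set (ℕ × Ω) := {x | IsUnit
        (∑ i ∈ Finset.range x.1, (X i)ᵀ * (S i + block (Δ x) (obs i))⁻¹ * X i) ∧
      ∀ a b, |(x.1 : ℝ) * (∑ i ∈ Finset.range x.1,
        (X i)ᵀ * (S i + block (Δ x) (obs i))⁻¹ * X i)⁻¹ a b| ≤ L}
  set G₂ : Set (ℕ × Ω) := {x | R x.1 x.2 < L'}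
  refine ⟨G₁ ∩ G₂, ?_, ?_⟩
  · filter_upwards [eventually_ge_atTop k₀, eventually_gt_atTop 0] with k hk hk0
    have h1 : P.real {ω | (k, ω) ∉ G₁} ≤ η' := hL k hk
    have h2 : P.real {ω | (k, ω) ∉ G₂} ≤ η' := by
      have hm := mul_meas_ge_le_integral_of_nonneg (Eventually.of_forall (hR0 k hk0)) (hRi k hk0) L'
      have e1 : {ω | (k, ω) ∉ G₂} = {ω | L' ≤ R k ω} := by ext ω; simp [G₂]
      rw [e1]
      refine le_of_mul_le_mul_left ?_ hL'
      calc _ ≤ K := hm.trans (hRE k hk0)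
        _ ≤ K + 1 := by linarith
        _ = L' * η' := (div_mul_cancel₀ _ hη'.ne').symm
    have h3 : P.real {ω | (k, ω) ∉ G₁ ∩ G₂} ≤ (min η 1).toReal := by
      calc _ ≤ P.real ({ω | (k, ω) ∉ G₁} ∪ {ω | (k, ω) ∉ G₂}) := by
            refine measureReal_mono fun ω hω => ?_
            by_cases h : (k, ω) ∈ G₁
            · exact Or.inr fun h' => hω ⟨h, h'⟩
            · exact Or.inl h
        _ ≤ η' + η' := (measureReal_union_le _ _).trans (add_le_add h1 h2)
        _ = _ := add_halves _
    rw [measureReal_def, ENNReal.toReal_le_toReal (measure_ne_top _ _) hmin] at h3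
    exact h3.trans (min_le_left _ _)
  · intro U hU hG
    have hG₁ : ∀ᶠ x in (U : Filter (ℕ × Ω)), x ∈ G₁ := by filter_upwards [hG] with x hx using hx.1
    have hG₂ : ∀ᶠ x in (U : Filter (ℕ × Ω)), R x.1 x.2 < L' := by
      filter_upwards [hG] with x hx using hx.2
    have hfst : Tendsto (Prod.fst : ℕ × Ω → ℕ) U atTop := tendsto_fst_inProbability.mono_left hU
    have hpos : ∀ᶠ x in (U : Filter (ℕ × Ω)), 0 < x.1 := hfst.eventually_gt_atTop 0
    have hdiff : ∀ ε > 0, ∀ᶠ x in (U : Filter (ℕ × Ω)), ∀ a b, |Δ x a b| ≤ ε := fun ε hε => by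
      refine eventually_all.2 fun a => eventually_all.2 fun b => ?_
      filter_upwards [(Metric.tendsto_nhds.1 ((hΔ a b).mono_left hU)) ε hε] with x hx
      rw [Real.dist_eq, sub_zero] at hx
      exact hx.le
    obtain ⟨M₀, hM₀⟩ := exists_tendsto_matrix_of_bounded U (C := L) (f := fun x : ℕ × Ω =>
      (x.1 : ℝ) • (∑ i ∈ Finset.range x.1, (X i)ᵀ * (S i + block (Δ x) (obs i))⁻¹ * X i)⁻¹)
      fun r t => by
        filter_upwards [hG₁] with x hx
        exact hx.2 r t
    obtain ⟨G₀, hG₀⟩ := exists_tendsto_matrix_of_bounded U (C := p * (p * (CX * (1 / c)) * CX))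
      (f := fun x : ℕ × Ω => (x.1 : ℝ)⁻¹ • ∑ i ∈ Finset.range x.1, (X i)ᵀ * (S i)⁻¹ * X i)
      fun r t => by
        filter_upwards [hpos] with x hx
        have hx' : (0 : ℝ) < x.1 := Nat.cast_pos.2 hx
        rw [Matrix.smul_apply, Matrix.sum_apply, smul_eq_mul, abs_mul, abs_of_pos (inv_pos.2 hx'),
          inv_mul_le_iff₀ hx']
        refine (Finset.abs_sum_le_sum_abs _ _).trans ((Finset.sum_le_sum fun i _ =>
          abs_gram_apply_le hc hS hCX hX r t i).trans (le_of_eq ?_))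
        simp
    obtain ⟨s₀, hs₀⟩ := exists_tendsto_vector_of_bounded U (C := √L') (f := fun x : ℕ × Ω =>
      (√(x.1 : ℝ))⁻¹ • ∑ i ∈ Finset.range x.1, ((X i)ᵀ * (S i)⁻¹) *ᵥ e i x.2)
      fun r => by
        filter_upwards [hpos, hG₂] with x hx hxR
        have hx' : (0 : ℝ) < x.1 := Nat.cast_pos.2 hx
        have h1 := (hRc x.1 hx x.2).1 r
        refine Real.abs_le_sqrt ?_
        rw [Pi.smul_apply, smul_eq_mul, score_apply, mul_pow, inv_pow, Real.sq_sqrt hx'.le,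
          inv_mul_le_iff₀ hx']
        nlinarith
    refine ⟨M₀, G₀, s₀, ?_⟩
    constructor
    · exact hfst
    · exact ⟨c, hc, hS⟩
    · exact ⟨CX, hX⟩
    · exact ⟨C, hSC⟩
    · intro x i
      rw [Matrix.IsHermitian, Matrix.conjTranspose_eq_transpose_of_trivial, Matrix.transpose_add,
        transpose_eq_of_isGaussianErrors hE]
      congr 1
      ext r t
      exact (hΔs x).apply _ _
    · intro ε hε
      filter_upwards [hdiff ε hε] with x hx i r t
      simpa [block] using hx r t
    · filter_upwards [hG₁] with x hx using hx.1
    · exact hM₀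
    · exact hG₀
    · exact hs₀
    · refine tendsto_pi_nhds.2 fun r => ?_
      rw [Metric.tendsto_nhds]
      intro ε hε
      -- The estimation error of `T` is eventually below any fixed `d`, so the change of the
      -- normalized score is at most `d L'`, which is less than `ε`.
      set d := min δ (ε / (L' + 1))
      have hd : 0 < d := by positivity
      filter_upwards [hpos, hG₂, hdiff d hd] with x hx hxR hxd
      have hx' : (0 : ℝ) < x.1 := Nat.cast_pos.2 hx
      have hs : 0 < √(x.1 : ℝ) := Real.sqrt_pos.2 hx'
      have h1 := (hRc x.1 hx x.2).2.2 (Δ x) d hd.le (min_le_left _ _) hxd r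
      rw [Real.dist_eq, Pi.zero_apply, sub_zero, Pi.smul_apply, Finset.sum_apply, smul_eq_mul,
        abs_mul, abs_of_pos (inv_pos.2 hs), inv_mul_lt_iff₀ hs]
      calc _ ≤ d * (R x.1 x.2 * √x.1) := h1
        _ ≤ ε / (L' + 1) * (L' * √x.1) := by
            exact mul_le_mul (min_le_right _ _) (mul_le_mul_of_nonneg_right hxR.le hs.le)
              (mul_nonneg (hR0 x.1 hx x.2) hs.le) (by positivity)
        _ = √x.1 * (ε * (L' / (L' + 1))) := by ring
        _ < √x.1 * ε := by
            have : L' / (L' + 1) < 1 := (div_lt_one (by positivity)).2 (by linarith)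
            have h2 : ε * (L' / (L' + 1)) < ε := mul_lt_of_lt_one_right hε this
            exact mul_lt_mul_of_pos_left h2 hs
    · refine ⟨L', ?_⟩
      filter_upwards [hpos, hG₂] with x hx hxR
      have hx' : (0 : ℝ) < x.1 := Nat.cast_pos.2 hx
      refine (hRc x.1 hx x.2).2.1.trans ?_
      gcongr
    · have h1 := ((tendsto_meat_sub_gram hE hc hS hCX hX).mono_left hU).add hG₀
      simpa using h1

end Model

end MetaRegression

namespace MetaRegression

/-! ### Asymptotic equivalence and coverage -/

section MainResult

variable {Ω : Type*} [MeasurableSpace Ω] {P : Measure Ω} [IsProbabilityMeasure P] {p q : ℕ}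
  {obs : ℕ → Finset (Fin p)} {X : ∀ i, Matrix (obs i) (Fin q) ℝ} {e : ∀ i, Ω → obs i → ℝ}
  {S : ∀ i, Matrix (obs i) (obs i) ℝ} {Sh : ℕ × Ω → ∀ i, Matrix (obs i) (obs i) ℝ}
  {β : Fin q → ℝ}

omit [IsProbabilityMeasure P] in
lemma asympEquiv_of_tendsto {A B : ℕ → Ω → Matrix (Fin q) (Fin q) ℝ}
    (h : ∀ a b, Tendsto (fun x : ℕ × Ω => (x.1 : ℝ) * (A x.1 x.2 a b - B x.1 x.2 a b))
      (inProbability P) (𝓝 0)) : AsympEquiv P A B := by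
  refine ⟨fun a b => tendstoInMeasure_const_iff.2 ?_, fun a b => tendstoInMeasure_const_iff.2 (h a b)⟩
  have h1 : Tendsto (fun x : ℕ × Ω => (x.1 : ℝ)⁻¹) (inProbability P) (𝓝 0) :=
    tendsto_inv_atTop_zero.comp (tendsto_natCast_atTop_atTop.comp tendsto_fst_inProbability)
  have h2 := h1.mul (h a b)
  rw [mul_zero] at h2
  refine h2.congr' ?_
  filter_upwards [tendsto_fst_inProbability.eventually_gt_atTop 0] with x hx
  rw [inv_mul_cancel_left₀ (Nat.cast_pos.2 hx).ne']

/-- A property of the index alone that holds with probability tending to one holds eventually. -/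
lemma eventually_of_eventually_inProbability {Q : ℕ → Prop}
    (h : ∀ᶠ x : ℕ × Ω in inProbability P, Q x.1) : ∀ᶠ k in atTop, Q k := by
  have h1 := (mem_inProbability.1 h).eventually (gt_mem_nhds (zero_lt_one' ENNReal))
  filter_upwards [h1] with k hk
  by_contra hQ
  simp [hQ] at hk

/-- Confidence regions of cluster-robust estimators, for working covariance matrices such that
every ultrafilter of high probability is a limit setting. -/
lemma asympEquiv_and_tendsto_coverage (hq : 0 < q) (hE : IsGaussianErrors P e S) {c₀ : ℝ}
    (hc : 0 < c₀) (hS : ∀ i v, c₀ * (v ⬝ᵥ v) ≤ v ⬝ᵥ S i *ᵥ v)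
    (h : ∀ η : ENNReal, 0 < η → ∃ G : Set (ℕ × Ω), (∀ᶠ k in atTop, P {ω | (k, ω) ∉ G} ≤ η) ∧
      ∀ U : Ultrafilter (ℕ × Ω), (U : Filter (ℕ × Ω)) ≤ inProbability P → G ∈ U →
        ∃ M₀ G₀ s₀, LimitSetting (U : Filter (ℕ × Ω)) Prod.fst X S Sh (fun x i => e i x.2)
          M₀ G₀ s₀) :
    (∀ c c' : CR, AsympEquiv P
      (fun k ω => (errorData X (Sh (k, ω)) β fun i => e i ω).crCov k c)
      fun k ω => (errorData X (Sh (k, ω)) β fun i => e i ω).crCov k c') ∧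
    ∀ (c : CR) (α : ℝ), 0 < α → α < 1 → Tendsto (fun k => P.real {ω | β ∈
      (errorData X (Sh (k, ω)) β fun i => e i ω).confRegion k c α}) atTop (𝓝 (1 - α)) := by
  refine ⟨fun c c' => asympEquiv_of_tendsto fun a b => ?_, fun c α hα₀ hα₁ => ?_⟩
  · refine tendsto_inProbability_of_ultrafilter fun η hη => ?_
    obtain ⟨G, hG, hU⟩ := h η hη
    refine ⟨G, hG, fun U hUle hGU => ?_⟩
    obtain ⟨M₀, G₀, s₀, hL⟩ := hU U hUle hGU
    have h1 := (hL.tendsto_smul_crCov (β := β) hq c).sub (hL.tendsto_smul_crCov (β := β) hq c')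
    rw [sub_self] at h1
    refine ((tendsto_pi_nhds.1 (tendsto_pi_nhds.1 h1 a)) b).congr fun x => ?_
    simp only [Matrix.sub_apply, Matrix.smul_apply, smul_eq_mul, mul_sub]
  · obtain ⟨t, ht, htα⟩ := exists_cdf_chiSq_eq hq (sub_pos.2 hα₁) (sub_lt_self 1 hα₀)
    -- The matrix with the true weights is nonrandom, so invertibility in probability is
    -- invertibility for all large `k`.
    have hgram : ∀ᶠ k in atTop, IsUnit (∑ i ∈ Finset.range k, (X i)ᵀ * (S i)⁻¹ * X i) := by
      refine eventually_of_eventually_inProbability (P := P) (tendsto_nhds_true.1 ?_)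
      refine tendsto_inProbability_of_ultrafilter fun η hη => ?_
      obtain ⟨G, hG, hU⟩ := h η hη
      refine ⟨G, hG, fun U hUle hGU => ?_⟩
      obtain ⟨M₀, G₀, s₀, hL⟩ := hU U hUle hGU
      exact tendsto_nhds_true.2 hL.eventually_isUnit_gram
    have hcdf : ∀ᶠ k in atTop, ∀ x, P.real {ω |
        (∑ i ∈ Finset.range k, ((X i)ᵀ * (S i)⁻¹) *ᵥ e i ω) ⬝ᵥ
          (∑ i ∈ Finset.range k, (X i)ᵀ * (S i)⁻¹ * X i)⁻¹ *ᵥ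
            (∑ i ∈ Finset.range k, ((X i)ᵀ * (S i)⁻¹) *ᵥ e i ω) ≤ x} = cdf (chiSq q) x := by
      filter_upwards [hgram] with k hk x
      exact measureReal_quadratic_le_eq_cdf_chiSq
        ((posSemidef_gram hE k).posDef_iff_isUnit.2 hk) (hasLaw_score hE hc hS k) x
    -- The subtraction in the degrees of freedom is truncated, which does not matter for large `k`.
    have hdf : Tendsto (fun k : ℕ => max 2 (k - q)) atTop atTop :=
      tendsto_atTop_mono (fun k => le_max_right _ _) (tendsto_sub_atTop_nat q)
    rw [← htα]
    refine tendsto_measureReal_le_of_tendsto_sub (continuous_cdf_chiSq hq) hcdf ?_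
      ((tendsto_mul_quantile_fDist hq (sub_pos.2 hα₁) ht htα).comp hdf)
    refine tendsto_inProbability_of_ultrafilter fun η hη => ?_
    obtain ⟨G, hG, hU⟩ := h η hη
    refine ⟨G, hG, fun U hUle hGU => ?_⟩
    obtain ⟨M₀, G₀, s₀, hL⟩ := hU U hUle hGU
    exact hL.tendsto_quadratic_sub (β := β) hq c

end MainResult

lemma abs_le_sum_abs {p : ℕ} (T : Matrix (Fin p) (Fin p) ℝ) (a b : Fin p) :
    |T a b| ≤ ∑ a, ∑ b, |T a b| :=
  (Finset.single_le_sum (f := fun b => |T a b|) (fun _ _ => abs_nonneg _)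
    (Finset.mem_univ b)).trans (Finset.single_le_sum (f := fun a => ∑ b, |T a b|)
      (fun _ _ => Finset.sum_nonneg fun _ _ => abs_nonneg _) (Finset.mem_univ a))

end MetaRegression

theorem mainTheorem1 {Ω : Type*} [MeasurableSpace Ω] (P : Measure Ω) [IsProbabilityMeasure P]
    (p q : ℕ) (hq : 0 < q) (α : ℝ) (hα₀ : 0 < α) (hα₁ : α < 1)
    -- the studies: reported effects, design matrices, within- and between-study covariances
    (obs : ℕ → Finset (Fin p))
    (X : ∀ i, Matrix (obs i) (Fin q) ℝ)
    (V : ∀ i, Matrix (obs i) (obs i) ℝ) (hV : ∀ i, (V i).PosSemidef)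
    (T : Matrix (Fin p) (Fin p) ℝ) (hT : T.PosSemidef)
    (β : Fin q → ℝ)
    -- the mixed-effects model `Y_i = X_i β + u_i + ε_i` with independent studies
    (u ε Y : ∀ i, Ω → EuclideanSpace ℝ (obs i))
    (hu : ∀ i, HasLaw (u i) (multivariateGaussian 0 (MetaRegression.block T (obs i))) P)
    (hε : ∀ i, HasLaw (ε i) (multivariateGaussian 0 (V i)) P)
    (huε : ∀ i, IndepFun (u i) (ε i) P)
    (hind : iIndepFun (fun i ω => (u i ω, ε i ω)) P)
    (hY : ∀ i ω r, Y i ω r = (X i *ᵥ β) r + u i ω r + ε i ω r)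
    -- uniform boundedness and nondegeneracy of the studies
    (hXb : ∃ C : ℝ, ∀ i r a, |X i r a| ≤ C)
    (hVb : ∃ C : ℝ, ∀ i r s, |V i r s| ≤ C)
    (hnd : ∃ c : ℝ, 0 < c ∧ ∀ i (v : obs i → ℝ),
      c * (v ⬝ᵥ v) ≤ v ⬝ᵥ ((MetaRegression.block T (obs i) + V i) *ᵥ v))
    -- the estimator of `T` from the first `k` studies, and its consistency
    (That : ℕ → Ω → Matrix (Fin p) (Fin p) ℝ)
    (hTm : ∀ k a b, AEMeasurable (fun ω => That k ω a b) P)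
    (hTs : ∀ k ω, (That k ω).IsSymm)
    (hTc : ∀ a b, TendstoInMeasure P (fun k ω => That k ω a b) atTop fun _ => T a b)
    -- the data with working covariance matrices `That_i + V_i`
    (D : ℕ → Ω → MetaRegression.Data p q)
    (hD : ∀ k ω, D k ω =
      { obs := obs
        X := X
        S := fun i => MetaRegression.block (That k ω) (obs i) + V i
        Y := fun i => Y i ω })
    -- `k (X' W X)⁻¹` exists and is uniformly bounded for `k ≥ k₀`, in probability
    (hB : ∀ η : ℝ, 0 < η → ∃ (k₀ : ℕ) (C : ℝ), ∀ k ≥ k₀,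
      P.real {ω | ¬ (IsUnit ((D k ω).gram k) ∧
        ∀ a b, |(k : ℝ) * ((D k ω).gram k)⁻¹ a b| ≤ C)} ≤ η) :
    (∀ c c' : MetaRegression.CR,
      MetaRegression.AsympEquiv P (fun k ω => (D k ω).crCov k c) fun k ω => (D k ω).crCov k c') ∧
    (∀ c : MetaRegression.CR,
      Tendsto (fun k => P.real {ω | β ∈ (D k ω).confRegion k c α}) atTop (𝓝 (1 - α))) := by
  obtain ⟨CX, hCX⟩ := hXb
  obtain ⟨CV, hCV⟩ := hVb
  obtain ⟨c₀, hc₀, hc⟩ := hnd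
  set e : ∀ i, Ω → obs i → ℝ := fun i ω => (u i ω).ofLp + (ε i ω).ofLp with he
  set Δ : ℕ × Ω → Matrix (Fin p) (Fin p) ℝ := fun x => That x.1 x.2 - T with hΔ
  have hE : MetaRegression.IsGaussianErrors P e
      (fun i => MetaRegression.block T (obs i) + V i) :=
    MetaRegression.isGaussianErrors_of_multivariateGaussian (fun i => hT.submatrix _) hV hu hε
      huε hind
  -- The working covariance is rewritten as the true one plus a block of the estimation error of
  -- `T`, the form in which the perturbation bounds are stated.
  have hDe : ∀ k ω, D k ω = MetaRegression.errorData X (fun i =>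
      MetaRegression.block T (obs i) + V i + MetaRegression.block (Δ (k, ω)) (obs i)) β
        fun i => e i ω := by
    intro k ω
    rw [hD, MetaRegression.errorData]
    congr 1
    · funext i
      ext r t
      simp only [hΔ, MetaRegression.block, Matrix.add_apply, Matrix.submatrix_apply,
        Matrix.sub_apply]
      ring
    · funext i r
      rw [hY, add_assoc]
      rfl
  have hΔ0 : ∀ a b, Tendsto (fun x => Δ x a b) (MetaRegression.inProbability P) (𝓝 0) := by
    intro a b
    have h1 := (MetaRegression.tendstoInMeasure_const_iff.1 (hTc a b)).sub_const (T a b)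
    rw [sub_self] at h1
    exact h1
  have hΔs : ∀ x, (Δ x).IsSymm := by
    refine fun x => (hTs x.1 x.2).sub ?_
    have := hT.isHermitian
    rwa [Matrix.IsHermitian, Matrix.conjTranspose_eq_transpose_of_trivial] at this
  have hSb : ∀ i r t, |(MetaRegression.block T (obs i) + V i) r t| ≤
      (∑ a, ∑ b, |T a b|) + |CV| := fun i r t =>
    (abs_add_le _ _).trans (add_le_add (MetaRegression.abs_le_sum_abs T _ _)
      ((hCV i r t).trans (le_abs_self _)))
  simp only [hDe] at hB ⊢
  have h := MetaRegression.exists_limitSetting hE hc₀ hc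
    (add_nonneg (Finset.sum_nonneg fun _ _ => Finset.sum_nonneg fun _ _ => abs_nonneg _)
      (abs_nonneg _)) hSb (abs_nonneg CX) (fun i r a => (hCX i r a).trans (le_abs_self _))
    hΔ0 hΔs hB
  have hmain := MetaRegression.asympEquiv_and_tendsto_coverage (β := β) hq hE hc₀ hc h
  exact ⟨hmain.1, fun c => hmain.2 c α hα₀ hα₁⟩
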